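/- **Setting.** Let $1\le k<n$, let $\kappa_1<\dots<\kappa_n$ be real, and let $[A]$ be a point of the totally nonnegative Grassmannian $Gr^{TNN}(k,n)=GL_k^+\backslash\{k\times n$ real matrices of rank $k$ with nonnegative maximal minors$\}$, with reduced row echelon matrix $R=(R^r_j)$ and pivots $i_1<\dots<i_k$. KP times are sequences $\vec t=(t_1,t_2,\dots)\in\mathbb C^{\mathbb N}$ with finitely many nonzero terms; $\theta(\zeta,\vec t)=\sum_{l\ge1}\zeta^l t_l$ and $f^{(r)}(\vec t)=\sum_{j=1}^n R^r_j e^{\theta(\kappa_j,\vec t)}$, $r\in[k]$. **Le-graph.** Let $D$ be the Le-diagram of the positroid cell of $[A]$, i.e. the diagram with pivot set $\{i_1,\dots,i_k\}$, boxes $B_{i_rj}$ ($j$ a non-pivot, $j>i_r$) filled with $0$ or $1$ subject to the Le-rule, such that $[A]$ is represented by a Le-network with positive weights on the Le-graph of $D$ (such a $D$ exists): for $j>i_r$, $R^r_j=(-1)^{\#\{s:\,i_r<i_s<j\}}$ times the sum of the weights of the directed paths from $b_{i_r}$ to $b_j$. Let $g$ be the number of filled boxes; it is the dimension of the cell. The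 trivalent bipartite Le-graph has boundary vertices $b_1,\dots,b_n$, a white vertex $V_{i_r}$ for each $r$, and a black vertex $V'_{i_rj}$ and a white vertex $V_{i_rj}$ for each filled box $B_{i_rj}$. Its edges join: $V'_{i_rj}$ to $V_{i_rj}$; each white vertex to the black vertex of the next filled box to its left in its row, if there is one; $V_{i_r}$ to $b_{i_r}$; and $V_{i_rj}$ to the black vertex of the next filled box below it in column $j$, or to $b_j$ if there is none. **Curve.** $\Gamma$ consists of one copy of $\mathbb{CP}^1$ for each white vertex, one for each black vertex, and $\Gamma_0=\mathbb{CP}^1$ with marked points $\kappa_1,\dots,\kappa_n$ and $P_0=\infty$. On a white component let $P^{(1)},P^{(2)},P^{(3)}$, and on a black component let $Q^{(1)},Q^{(2)},Q^{(3)}$, be the points with coordinate $\zeta=0,1,\infty$. Each edge glues two points: a horizontal edge from a white vertex to the black vertex on its left glues $P^{(1)}$ to $Q^{(2)}$; the edge $V'_{i_rj}V_{i_rj}$ glues $Q^{(1)}$ to $P^{(3)}$; a vertical edge glues $P^{(2)}$ of its upper vertex to $Q^{(3)}$ of the black vertex below, or to $\kappa_j\in\Gamma_0$ if it ends at $b_j$.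 The Darboux points are the points $P^{(3)}_{i_r}$, $r\in[k]$, at $\zeta=\infty$ on the components of $V_{i_r}$. The glued points cut the real circles $\mathbb{RP}^1$ of the components into arcs. An oval is a maximal chain of (closed) arcs in which an arc traversed in the direction of increasing $\zeta$ and ending at a glued point is continued by the arc that starts at its partner; ovals correspond to the faces of the Le-graph. The infinite oval $\Omega_0$ is the one containing $P_0$; the others are finite. **Definitions.** A *real and regular vacuum divisor* is an effective divisor $\mathcal D$ of degree $g$ on $\Gamma\setminus\Gamma_0$ such that: (i) $\mathcal D$ is contained in the union of the ovals; (ii) there is exactly one divisor point, of multiplicity one, on the component of each white vertex that has a horizontal edge to its left (the trivalent white vertices, and the $V_{i_r}$ with a filled box in row $r$); (iii) on each finite oval the number of divisor points plus the number of Darboux points is odd; (iv) on $\Omega_0$ the number of divisor points plus the number of Darboux points minus $k$ is even. A *real and regular vacuum wave function* with initial time $\vec t_0$ and divisor $\mathcal D$ is a function $\hat\phi(P,\vec t)\in\mathbb C\cup\{\infty\}$, $P\in\Gamma\setminus\{P_0\}$, such that: $\hat\phi(P,\vec t_0)=1$ for all $P$; $\hat\phi(\zeta,\vec t)=e^{\theta(\zeta,\vec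 t-\vec t_0)}$ on $\Gamma_0\setminus\{P_0\}$; for $P\notin\mathcal D$ on the other components, $\hat\phi(P,\cdot)$ solves the heat hierarchy $\partial_{t_l}\hat\phi=\partial_{t_1}^l\hat\phi$, $l\ge 1$; $\hat\phi$ is real (or $\infty$) when $\vec t$ and $\zeta(P)$ are real; $\hat\phi$ takes equal values at glued points for all $\vec t$; for each $\vec t$, on every component other than $\Gamma_0$, $\hat\phi(\cdot,\vec t)$ is meromorphic with $(\hat\phi)+\mathcal D\ge0$; for $P\notin\mathcal D$, $P\neq P_0$, $\hat\phi(P,\cdot)$ is finite and holomorphic in $\vec t$ for all $\vec t$. **Theorem.** There is a real initial time $\vec t_0$ with $f^{(r)}(\vec t_0)\ne0$ for all $r\in[k]$ such that there is a unique real and regular vacuum divisor $\mathcal D$ of degree $g$ for which there exists a real and regular vacuum wave function $\hat\phi$ with initial time $\vec t_0$ and divisor $\mathcal D$ satisfying $$\hat\phi(P^{(3)}_{i_r},\vec t)=\frac{f^{(r)}(\vec t)}{f^{(r)}(\vec t_0)},\qquad r\in[k],\ \text{for all }\vec t,$$ and for this $\mathcal D$ the wave function $\hat\phi$ is unique. Moreover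 $\mathcal D$ is the pole divisor of $\hat\phi$: at each of its $g$ points, $\hat\phi(\cdot,\vec t)$ has a simple pole for some real $\vec t$. -/

import Mathlib

open Filter Topology

namespace KPSoliton

/-! ### Soliton data -/

/-- `A` is a `k × n` matrix of rank `k` all of whose maximal minors are nonnegative, so that it
represents a point of the totally nonnegative Grassmannian. -/
def IsTNN {k n : ℕ} (A : Matrix (Fin k) (Fin n) ℝ) : Prop :=
  A.rank = k ∧ ∀ J : Fin k ↪o Fin n, 0 ≤ (A.submatrix id J).det

/-- `A` and `B` represent the same point of the quotient by `GL_k^+`. -/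
def SamePoint {k n : ℕ} (A B : Matrix (Fin k) (Fin n) ℝ) : Prop :=
  ∃ g : Matrix (Fin k) (Fin k) ℝ, 0 < g.det ∧ B = g * A

/-- Reduced row echelon form (of full rank). -/
def IsRREF {k n : ℕ} (R : Matrix (Fin k) (Fin n) ℝ) : Prop :=
  ∃ p : Fin k ↪o Fin n,
    (∀ r s, R r (p s) = if r = s then 1 else 0) ∧ ∀ r j, j < p r → R r j = 0

/-- The KP times `(t₁, t₂, …)`, only finitely many of which are nonzero. -/
abbrev Times : Type := ℕ+ →₀ ℂ

/-- Real KP times. -/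
abbrev RealTimes : Type := ℕ+ →₀ ℝ

/-- Real times as complex times. -/
noncomputable def RealTimes.toComplex (t : RealTimes) : Times :=
  Finsupp.mapRange Complex.ofReal Complex.ofReal_zero t

/-- `θ(ζ, t) = ∑ ζ^l t_l`. -/
noncomputable def theta (ζ : ℂ) (t : Times) : ℂ := t.sum fun l a => ζ ^ (l : ℕ) * a

/-- The heat hierarchy solution `f^{(r)}(t) = ∑_j R^r_j exp(θ(κ_j, t))`. -/
noncomputable def generator {k n : ℕ} (κ : Fin n → ℝ) (R : Matrix (Fin k) (Fin n) ℝ) (r : Fin k)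
    (t : Times) : ℂ :=
  ∑ j, (R r j : ℂ) * Complex.exp (theta (κ j : ℂ) t)

/-! ### Le-diagrams and Le-networks -/

/-- A Le-diagram whose Young diagram fits in the `k × (n - k)` rectangle. The shape is given by the
pivot set; the box `B_{i_r j}` (row `r`, column labelled by the non-pivot `j`) belongs to the Young
diagram iff `i_r < j`. `boxes` is the set of boxes filled with `1`; rows are numbered from top to
bottom and the column labels increase from right to left. -/
structure LeDiagram (k n : ℕ) where
  pivot : Fin k ↪o Fin n
  boxes : Finset (Fin k × Fin n)
  isBox : ∀ b ∈ boxes, b.2 ∉ Set.range pivot ∧ pivot b.1 < b.2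
  le_rule : ∀ r s j l, r < s → j < l → (r, j) ∈ boxes → (s, l) ∈ boxes → pivot s < j →
    (s, j) ∈ boxes

namespace LeDiagram

variable {k n : ℕ} (D : LeDiagram k n)

/-- The internal white vertices of the trivalent bipartite Le-graph: `V_{i_r j}` for each filled box
`(r, j)`, and `V_{i_r}`, which is encoded as `(r, i_r)`. The internal black vertices are the
`V'_{i_r j}` for the filled boxes `(r, j)`. -/
def whites : Finset (Fin k × Fin n) := D.boxes ∪ Finset.univ.image fun r => (r, D.pivot r)

/-- A horizontal edge joins the white vertex `v` to the black vertex `b` of the next filled box to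
the left of `v` in the same row. -/
def Horizontal (v b : Fin k × Fin n) : Prop :=
  v ∈ D.whites ∧ b ∈ D.boxes ∧ b.1 = v.1 ∧ v.2 < b.2 ∧
    ∀ b' ∈ D.boxes, b'.1 = v.1 → v.2 < b'.2 → b.2 ≤ b'.2

/-- A vertical edge joins the white vertex `v` to the black vertex `b` of the next filled box below
`v` in the same column. -/
def Vertical (v b : Fin k × Fin n) : Prop :=
  v ∈ D.whites ∧ b ∈ D.boxes ∧ b.2 = v.2 ∧ v.1 < b.1 ∧
    ∀ b' ∈ D.boxes, b'.2 = v.2 → v.1 < b'.1 → b.1 ≤ b'.1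

/-- If there is no filled box below the white vertex `v`, its vertical edge joins it to the boundary
vertex with the label of its column (for `V_{i_r}` this is always the case: the label is `i_r`). -/
def ToBoundary (v : Fin k × Fin n) : Prop :=
  v ∈ D.whites ∧ ∀ b ∈ D.boxes, b.2 = v.2 → ¬ v.1 < b.1

end LeDiagram

/-- Labels for the vertices of the bipartite Le-network: boundary vertices `b_j`, white and black
internal vertices. Labels of internal vertices at which there is no vertex carry no edge. -/
abbrev NetVertex (k n : ℕ) : Type := Fin n ⊕ ((Fin k × Fin n) ⊕ (Fin k × Fin n))

namespace LeDiagram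

variable {k n : ℕ} (D : LeDiagram k n)

open Classical in
/-- The weighted adjacency matrix of the acyclically oriented bipartite Le-network with box weights
`w`: the edge from `b_{i_r}` up to `V_{i_r}`, the horizontal edges from a white vertex to the black
vertex `b` on its left (of weight `w b`), the edges from `V'_b` to `V_b`, and the vertical edges
pointing downwards from `V_b`; the weights not mentioned are `1`. -/
noncomputable def adjacency (w : Fin k × Fin n → ℝ) :
    Matrix (NetVertex k n) (NetVertex k n) ℝ
  | .inl j, .inr (.inl v) => if v.2 = j ∧ D.pivot v.1 = j then 1 else 0
  | .inr (.inl v), .inr (.inr b) =>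
      if D.Horizontal v b then w b else if D.Vertical v b then 1 else 0
  | .inr (.inr b), .inr (.inl v) => if v = b ∧ b ∈ D.boxes then 1 else 0
  | .inr (.inl v), .inl j => if v ∈ D.boxes ∧ D.ToBoundary v ∧ v.2 = j then 1 else 0
  | _, _ => 0

/-- The sum over all directed paths from `u` to `v` of the products of the edge weights. The entry
`(u, v)` of the `m`-th power of the adjacency matrix is the sum over the paths of length `m`, and in
an acyclic network every path has fewer edges than there are vertices. -/
noncomputable def pathSum (w : Fin k × Fin n → ℝ) (u v : NetVertex k n) : ℝ :=
  ∑ m ∈ Finset.range (Fintype.card (NetVertex k n)), (D.adjacency w ^ m) u v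

/-- The matrix (in reduced row echelon form) of the Le-network with weights `w`. -/
noncomputable def networkMatrix (w : Fin k × Fin n → ℝ) : Matrix (Fin k) (Fin n) ℝ := fun r j =>
  if j < D.pivot r then 0
  else if j = D.pivot r then 1
  else (-1) ^ (Finset.univ.filter fun s => D.pivot r < D.pivot s ∧ D.pivot s < j).card *
    D.pathSum w (.inl (D.pivot r)) (.inl j)

/-- `D` is the Le-diagram of (the positroid cell of) the point with reduced row echelon matrix `R`:
for some positive weights of the filled boxes, the Le-network represents this point. -/
def Represents (R : Matrix (Fin k) (Fin n) ℝ) : Prop :=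
  ∃ w : Fin k × Fin n → ℝ, (∀ b ∈ D.boxes, 0 < w b) ∧ D.networkMatrix w = R

/-- The dimension of the positroid cell: the number of filled boxes. -/
def dim : ℕ := D.boxes.card

/-! ### The reducible rational curve -/

/-- The irreducible components of the curve, each of them a copy of the Riemann sphere: `base` is
`Γ₀`, `white v` is `Γ_{i_r j}` or `Γ_{i_r}`, and `black b` is `Σ_{i_r j}`. -/
inductive Component : Type
  | base : Component
  | white (v : {v : Fin k × Fin n // v ∈ D.whites}) : Component
  | black (b : {b : Fin k × Fin n // b ∈ D.boxes}) : Component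

/-- A point of a component, with its affine coordinate in `ℂ ∪ {∞}`. The points of the curve are
these up to identification of the pairs of glued points. -/
abbrev Point : Type := D.Component × OnePoint ℂ

/-- A real point of a component, with its affine coordinate in `ℝ ∪ {∞}`; here `∞ = ⊤`. -/
abbrev RealPoint : Type := D.Component × WithTop ℝ

end LeDiagram

/-- The inclusion of `ℝ ∪ {∞}` in `ℂ ∪ {∞}`. -/
noncomputable def toSphere : WithTop ℝ → OnePoint ℂ
  | ⊤ => OnePoint.infty
  | (x : ℝ) => ((x : ℂ) : OnePoint ℂ)

namespace LeDiagram

variable {k n : ℕ} (D : LeDiagram k n)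

/-- The point of the curve given by a real point. -/
noncomputable def RealPoint.toPoint {D : LeDiagram k n} (p : D.RealPoint) : D.Point :=
  (p.1, toSphere p.2)

/-- The essential singularity `P₀`. -/
def P0 : D.Point := (.base, OnePoint.infty)

/-- The white vertex `V_{i_r}`. -/
def source (r : Fin k) : {v : Fin k × Fin n // v ∈ D.whites} :=
  ⟨(r, D.pivot r), Finset.mem_union_right _ (Finset.mem_image_of_mem _ (Finset.mem_univ r))⟩

/-- The Darboux point `P^{(3)}_{i_r}`. -/
def darboux (r : Fin k) : D.Point := (.white (D.source r), OnePoint.infty)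

/-- The gluing rules. The marked points `P^{(1)}, P^{(2)}, P^{(3)}` of a white component and
`Q^{(1)}, Q^{(2)}, Q^{(3)}` of a black component have coordinates `0, 1, ∞`; there is one double
point for each edge of the Le-graph. -/
inductive Glued (κ : Fin n → ℝ) : D.RealPoint → D.RealPoint → Prop
  | horizontal (v b) (h : D.Horizontal v.1 b.1) :
      Glued κ (.white v, ((0 : ℝ) : WithTop ℝ)) (.black b, ((1 : ℝ) : WithTop ℝ))
  | middle (v b) (h : v.1 = b.1) :
      Glued κ (.white v, ⊤) (.black b, ((0 : ℝ) : WithTop ℝ))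
  | vertical (v b) (h : D.Vertical v.1 b.1) :
      Glued κ (.white v, ((1 : ℝ) : WithTop ℝ)) (.black b, ⊤)
  | boundary (v) (h : D.ToBoundary v.1) :
      Glued κ (.white v, ((1 : ℝ) : WithTop ℝ)) (.base, ((κ v.1.2 : ℝ) : WithTop ℝ))

/-- `p` and `q` are glued together. -/
def Partner (κ : Fin n → ℝ) (p q : D.RealPoint) : Prop := D.Glued κ p q ∨ D.Glued κ q p

/-- `p` is a double point. -/
def IsDouble (κ : Fin n → ℝ) (p : D.RealPoint) : Prop := ∃ q, D.Partner κ p q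

/-! ### The ovals -/

end LeDiagram

/-- The open arc of the circle `ℝ ∪ {∞}` from `a` to `b` in the direction of increasing coordinate
(for `a = b` the whole circle without `a`). -/
noncomputable def openArc (a b : WithTop ℝ) : Set (WithTop ℝ) :=
  if a < b then Set.Ioo a b else Set.Ioi a ∪ Set.Iio b

namespace LeDiagram

variable {k n : ℕ} (D : LeDiagram k n)

/-- On the real part of the component `c`, the arc from `a` to `b` joins two consecutive
double points. -/
def IsArc (κ : Fin n → ℝ) (c : D.Component) (a b : WithTop ℝ) : Prop :=
  D.IsDouble κ (c, a) ∧ D.IsDouble κ (c, b) ∧ ∀ x ∈ openArc a b, ¬ D.IsDouble κ (c, x)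

/-- The arc starting at the double point `p` ends at a double point that is glued to `q`; the oval
continues with the arc starting at `q`. (All coordinates increase in the direction induced by the
same orientation of the plane; hence at a double point the arc arriving at one of the two glued
points is adjacent to the arc leaving from the other one. The ovals correspond to the faces of the
Le-graph.) -/
def NextArc (κ : Fin n → ℝ) (p q : D.RealPoint) : Prop :=
  ∃ b, D.IsArc κ p.1 p.2 b ∧ D.Partner κ (p.1, b) q

/-- The oval that contains the arc starting at the double point `p`, as a set of points of the
components: the union of the (closed) arcs met by continuing the given arc through double points. -/
def ovalThrough (κ : Fin n → ℝ) (p : D.RealPoint) : Set D.Point :=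
  {x | ∃ q : D.RealPoint, Relation.EqvGen (D.NextArc κ) p q ∧
    ∃ b, D.IsArc κ q.1 q.2 b ∧
      ∃ y, (y ∈ openArc q.2 b ∨ y = q.2 ∨ y = b) ∧ x = RealPoint.toPoint (D := D) (q.1, y)}

/-- `S` is an oval of the curve. -/
def IsOval (κ : Fin n → ℝ) (S : Set D.Point) : Prop :=
  ∃ p, D.IsDouble κ p ∧ S = D.ovalThrough κ p

/-- The points of the curve that lie on `Γ₀`, including the double points there. -/
def OnBase (κ : Fin n → ℝ) (x : D.Point) : Prop :=
  x.1 = .base ∨ ∃ p q : D.RealPoint, x = RealPoint.toPoint p ∧ D.Partner κ p q ∧ q.1 = .base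

/-! ### Divisors -/

open Classical in
/-- The degree of the part of an effective divisor that lies in a set of points. -/
noncomputable def degreeOn {D : LeDiagram k n} (δ : D.Point →₀ ℕ) (S : Set D.Point) : ℕ :=
  ∑ p ∈ δ.support.filter (fun p => p ∈ S), δ p

/-- The number of Darboux points in a set. -/
noncomputable def darbouxCount (S : Set D.Point) : ℕ := Set.ncard {r : Fin k | D.darboux r ∈ S}

/-- Real and regular vacuum divisors. The component of the white vertex `v` carries a divisor point
if there is a horizontal edge to the left of `v`: these `v` are the trivalent white vertices and
the bivalent white vertices whose component contains a Darboux point. The infinite oval is the one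
containing `P₀`; the other ones are finite. -/
structure IsRealRegularDivisor (κ : Fin n → ℝ) (δ : D.Point →₀ ℕ) : Prop where
  degree_eq : degreeOn δ Set.univ = D.dim
  off_base : ∀ x ∈ δ.support, ¬ D.OnBase κ x
  on_ovals : ∀ x ∈ δ.support, ∃ S, D.IsOval κ S ∧ x ∈ S
  one_point : ∀ v : {v : Fin k × Fin n // v ∈ D.whites}, (∃ b, D.Horizontal v.1 b) →
    degreeOn δ {x | x.1 = .white v} = 1
  finite_oval : ∀ S, D.IsOval κ S → D.P0 ∉ S → Odd (degreeOn δ S + D.darbouxCount S)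
  infinite_oval : ∀ S, D.IsOval κ S → D.P0 ∈ S → Even (degreeOn δ S + D.darbouxCount S + k)

end LeDiagram

/-! ### Wave functions -/

/-- A local parameter of the Riemann sphere at a point, defined for small `z ≠ 0`. -/
noncomputable def localPoint : OnePoint ℂ → ℂ → OnePoint ℂ
  | OnePoint.infty, z => ((z⁻¹ : ℂ) : OnePoint ℂ)
  | OnePoint.some a, z => ((a + z : ℂ) : OnePoint ℂ)

/-- `f` is a meromorphic function on the Riemann sphere which has at each point `a` at most a pole
of order `m a`. -/
def IsMeromorphicWithPoles (f : OnePoint ℂ → OnePoint ℂ) (m : OnePoint ℂ → ℕ) : Prop :=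
  Continuous f ∧ ∀ a, ∃ h : ℂ → ℂ, AnalyticAt ℂ h 0 ∧
    ∀ᶠ z in 𝓝[≠] (0 : ℂ), f (localPoint a z) = ((h z / z ^ m a : ℂ) : OnePoint ℂ)

/-- `F` is an entire function of any finite number of times. -/
def IsEntire (F : Times → ℂ) : Prop :=
  ∀ (t : Times) (m : ℕ) (v : Fin m → Times),
    Differentiable ℂ fun x : Fin m → ℂ => F (t + ∑ i, x i • v i)

/-- The heat hierarchy `∂_{t_l} F = ∂_{t_1}^l F`, `l ≥ 1`. -/
def SolvesHeatHierarchy (F : Times → ℂ) : Prop :=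
  ∀ (t : Times) (l : ℕ+),
    deriv (fun s : ℂ => F (t + Finsupp.single l s)) 0 =
      iteratedDeriv (l : ℕ) (fun s : ℂ => F (t + Finsupp.single 1 s)) 0

namespace LeDiagram

variable {k n : ℕ} (D : LeDiagram k n)

/-- `φ` is a real and regular vacuum wave function with initial time `t₀` corresponding to the
divisor `δ`. Values at `P₀` play no role. -/
structure IsVacuumWaveFunction (κ : Fin n → ℝ) (t₀ : RealTimes) (δ : D.Point →₀ ℕ)
    (φ : D.Point → Times → OnePoint ℂ) : Prop where
  initial : ∀ x, x ≠ D.P0 → φ x t₀.toComplex = ((1 : ℂ) : OnePoint ℂ)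
  on_base : ∀ (ζ : ℂ) (t : Times),
    φ (.base, (ζ : OnePoint ℂ)) t = ((Complex.exp (theta ζ (t - t₀.toComplex)) : ℂ) : OnePoint ℂ)
  heat : ∀ x : D.Point, x.1 ≠ .base → δ x = 0 →
    ∃ F : Times → ℂ, (∀ t, φ x t = (F t : OnePoint ℂ)) ∧ SolvesHeatHierarchy F
  real : ∀ p : D.RealPoint, p.toPoint ≠ D.P0 → ∀ t : RealTimes,
    φ p.toPoint t.toComplex ∈ Set.range toSphere
  glued : ∀ p q : D.RealPoint, D.Glued κ p q → ∀ t, φ p.toPoint t = φ q.toPoint t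
  meromorphic : ∀ c : D.Component, c ≠ .base → ∀ t,
    IsMeromorphicWithPoles (fun z => φ (c, z) t) (fun z => δ (c, z))
  regular : ∀ x, x ≠ D.P0 → δ x = 0 →
    ∃ F : Times → ℂ, (∀ t, φ x t = (F t : OnePoint ℂ)) ∧ IsEntire F

/-- At each Darboux point, `φ` is the normalized generator of the Darboux transformation. -/
def HasDarbouxValues (κ : Fin n → ℝ) (R : Matrix (Fin k) (Fin n) ℝ) (t₀ : RealTimes)
    (φ : D.Point → Times → OnePoint ℂ) : Prop :=
  ∀ (r : Fin k) (t : Times),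
    φ (D.darboux r) t =
      ((generator κ R r t / generator κ R r t₀.toComplex : ℂ) : OnePoint ℂ)

end LeDiagram

end KPSoliton

open KPSoliton

/-! The theorem has three independent ingredients: a Le-network for the given point, a wave function
read off from that network, and a parity count on the ovals.

Le-network. Removing the signs from the nonpivot part of `R` leaves a matrix all of whose minors
inside the Young shape are nonnegative once the order of the rows is reversed
(`isTotallyNonneg_unsignedPart`). Take the first nonzero column and its topmost nonzero entry.
Subtracting a multiple of the next row that is nonzero in this column kills the entry and preserves
total nonnegativity (`IsTotallyNonneg.eliminate`, which rests on `minor_exchange`); if there is no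
such row, the entry is simply erased. Undoing one such step adds exactly one box to a network
(`Realizes.insert`), and the Le-rule is the nonnegativity of 2 by 2 minors.

Wave function. The path sums out of the vertices satisfy a linear recursion. With the signs restored
it reads `U v = U below + (± w) U left`, where the sign is the parity of the number of pivots
between the two ends of the horizontal edge, and `U v` has leading coefficient 1 in the column of
`v`. As t₁ tends to -∞ the exponential with the smallest κ dominates, so at a suitable real time all
these sums are positive. Dividing by their values there gives `a v = (1 - γ v) a below + γ v a left`
with `γ v < 1` and with the sign of `γ v` given by the parity (`exists_isVacuumNetwork`). This
relation says precisely that the function on the component of `v` with a simple pole at `γ v` and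
value `a v` at ∞ takes the values of the lower and left neighbours at 1 and 0. On black components
the wave function is constant.

Uniqueness. The degree and the one-point condition leave room for no further divisor points. A
function on the sphere with at most one simple pole is determined by its values at ∞ and 1 and the
position of the pole. The values at the vertices are triangular combinations of exponentials: only
columns weakly to the left of the vertex occur. Comparing coefficients in the column of `v`, to
which the left neighbour does not contribute, identifies the pole with `γ v`, and then the value at
the left neighbour. So the Darboux values propagate through the whole network
(`IsVacuumNetwork.unique`).

Parity. The successor map on arcs is a permutation of the double points, and ovals are its cycles.
An oval through the point 0 of the component of `v` stays on the face below the horizontal edge at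
`v`; it contains no other such point and misses the arc through P₀ (`OnFace.next`,
`OnFace.not_isLast`). An oval without such a point must contain the arc through P₀, because
`Mark.height` cannot increase around a cycle. Modulo 2 the number of divisor and Darboux points on
an arc is the increment of a potential, namely the number of pivots to the right, plus 1 for an arc
starting at a point 0 of a white component and plus k for the arc through P₀ (`Next.weight_eq`).
Summing around a cycle gives 1 on finite ovals and k on the infinite one. -/

namespace KPSoliton
-- Neighbours in the Le-graph.
namespace LeDiagram

variable {k n : ℕ} {D : LeDiagram k n} {v v' b b' : Fin k × Fin n}

theorem mem_whites : v ∈ D.whites ↔ v ∈ D.boxes ∨ v.2 = D.pivot v.1 := by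
  simp only [whites, Finset.mem_union, Finset.mem_image, Finset.mem_univ, true_and]
  refine or_congr_right ⟨?_, fun h => ⟨v.1, Prod.ext rfl h.symm⟩⟩
  rintro ⟨r, rfl⟩
  rfl

theorem pivot_mem_whites (r : Fin k) : (r, D.pivot r) ∈ D.whites := mem_whites.2 (Or.inr rfl)

theorem mem_whites_of_mem_boxes (h : b ∈ D.boxes) : b ∈ D.whites := mem_whites.2 (Or.inl h)

theorem col_ne_pivot (h : b ∈ D.boxes) (r : Fin k) : b.2 ≠ D.pivot r :=
  fun e => (D.isBox b h).1 ⟨r, e.symm⟩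

theorem pivot_lt_col (h : b ∈ D.boxes) : D.pivot b.1 < b.2 := (D.isBox b h).2

theorem pivot_le_col (h : v ∈ D.whites) : D.pivot v.1 ≤ v.2 := by
  rcases mem_whites.1 h with h | h
  · exact (pivot_lt_col h).le
  · exact h.ge

theorem mem_boxes_of_col_ne (h : v ∈ D.whites) (h' : ∀ r, v.2 ≠ D.pivot r) : v ∈ D.boxes :=
  (mem_whites.1 h).resolve_right (h' _)

theorem eq_pivot_of_not_mem_boxes (h : v ∈ D.whites) (h' : v ∉ D.boxes) :
    v = (v.1, D.pivot v.1) :=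
  Prod.ext rfl ((mem_whites.1 h).resolve_left h')

theorem row_eq_of_col_eq_pivot (h : v ∈ D.whites) {r : Fin k} (h' : v.2 = D.pivot r) :
    v = (r, D.pivot r) := by
  rcases mem_whites.1 h with hb | hb
  · exact absurd h' (col_ne_pivot hb r)
  · have : v.1 = r := D.pivot.injective (hb.symm.trans h')
    exact Prod.ext this h'

theorem exists_horizontal (hv : v ∈ D.whites) (hb : b ∈ D.boxes) (h1 : b.1 = v.1)
    (h2 : v.2 < b.2) : ∃ c, D.Horizontal v c ∧ c.2 ≤ b.2 := by
  classical
  obtain ⟨c, hc, hmin⟩ := (D.boxes.filter fun c => c.1 = v.1 ∧ v.2 < c.2).exists_min_image Prod.snd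
    ⟨b, by simp [hb, h1, h2]⟩
  simp only [Finset.mem_filter] at hc hmin
  exact ⟨c, ⟨hv, hc.1, hc.2.1, hc.2.2, fun b' hb' h3 h4 => hmin b' ⟨hb', h3, h4⟩⟩,
    hmin b ⟨hb, h1, h2⟩⟩

theorem Horizontal.right_unique (h : D.Horizontal v b) (h' : D.Horizontal v b') : b = b' := by
  obtain ⟨-, hb, h1, h2, h3⟩ := h
  obtain ⟨-, hb', h1', h2', h3'⟩ := h'
  exact Prod.ext (h1.trans h1'.symm) (le_antisymm (h3 _ hb' h1' h2') (h3' _ hb h1 h2))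

theorem exists_horizontal_right (hb : b ∈ D.boxes) : ∃ v, D.Horizontal v b := by
  classical
  obtain ⟨v, hv, hmax⟩ := (D.whites.filter fun c => c.1 = b.1 ∧ c.2 < b.2).exists_max_image Prod.snd
    ⟨(b.1, D.pivot b.1), by simp [pivot_mem_whites, pivot_lt_col hb]⟩
  simp only [Finset.mem_filter] at hv hmax
  refine ⟨v, hv.1, hb, hv.2.1.symm, hv.2.2, fun b' hb' h3 h4 => ?_⟩
  by_contra! h
  exact (hmax b' ⟨mem_whites_of_mem_boxes hb', h3.trans hv.2.1, h⟩).not_gt h4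

/-- Of two distinct white vertices in one row, the one further left is not the pivot vertex. It is
therefore a filled box, and it would separate the other one from `b`. -/
theorem Horizontal.left_unique (h : D.Horizontal v b) (h' : D.Horizontal v' b) : v = v' := by
  obtain ⟨hv, hb, h1, h2, h3⟩ := h
  obtain ⟨hv', hb', h1', h2', h3'⟩ := h'
  have e : v.1 = v'.1 := h1.symm.trans h1'
  refine Prod.ext e (le_antisymm ?_ ?_) <;> by_contra! hlt
  · have hvb : v ∈ D.boxes := (mem_whites.1 hv).resolve_right fun hp => by
      have := pivot_le_col hv'
      rw [← e, ← hp] at this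
      exact this.not_gt hlt
    exact (h3' _ hvb e hlt).not_gt h2
  · have hvb : v' ∈ D.boxes := (mem_whites.1 hv').resolve_right fun hp => by
      have := pivot_le_col hv
      rw [e, ← hp] at this
      exact this.not_gt hlt
    exact (h3 _ hvb e.symm hlt).not_gt h2'

theorem exists_vertical (hv : v ∈ D.whites) (hb : b ∈ D.boxes) (h1 : b.2 = v.2)
    (h2 : v.1 < b.1) : ∃ c, D.Vertical v c ∧ c.1 ≤ b.1 := by
  classical
  obtain ⟨c, hc, hmin⟩ := (D.boxes.filter fun c => c.2 = v.2 ∧ v.1 < c.1).exists_min_image Prod.fst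
    ⟨b, by simp [hb, h1, h2]⟩
  simp only [Finset.mem_filter] at hc hmin
  exact ⟨c, ⟨hv, hc.1, hc.2.1, hc.2.2, fun b' hb' h3 h4 => hmin b' ⟨hb', h3, h4⟩⟩,
    hmin b ⟨hb, h1, h2⟩⟩

theorem exists_vertical_or_toBoundary (hv : v ∈ D.whites) :
    (∃ b, D.Vertical v b) ∨ D.ToBoundary v := by
  by_cases h : ∃ b ∈ D.boxes, b.2 = v.2 ∧ v.1 < b.1
  · obtain ⟨b, hb, h1, h2⟩ := h
    obtain ⟨c, hc, -⟩ := exists_vertical hv hb h1 h2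
    exact Or.inl ⟨c, hc⟩
  · push Not at h
    exact Or.inr ⟨hv, fun b hb e => not_lt.2 (h b hb e)⟩

theorem Vertical.not_toBoundary (h : D.Vertical v b) : ¬ D.ToBoundary v :=
  fun h' => h'.2 b h.2.1 h.2.2.1 h.2.2.2.1

theorem Vertical.mem_boxes (h : D.Vertical v b) : v ∈ D.boxes :=
  mem_boxes_of_col_ne h.1 fun r => h.2.2.1 ▸ col_ne_pivot h.2.1 r

theorem Vertical.right_unique (h : D.Vertical v b) (h' : D.Vertical v b') : b = b' := by
  obtain ⟨-, hb, h1, h2, h3⟩ := h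
  obtain ⟨-, hb', h1', h2', h3'⟩ := h'
  exact Prod.ext (le_antisymm (h3 _ hb' h1' h2') (h3' _ hb h1 h2)) (h1.trans h1'.symm)

theorem exists_vertical_above (hb : b ∈ D.boxes) (hb' : b' ∈ D.boxes) (h1 : b'.2 = b.2)
    (h2 : b'.1 < b.1) : ∃ v, D.Vertical v b ∧ b'.1 ≤ v.1 := by
  classical
  obtain ⟨v, hv, hmax⟩ := (D.boxes.filter fun c => c.2 = b.2 ∧ c.1 < b.1).exists_max_image Prod.fst
    ⟨b', by simp [hb', h1, h2]⟩
  simp only [Finset.mem_filter] at hv hmax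
  refine ⟨v, ⟨mem_whites_of_mem_boxes hv.1, hb, hv.2.1.symm, hv.2.2, fun c hc h3 h4 => ?_⟩,
    hmax _ ⟨hb', h1, h2⟩⟩
  by_contra! h
  exact (hmax c ⟨hc, h3.trans hv.2.1, h⟩).not_gt h4

theorem Vertical.left_unique (h : D.Vertical v b) (h' : D.Vertical v' b) : v = v' := by
  have hb := h.mem_boxes
  have hb' := h'.mem_boxes
  obtain ⟨-, -, h1, h2, h3⟩ := h
  obtain ⟨-, -, h1', h2', h3'⟩ := h'
  have e : v.2 = v'.2 := h1.symm.trans h1'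
  refine Prod.ext (le_antisymm ?_ ?_) e <;> by_contra! hlt
  · exact (h3' _ hb e hlt).not_gt h2
  · exact (h3 _ hb' e.symm hlt).not_gt h2'

theorem ToBoundary.unique (h : D.ToBoundary v) (h' : D.ToBoundary v') (e : v.2 = v'.2) :
    v = v' := by
  rcases mem_whites.1 h.1 with hb | hb
  · have hb' : v' ∈ D.boxes := mem_boxes_of_col_ne h'.1 fun r => e ▸ col_ne_pivot hb r
    exact Prod.ext (le_antisymm (not_lt.1 (h'.2 _ hb e)) (not_lt.1 (h.2 _ hb' e.symm))) e
  · rw [row_eq_of_col_eq_pivot h'.1 (e.symm.trans hb)]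
    exact Prod.ext rfl hb

theorem exists_toBoundary (hv : v ∈ D.whites) : ∃ u, D.ToBoundary u ∧ u.2 = v.2 ∧ v.1 ≤ u.1 := by
  classical
  obtain ⟨u, hu, hmax⟩ := (D.whites.filter fun c => c.2 = v.2).exists_max_image Prod.fst
    ⟨v, by simp [hv]⟩
  simp only [Finset.mem_filter] at hu hmax
  refine ⟨u, ⟨hu.1, fun b hb e hlt => ?_⟩, hu.2, hmax v ⟨hv, rfl⟩⟩
  exact (hmax b ⟨mem_whites_of_mem_boxes hb, e.trans hu.2⟩).not_gt hlt

theorem toBoundary_pivot (r : Fin k) : D.ToBoundary (r, D.pivot r) :=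
  ⟨pivot_mem_whites r, fun _ hb e => absurd e (col_ne_pivot hb r)⟩

end LeDiagram
end KPSoliton

/-! ### Path sums as the solution of a linear recursion. -/

namespace KPSoliton

/-- Replacing `ρ u` by the number of vertices of smaller rank keeps it increasing along edges and
bounds it by the number of vertices, so no path is long enough to contribute to this power. -/
theorem pow_card_eq_zero_of_rank {V : Type*} [Fintype V] [DecidableEq V] {A : Matrix V V ℝ}
    {ρ : V → ℕ} (h : ∀ u v, A u v ≠ 0 → ρ u < ρ v) : A ^ Fintype.card V = 0 := by
  classical
  let ρ' : V → ℕ := fun u => (Finset.univ.filter fun x => ρ x < ρ u).card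
  have hmono : ∀ u v, A u v ≠ 0 → ρ' u < ρ' v := fun u v huv => by
    refine Finset.card_lt_card ⟨fun x hx => ?_, fun hsub => ?_⟩
    · simp only [Finset.mem_filter, Finset.mem_univ, true_and] at hx ⊢
      exact hx.trans (h u v huv)
    · have := hsub (Finset.mem_filter.2 ⟨Finset.mem_univ u, h u v huv⟩)
      simp at this
  have hlt : ∀ u, ρ' u < Fintype.card V := fun u => by
    refine Finset.card_lt_univ_of_notMem (x := u) ?_
    simp
  have key : ∀ m u v, (A ^ m) u v ≠ 0 → ρ' u + m ≤ ρ' v := by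
    intro m
    induction m with
    | zero =>
      intro u v huv
      rw [pow_zero, Matrix.one_apply] at huv
      have : u = v := by by_contra h'; simp [h'] at huv
      simp [this]
    | succ m ih =>
      intro u v huv
      rw [pow_succ, Matrix.mul_apply] at huv
      obtain ⟨x, -, hx⟩ := Finset.exists_ne_zero_of_sum_ne_zero huv
      have h1 := ih u x (left_ne_zero_of_mul hx)
      have h2 := hmono x v (right_ne_zero_of_mul hx)
      omega
  ext u v
  by_contra hne
  have := key _ u v hne
  have := hlt v
  omega

namespace LeDiagram

variable {k n : ℕ} {D : LeDiagram k n} {v b : Fin k × Fin n} {w : Fin k × Fin n → ℝ}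

open Classical in
/-- A height on the vertices which increases along the edges of the Le-network. -/
noncomputable def height (D : LeDiagram k n) : NetVertex k n → ℕ
  | .inl j => if j ∈ Set.range D.pivot then 0 else 2 * (k + n) + 10
  | .inr (.inl v) => 2 * (v.1 + v.2) + 2
  | .inr (.inr b) => 2 * (b.1 + b.2) + 1

/-- Edges to the left or downwards raise row plus column, and the edge from a black vertex to its
white vertex gains from the offsets 1 and 2. Paths end only at nonpivot boundary vertices, which lie
above every internal vertex; pivot boundary vertices receive no edge. -/
theorem height_lt {x y : NetVertex k n} (h : D.adjacency w x y ≠ 0) : D.height x < D.height y := by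
  rcases x with j | v | b <;> rcases y with j' | v' | b' <;>
    simp only [adjacency, height, ne_eq, not_true_eq_false, ite_eq_right_iff, Classical.not_imp,
      one_ne_zero, not_false_eq_true, and_true] at h ⊢
  · rw [if_pos ⟨v'.1, h.2⟩]
    omega
  · obtain ⟨hb, -, rfl⟩ := h
    rw [if_neg (D.isBox v hb).1]
    omega
  · split_ifs at h with h1 h2
    · obtain ⟨-, -, e, hlt, -⟩ := h1
      rw [e]
      have := Fin.lt_def.1 hlt
      omega
    · obtain ⟨-, -, e, hlt, -⟩ := h2
      rw [e]
      have := Fin.lt_def.1 hlt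
      omega
    · simp at h
  · rw [h.1]
    omega

/-- The path sum is a truncated Neumann series. As the adjacency matrix is nilpotent, the truncation
loses nothing, and splitting off the first step of a path is exact. -/
theorem pathSum_eq (x y : NetVertex k n) :
    D.pathSum w x y = (if x = y then 1 else 0) + ∑ z, D.adjacency w x z * D.pathSum w z y := by
  classical
  have h0 : D.adjacency w ^ Fintype.card (NetVertex k n) = 0 :=
    pow_card_eq_zero_of_rank (ρ := D.height) fun _ _ => height_lt
  have key : (∑ m ∈ Finset.range (Fintype.card (NetVertex k n)), D.adjacency w ^ m) =
      1 + D.adjacency w * ∑ m ∈ Finset.range (Fintype.card (NetVertex k n)),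
        D.adjacency w ^ m := by
    have h1 := Finset.sum_range_succ (fun m => D.adjacency w ^ m) (Fintype.card (NetVertex k n))
    rw [Finset.sum_range_succ', h0, add_zero, pow_zero] at h1
    rw [Finset.mul_sum]
    simp only [← pow_succ']
    rw [← h1, add_comm]
  have := congrFun (congrFun key x) y
  simpa only [pathSum, Matrix.add_apply, Matrix.mul_apply, Matrix.sum_apply, Matrix.one_apply]
    using this

open Classical in
/-- The contribution to the flow out of a white vertex of its vertical edge. -/
noncomputable def below (D : LeDiagram k n) (Z : Fin k × Fin n → Fin n → ℝ) (v : Fin k × Fin n) :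
    Fin n → ℝ :=
  ∑ b ∈ D.boxes with D.Vertical v b, Z b + if D.ToBoundary v then Pi.single v.2 1 else 0

open Classical in
/-- The contribution to the flow out of a white vertex of its horizontal edge to the left. -/
noncomputable def leftward (D : LeDiagram k n) (w : Fin k × Fin n → ℝ)
    (Z : Fin k × Fin n → Fin n → ℝ) (v : Fin k × Fin n) : Fin n → ℝ :=
  ∑ b ∈ D.boxes with D.Horizontal v b, w b • Z b

theorem below_of_vertical {Z : Fin k × Fin n → Fin n → ℝ} (h : D.Vertical v b) :
    D.below Z v = Z b := by
  classical
  have : (D.boxes.filter fun b' => D.Vertical v b') = {b} := by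
    ext b'
    simp only [Finset.mem_filter, Finset.mem_singleton]
    exact ⟨fun h' => h'.2.right_unique h, fun e => e ▸ ⟨h.2.1, h⟩⟩
  rw [below, if_neg h.not_toBoundary, this, Finset.sum_singleton, add_zero]

theorem below_of_toBoundary {Z : Fin k × Fin n → Fin n → ℝ} (h : D.ToBoundary v) :
    D.below Z v = Pi.single v.2 1 := by
  classical
  have : (D.boxes.filter fun b' => D.Vertical v b') = ∅ := by
    ext b'
    simp only [Finset.mem_filter, Finset.notMem_empty, iff_false]
    exact fun h' => h'.2.not_toBoundary h
  rw [below, if_pos h, this, Finset.sum_empty, zero_add]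

theorem leftward_of_horizontal {Z : Fin k × Fin n → Fin n → ℝ} (h : D.Horizontal v b) :
    D.leftward w Z v = w b • Z b := by
  classical
  have : (D.boxes.filter fun b' => D.Horizontal v b') = {b} := by
    ext b'
    simp only [Finset.mem_filter, Finset.mem_singleton]
    exact ⟨fun h' => h'.2.right_unique h, fun e => e ▸ ⟨h.2.1, h⟩⟩
  rw [leftward, this, Finset.sum_singleton]

theorem leftward_of_not {Z : Fin k × Fin n → Fin n → ℝ} (h : ¬ ∃ b, D.Horizontal v b) :
    D.leftward w Z v = 0 := by
  classical
  have : (D.boxes.filter fun b' => D.Horizontal v b') = ∅ := by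
    ext b'
    simp only [Finset.mem_filter, Finset.notMem_empty, iff_false]
    exact fun h' => h ⟨_, h'.2⟩
  rw [leftward, this, Finset.sum_empty]

/-- `Z b` is the vector of the sums over the paths from `b` to the boundary vertices. -/
def IsFlow (D : LeDiagram k n) (w : Fin k × Fin n → ℝ) (Z : Fin k × Fin n → Fin n → ℝ) : Prop :=
  ∀ v ∈ D.boxes, Z v = D.below Z v + D.leftward w Z v

/-- The recursion at a box refers only to boxes further to the left or lower down, so induction on
`k + n` minus row plus column applies. -/
theorem IsFlow.unique {Z Z' : Fin k × Fin n → Fin n → ℝ} (h : D.IsFlow w Z) (h' : D.IsFlow w Z') :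
    ∀ v ∈ D.boxes, Z v = Z' v := by
  classical
  have key : ∀ m : ℕ, ∀ v ∈ D.boxes, k + n - (v.1 + v.2) ≤ m → Z v = Z' v := by
    intro m
    induction m with
    | zero =>
      intro v hv hm
      have := v.1.2
      have := v.2.2
      omega
    | succ m ih =>
      intro v hv hm
      have hrow := v.1.2
      have hcol := v.2.2
      rw [h v hv, h' v hv, below, below, leftward, leftward]
      congr 1
      · congr 1
        refine Finset.sum_congr rfl fun b hb => ih b (Finset.mem_filter.1 hb).1 ?_
        obtain ⟨-, -, e, hlt, -⟩ := (Finset.mem_filter.1 hb).2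
        rw [e]
        have := Fin.lt_def.1 hlt
        omega
      · refine Finset.sum_congr rfl fun b hb => ?_
        rw [ih b (Finset.mem_filter.1 hb).1 ?_]
        obtain ⟨-, -, e, hlt, -⟩ := (Finset.mem_filter.1 hb).2
        rw [e]
        have := Fin.lt_def.1 hlt
        omega
  exact fun v hv => key _ v hv le_rfl

/-- The path sums of the Le-network. -/
noncomputable def flow (D : LeDiagram k n) (w : Fin k × Fin n → ℝ) (b : Fin k × Fin n)
    (l : Fin n) : ℝ :=
  D.pathSum w (.inr (.inr b)) (.inl l)

/-- The vertical edge of a pivot vertex is oriented towards it, coming from the source, so it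
contributes to the outgoing flow only at a filled box. -/
theorem pathSum_white (v : Fin k × Fin n) (l : Fin n) :
    D.pathSum w (.inr (.inl v)) (.inl l) =
      (if v ∈ D.boxes then D.below (D.flow w) v l else 0) + D.leftward w (D.flow w) v l := by
  classical
  rw [pathSum_eq]
  simp only [Fintype.sum_sum_type, adjacency, reduceCtorEq, if_false, zero_add, zero_mul,
    Finset.sum_const_zero, ite_mul, one_mul]
  have h1 : ∀ j : Fin n, (if v ∈ D.boxes ∧ D.ToBoundary v ∧ v.2 = j then
      D.pathSum w (.inl j) (.inl l) else 0) =
      if v.2 = j then (if v ∈ D.boxes ∧ D.ToBoundary v then D.pathSum w (.inl v.2) (.inl l)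
        else 0) else 0 := fun j => by
    by_cases e : v.2 = j
    · subst e; simp
    · simp [e]
  -- The boundary vertex of a box column is a sink: only the empty path starts there.
  have h2 : v ∈ D.boxes → D.pathSum w (.inl v.2) (.inl l) = if v.2 = l then 1 else 0 := fun hv => by
    rw [pathSum_eq, add_eq_left.2]
    · simp
    simp only [Fintype.sum_sum_type, adjacency, zero_mul, Finset.sum_const_zero, zero_add, add_zero]
    refine Finset.sum_eq_zero fun x _ => ?_
    rw [if_neg, zero_mul]
    rintro ⟨e, e'⟩
    exact col_ne_pivot hv x.1 e'.symm
  have h3 : ∀ b : Fin k × Fin n, (if D.Horizontal v b then w b * D.pathSum w (.inr (.inr b)) (.inl l)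
      else if D.Vertical v b then D.pathSum w (.inr (.inr b)) (.inl l) else 0) =
      (if D.Vertical v b then D.flow w b l else 0) +
        if D.Horizontal v b then w b * D.flow w b l else 0 := fun b => by
    by_cases hH : D.Horizontal v b
    · have : ¬ D.Vertical v b := fun hV => hV.2.2.2.1.ne hH.2.2.1.symm
      simp [hH, this, flow]
    · simp [hH, flow]
  simp only [h1, h3, Finset.sum_add_distrib, Finset.sum_ite_eq, Finset.mem_univ, if_true]
  have h4 : (∑ b, if D.Horizontal v b then w b * D.flow w b l else 0) =
      D.leftward w (D.flow w) v l := by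
    rw [leftward, Finset.sum_apply, Finset.sum_filter, ← Finset.sum_subset (Finset.subset_univ D.boxes)]
    · simp
    · exact fun b _ hb => if_neg fun h => hb h.2.1
  have h5 : (∑ b, if D.Vertical v b then D.flow w b l else 0) =
      ∑ b ∈ D.boxes with D.Vertical v b, D.flow w b l := by
    rw [Finset.sum_filter, ← Finset.sum_subset (Finset.subset_univ D.boxes)]
    exact fun b _ hb => if_neg fun h => hb h.2.1
  rw [h4, h5, ← add_assoc]
  congr 1
  by_cases hv : v ∈ D.boxes
  · rw [if_pos hv, below, Pi.add_apply, Finset.sum_apply, h2 hv, add_comm]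
    congr 1
    by_cases ht : D.ToBoundary v
    · simp [hv, ht, Pi.single_apply, eq_comm]
    · simp [ht]
  · rw [if_neg hv, if_neg fun h => hv h.1, zero_add]
    exact Finset.sum_eq_zero fun b hb => absurd (Finset.mem_filter.1 hb).2.mem_boxes hv

theorem isFlow_flow : D.IsFlow w (D.flow w) := by
  classical
  intro v hv
  ext l
  rw [flow, pathSum_eq]
  simp only [Fintype.sum_sum_type, adjacency, reduceCtorEq, if_false, zero_add, zero_mul,
    Finset.sum_const_zero, ite_mul, one_mul, add_zero]
  rw [Finset.sum_eq_single v (fun b _ hb => if_neg fun h => hb h.1) (by simp), if_pos ⟨rfl, hv⟩,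
    pathSum_white, if_pos hv]
  rfl

theorem pathSum_pivot (r : Fin k) {l : Fin n} (h : l ≠ D.pivot r) :
    D.pathSum w (.inl (D.pivot r)) (.inl l) = D.leftward w (D.flow w) (r, D.pivot r) l := by
  classical
  rw [pathSum_eq, if_neg (by simpa using h.symm)]
  simp only [Fintype.sum_sum_type, adjacency, zero_add, zero_mul,
    Finset.sum_const_zero, ite_mul, one_mul, add_zero]
  rw [Finset.sum_eq_single (r, D.pivot r) _ (by simp), if_pos ⟨rfl, rfl⟩, pathSum_white,
    if_neg fun h => col_ne_pivot h r rfl, zero_add]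
  refine fun b _ hb => if_neg fun h => hb ?_
  have := D.pivot.injective h.2
  exact Prod.ext this h.1

theorem leftward_congr {Z Z' : Fin k × Fin n → Fin n → ℝ} (h : ∀ b ∈ D.boxes, Z b = Z' b) :
    D.leftward w Z v = D.leftward w Z' v := by
  classical
  refine Finset.sum_congr rfl fun b hb => ?_
  rw [h b (Finset.mem_filter.1 hb).1]

/-- The number of pivots strictly between two columns. -/
def pivotsBetween (D : LeDiagram k n) (i j : Fin n) : ℕ :=
  (Finset.univ.filter fun s => i < D.pivot s ∧ D.pivot s < j).card

theorem networkMatrix_of_isFlow {Z : Fin k × Fin n → Fin n → ℝ} (h : D.IsFlow w Z) (r : Fin k)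
    (j : Fin n) : D.networkMatrix w r j = if j < D.pivot r then 0 else if j = D.pivot r then 1 else
      (-1) ^ D.pivotsBetween (D.pivot r) j * D.leftward w Z (r, D.pivot r) j := by
  rw [networkMatrix]
  split_ifs with h1 h2
  · rfl
  · rfl
  · rw [pathSum_pivot r h2, leftward_congr (isFlow_flow.unique h)]
    rfl

end LeDiagram
end KPSoliton

/-! ### Signs of sequences, minors and a Plücker relation. -/

namespace KPSoliton

/-- The sign of the permutation sorting the sequence `f` (zero if `f` has repetitions). -/
noncomputable def orderSign {m : ℕ} (f : Fin m → ℝ) : ℝ :=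
  (SignType.sign (Matrix.vandermonde f).det : SignType)

/-- The sign of the position of `x` relative to the sequence `f`. -/
noncomputable def positionSign {m : ℕ} (x : ℝ) (f : Fin m → ℝ) : ℝ :=
  (SignType.sign (∏ a, (f a - x)) : SignType)

theorem orderSign_cons {m : ℕ} (x : ℝ) (f : Fin m → ℝ) :
    orderSign (Fin.cons x f : Fin (m + 1) → ℝ) = positionSign x f * orderSign f := by
  rw [orderSign, orderSign, positionSign, ← SignType.coe_mul, ← sign_mul]
  congr 2
  rw [Matrix.det_vandermonde, Matrix.det_vandermonde, Fin.prod_univ_succ, Fin.prod_Ioi_zero]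
  simp only [Fin.cons_zero, Fin.cons_succ, Fin.prod_Ioi_succ]

theorem positionSign_cons {m : ℕ} (x y : ℝ) (f : Fin m → ℝ) :
    positionSign x (Fin.cons y f : Fin (m + 1) → ℝ) =
      (SignType.sign (y - x) : SignType) * positionSign x f := by
  rw [positionSign, positionSign, ← SignType.coe_mul, ← sign_mul, Fin.prod_univ_succ]
  simp

theorem positionSign_congr {m : ℕ} {x y : ℝ} {f : Fin m → ℝ}
    (h : ∀ a, SignType.sign (f a - x) = SignType.sign (f a - y)) :
    positionSign x f = positionSign y f := by
  have key : ∀ z : ℝ, SignType.sign (∏ a, (f a - z)) = ∏ a, SignType.sign (f a - z) :=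
    fun z => map_prod (signHom : ℝ →*₀ SignType) _ _
  rw [positionSign, positionSign, key, key, Finset.prod_congr rfl fun a _ => h a]

theorem positionSign_eq_one {m : ℕ} {x : ℝ} {f : Fin m → ℝ} (h : ∀ a, x < f a) :
    positionSign x f = 1 := by
  rw [positionSign, sign_pos (Finset.prod_pos fun a _ => sub_pos.2 (h a))]
  rfl

theorem sign_mul_self_eq_one {x : ℝ} (h : x ≠ 0) :
    ((SignType.sign x : SignType) : ℝ) * (SignType.sign x : SignType) = 1 := by
  rcases lt_or_gt_of_ne h with h | h <;> simp [h]

theorem positionSign_mul_self {m : ℕ} {x : ℝ} {f : Fin m → ℝ} (h : ∀ a, f a ≠ x) :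
    positionSign x f * positionSign x f = 1 :=
  sign_mul_self_eq_one (Finset.prod_ne_zero_iff.2 fun a _ => sub_ne_zero.2 (h a))

theorem orderSign_mul_self {m : ℕ} {f : Fin m → ℝ} (h : Function.Injective f) :
    orderSign f * orderSign f = 1 :=
  sign_mul_self_eq_one (Matrix.det_vandermonde_ne_zero_iff.2 h)

theorem orderSign_of_strictMono {m : ℕ} {f : Fin m → ℝ} (h : StrictMono f) : orderSign f = 1 := by
  rw [orderSign, sign_pos, SignType.coe_one]
  rw [Matrix.det_vandermonde]
  exact Finset.prod_pos fun i _ => Finset.prod_pos fun j hj =>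
    sub_pos.2 (h (Finset.mem_Ioi.1 hj))

theorem orderSign_comp_perm {m : ℕ} (f : Fin m → ℝ) (π : Equiv.Perm (Fin m)) :
    orderSign (f ∘ π) = (Equiv.Perm.sign π : ℤ) * orderSign f := by
  have : (Matrix.vandermonde (f ∘ π)).det =
      (Equiv.Perm.sign π : ℤ) * (Matrix.vandermonde f).det := by
    rw [← Matrix.det_permute]
    rfl
  rw [orderSign, this, sign_mul, SignType.coe_mul, orderSign]
  congr 1
  rcases Int.units_eq_one_or (Equiv.Perm.sign π) with h | h <;> simp [h]

/-- The three-term Plücker relation between the maximal minors of rows `x, y, z` and `T`. -/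
theorem det_three_term {m : ℕ} (x y z : Fin (m + 2) → ℝ) (T : Fin m → Fin (m + 2) → ℝ)
    (j : Fin (m + 2)) :
    let d₂ : (Fin (m + 2) → ℝ) → (Fin (m + 2) → ℝ) → ℝ := fun u v =>
      (Matrix.of (Fin.cons u (Fin.cons v T : Fin (m + 1) → Fin (m + 2) → ℝ) :
        Fin (m + 2) → Fin (m + 2) → ℝ)).det
    let d₁ : (Fin (m + 2) → ℝ) → ℝ := fun u =>
      (Matrix.of fun a b => (Fin.cons u T : Fin (m + 1) → Fin (m + 2) → ℝ) a (j.succAbove b)).det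
    d₂ y z * d₁ x - d₂ x z * d₁ y + d₂ x y * d₁ z = 0 := by
  intro d₂ d₁
  -- `d₁` is linear in its first row; `cf` consists of the cofactors, with 0 in the deleted column
  -- `j`.
  obtain ⟨cf, hcf⟩ : ∃ cf : Fin (m + 2) → ℝ, ∀ u, d₁ u = ∑ b, u b * cf b := by
    refine ⟨j.insertNth 0 fun b => (-1) ^ (b : ℕ) *
      (Matrix.of fun (a' : Fin m) (b' : Fin m) => T a' (j.succAbove (b.succAbove b'))).det,
      fun u => ?_⟩
    simp only [d₁]
    rw [Fin.sum_univ_succAbove _ j, Matrix.det_succ_row_zero]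
    simp only [Fin.insertNth_apply_same, mul_zero, zero_add, Fin.insertNth_apply_succAbove]
    refine Finset.sum_congr rfl fun b _ => ?_
    simp only [Matrix.of_apply, Fin.cons_zero]
    rw [mul_comm ((-1 : ℝ) ^ (b : ℕ)), mul_assoc]
    rfl
  have hT : ∀ a, d₁ (T a) = 0 := fun a =>
    Matrix.det_zero_of_row_eq (i := 0) (j := a.succ) (Fin.succ_ne_zero a).symm (by
      ext b; simp)
  let rows : Fin (m + 3) → Fin (m + 2) → ℝ := Fin.cons x (Fin.cons y (Fin.cons z T :
    Fin (m + 1) → Fin (m + 2) → ℝ) : Fin (m + 2) → Fin (m + 2) → ℝ)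
  -- Bordering the rows by the values of `d₁` gives a singular matrix, killed by the vector `(-1,
  -- cf)`. Expanding its determinant along the first column leaves three terms, since `d₁` vanishes
  -- on the rows of `T`.
  let N : Matrix (Fin (m + 3)) (Fin (m + 3)) ℝ :=
    Matrix.of fun a => (Fin.cons (d₁ (rows a)) (rows a) : Fin (m + 3) → ℝ)
  have hN : N.det = 0 := by
    refine Matrix.exists_mulVec_eq_zero_iff.1 ⟨Fin.cons (-1) cf, fun h => ?_, ?_⟩
    · simpa using congrFun h 0
    · ext a
      simp only [N, Matrix.mulVec, dotProduct, Matrix.of_apply, Fin.sum_univ_succ (n := m + 2),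
        Fin.cons_zero, Fin.cons_succ, hcf, Pi.zero_apply]
      ring
  rw [Matrix.det_succ_column_zero, Fin.sum_univ_succ, Fin.sum_univ_succ, Fin.sum_univ_succ,
    Finset.sum_eq_zero (s := Finset.univ) (fun a _ => ?_)] at hN
  swap
  · have : N a.succ.succ.succ 0 = d₁ (T a) := rfl
    rw [this, hT, mul_zero, zero_mul]
  have e0 : N.submatrix (Fin.succAbove 0) Fin.succ =
      Matrix.of (Fin.cons y (Fin.cons z T : Fin (m + 1) → Fin (m + 2) → ℝ)) := rfl
  have e1 : N.submatrix (Fin.succAbove (Fin.succ 0)) Fin.succ =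
      Matrix.of (Fin.cons x (Fin.cons z T : Fin (m + 1) → Fin (m + 2) → ℝ)) := by
    ext a b
    refine Fin.cases ?_ (fun a => ?_) a <;> simp [N, rows]
  have e2 : N.submatrix (Fin.succAbove (Fin.succ (Fin.succ 0))) Fin.succ =
      Matrix.of (Fin.cons x (Fin.cons y T : Fin (m + 1) → Fin (m + 2) → ℝ)) := by
    ext a b
    refine congrFun (?_ : rows (Fin.succAbove (Fin.succ (Fin.succ 0)) a) = _) b
    refine Fin.cases rfl (fun a => Fin.cases ?_ (fun a => ?_) a) a
    · rw [Fin.succ_succAbove_succ]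
      rfl
    · rw [Fin.succ_succAbove_succ, Fin.succ_succAbove_succ, Fin.zero_succAbove]
      rfl
  rw [e0, e1, e2] at hN
  have f0 : N 0 0 = d₁ x := rfl
  have f1 : N (Fin.succ 0) 0 = d₁ y := rfl
  have f2 : N (Fin.succ (Fin.succ 0)) 0 = d₁ z := rfl
  rw [f0, f1, f2] at hN
  simp only [Fin.val_zero, Fin.val_succ, pow_zero, zero_add, pow_one, one_mul, add_zero] at hN
  simp only [d₂]
  linear_combination hN

/-- The minor of `M` with rows `I` and columns `J`. -/
noncomputable def minor {k n m : ℕ} (M : Fin k → Fin n → ℝ) (I : Fin m → Fin k)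
    (J : Fin m → Fin n) : ℝ :=
  (Matrix.of fun a b => M (I a) (J b)).det

/-- The sign of the sequence of rows `I` with respect to the reversed order of the rows. -/
noncomputable def rowSign {k m : ℕ} (I : Fin m → Fin k) : ℝ :=
  orderSign fun a => -((I a : ℕ) : ℝ)

/-- The sign of the sequence of columns `J`. -/
noncomputable def colSign {n m : ℕ} (J : Fin m → Fin n) : ℝ :=
  orderSign fun a => ((J a : ℕ) : ℝ)

/-- All minors of `M` that lie inside the shape given by `p` are nonnegative, if the order of the
rows is reversed. -/
def IsTotallyNonneg {k n : ℕ} (p : Fin k → Fin n) (M : Fin k → Fin n → ℝ) : Prop :=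
  ∀ (m : ℕ) (I : Fin m → Fin k) (J : Fin m → Fin n), (∀ a b, p (I a) < J b) →
    0 ≤ rowSign I * colSign J * minor M I J

section

variable {k n m : ℕ}

theorem rowSign_cons (x : Fin k) (I : Fin m → Fin k) :
    rowSign (Fin.cons x I : Fin (m + 1) → Fin k) =
      positionSign (-((x : ℕ) : ℝ)) (fun a => -((I a : ℕ) : ℝ)) * rowSign I := by
  rw [rowSign, rowSign, ← orderSign_cons]
  congr 1
  ext a
  refine Fin.cases ?_ (fun a => ?_) a <;> simp

theorem colSign_cons (x : Fin n) (J : Fin m → Fin n) :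
    colSign (Fin.cons x J : Fin (m + 1) → Fin n) =
      positionSign ((x : ℕ) : ℝ) (fun a => ((J a : ℕ) : ℝ)) * colSign J := by
  rw [colSign, colSign, ← orderSign_cons]
  congr 1
  ext a
  refine Fin.cases ?_ (fun a => ?_) a <;> simp

theorem minor_eq_zero_of_row {M : Fin k → Fin n → ℝ} {I : Fin m → Fin k} {J : Fin m → Fin n}
    (a : Fin m) (h : ∀ b, M (I a) (J b) = 0) : minor M I J = 0 :=
  Matrix.det_eq_zero_of_row_eq_zero a h

theorem minor_eq_zero_of_col {M : Fin k → Fin n → ℝ} {I : Fin m → Fin k} {J : Fin m → Fin n}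
    (b : Fin m) (h : ∀ a, M (I a) (J b) = 0) : minor M I J = 0 :=
  Matrix.det_eq_zero_of_column_eq_zero b h

theorem minor_eq_zero_of_row_eq {M : Fin k → Fin n → ℝ} {I : Fin m → Fin k} {J : Fin m → Fin n}
    {a a' : Fin m} (hne : a ≠ a') (h : I a = I a') : minor M I J = 0 :=
  Matrix.det_zero_of_row_eq hne (by ext b; simp [h])

theorem minor_eq_zero_of_col_eq {M : Fin k → Fin n → ℝ} {I : Fin m → Fin k} {J : Fin m → Fin n}
    {a a' : Fin m} (hne : a ≠ a') (h : J a = J a') : minor M I J = 0 :=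
  Matrix.det_zero_of_column_eq hne (by intro b; simp [h])

theorem minor_swap (M : Fin k → Fin n → ℝ) (x y : Fin k) (I : Fin m → Fin k)
    (J : Fin (m + 2) → Fin n) :
    minor M (Fin.cons x (Fin.cons y I : Fin (m + 1) → Fin k)) J =
      -minor M (Fin.cons y (Fin.cons x I : Fin (m + 1) → Fin k)) J := by
  have := Matrix.det_permute (Equiv.swap (0 : Fin (m + 2)) 1) (Matrix.of fun a b =>
    M ((Fin.cons y (Fin.cons x I : Fin (m + 1) → Fin k) : Fin (m + 2) → Fin k) a) (J b))
  rw [Equiv.Perm.sign_swap (by simp)] at this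
  simp only [Units.val_neg, Units.val_one, Int.cast_neg, Int.cast_one, neg_mul, one_mul] at this
  rw [minor, minor, ← this]
  congr 1
  ext a b
  simp only [Matrix.of_apply, Matrix.submatrix_apply, id]
  refine congrArg (fun i => M i (J b)) ?_
  refine Fin.cases ?_ (fun a => Fin.cases ?_ (fun a => ?_) a) a
  · simp
  · rw [show (Fin.succ 0 : Fin (m + 2)) = 1 from rfl, Equiv.swap_apply_right]
    rfl
  · rw [Equiv.swap_apply_of_ne_of_ne]
    · rfl
    · exact Fin.succ_ne_zero _
    · exact fun h => Fin.succ_ne_zero a (Fin.succ_injective _ h)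

theorem minor_comp_perm (M : Fin k → Fin n → ℝ) (I : Fin m → Fin k) (J : Fin m → Fin n)
    (π : Equiv.Perm (Fin m)) : minor M (I ∘ π) J = (Equiv.Perm.sign π : ℤ) * minor M I J := by
  rw [minor, minor, ← Matrix.det_permute]
  rfl

theorem rowSign_comp_perm (I : Fin m → Fin k) (π : Equiv.Perm (Fin m)) :
    rowSign (I ∘ π) = (Equiv.Perm.sign π : ℤ) * rowSign I :=
  orderSign_comp_perm (fun a => -((I a : ℕ) : ℝ)) π

/-- Sign and minor change together, so a signed minor depends only on the set of its rows. This
permits moving a distinguished row to the front. -/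
theorem rowSign_mul_minor_comp_perm (M : Fin k → Fin n → ℝ) (I : Fin m → Fin k) (J : Fin m → Fin n)
    (π : Equiv.Perm (Fin m)) :
    rowSign (I ∘ π) * colSign J * minor M (I ∘ π) J = rowSign I * colSign J * minor M I J := by
  rw [minor_comp_perm, rowSign_comp_perm]
  have : ((Equiv.Perm.sign π : ℤ) : ℝ) * ((Equiv.Perm.sign π : ℤ) : ℝ) = 1 := by
    rcases Int.units_eq_one_or (Equiv.Perm.sign π) with h | h <;> simp [h]
  linear_combination (rowSign I * colSign J * minor M I J) * this

end
end KPSoliton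

/-! ### Total nonnegativity under elimination. -/

namespace KPSoliton

section
variable {k n : ℕ} {p : Fin k → Fin n} {M : Fin k → Fin n → ℝ} {r r' : Fin k} {c : Fin n}

/-- The rows of `S` vanish in column `c`, so the expansion along this column has only two terms. -/
theorem minor_cons_cons_expand (habove : ∀ s, s < r → M s c = 0) {m : ℕ} {S : Fin m → Fin k}
    (hS : ∀ a, S a < r) (J : Fin (m + 1) → Fin n) :
    minor M (Fin.cons r' (Fin.cons r S : Fin (m + 1) → Fin k) : Fin (m + 2) → Fin k)
      (Fin.cons c J : Fin (m + 2) → Fin n) =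
      M r' c * minor M (Fin.cons r S : Fin (m + 1) → Fin k) J -
        M r c * minor M (Fin.cons r' S : Fin (m + 1) → Fin k) J := by
  rw [minor, Matrix.det_succ_column_zero, Fin.sum_univ_succ, Fin.sum_univ_succ,
    Finset.sum_eq_zero (s := Finset.univ) (fun a _ => ?_)]
  · have e1 : ((Matrix.of fun a b => M ((Fin.cons r' (Fin.cons r S : Fin (m + 1) → Fin k) :
        Fin (m + 2) → Fin k) a) ((Fin.cons c J : Fin (m + 2) → Fin n) b)).submatrix
          (Fin.succAbove (Fin.succ 0)) Fin.succ) = Matrix.of fun a b =>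
            M ((Fin.cons r' S : Fin (m + 1) → Fin k) a) (J b) := by
      ext a b
      refine Fin.cases ?_ (fun a => ?_) a <;> simp
    rw [e1]
    simp only [Fin.val_zero, Fin.val_succ, pow_zero, zero_add, pow_one, one_mul, add_zero]
    simp only [Matrix.of_apply, Fin.cons_zero, Fin.cons_succ, neg_mul, one_mul, sub_eq_add_neg]
    rfl
  · simp [habove _ (hS a)]

/-- The bracket is `M r' c` times the minor obtained when the elimination step has changed row `r`.
If all rows of `S` lie above `r`, the bracket is itself a minor of `M` with column `c` added.
Otherwise the lowest row `i` of `S` lies below `r'`, and a three-term Plücker relation for the rows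
`i`, `r'`, `r` reduces to the same claim without `i` and with one column fewer. -/
theorem minor_exchange (htn : IsTotallyNonneg p M) (hp : StrictMono p) (hrr : r < r')
    (habove : ∀ s, s < r → M s c = 0) (hpc : p r' < c) (hMr' : 0 < M r' c) :
    ∀ (m : ℕ) (S : Fin m → Fin k) (J : Fin (m + 1) → Fin n), StrictAnti S →
      (∀ a, S a < r ∨ r' < S a) → (∀ b, c ≤ J b) → (∀ a b, p (S a) < J b) →
      0 ≤ rowSign (Fin.cons r S : Fin (m + 1) → Fin k) * colSign J *
        (M r' c * minor M (Fin.cons r S : Fin (m + 1) → Fin k) J -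
          M r c * minor M (Fin.cons r' S : Fin (m + 1) → Fin k) J) := by
  have hrr' : ((r : ℕ) : ℝ) < ((r' : ℕ) : ℝ) := by exact_mod_cast hrr
  intro m
  induction m with
  | zero =>
    intro S J _ _ hJ _
    rw [← minor_cons_cons_expand habove (fun a => a.elim0)]
    by_cases hJc : ∃ b, J b = c
    · obtain ⟨b, hb⟩ := hJc
      rw [minor_eq_zero_of_col_eq (a := 0) (a' := b.succ) (Fin.succ_ne_zero b).symm (by simp [hb]),
        mul_zero]
    push Not at hJc
    have h := htn 2 (Fin.cons r' (Fin.cons r S : Fin 1 → Fin k)) (Fin.cons c J) (fun a b => by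
      have h1 : ∀ b : Fin 2, c ≤ (Fin.cons c J : Fin 2 → Fin n) b :=
        Fin.cases le_rfl fun b => by simpa using hJ b
      refine lt_of_lt_of_le ?_ (h1 b)
      refine Fin.cases hpc (fun a => ?_) a
      refine Fin.cases ((hp hrr).trans hpc) (fun a => a.elim0) a)
    rw [rowSign_cons, colSign_cons, positionSign_eq_one, positionSign_eq_one, one_mul, one_mul] at h
    · exact h
    · exact fun a => by exact_mod_cast lt_of_le_of_ne (hJ a) (Ne.symm (hJc a))
    · exact Fin.cases (by simpa using hrr) fun a => a.elim0
  | succ m ih =>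
    intro S J hS hSr hJ hshape
    by_cases hbase : S 0 < r
    · have hSlt : ∀ a, S a < r := fun a => (hS.antitone (Fin.zero_le a)).trans_lt hbase
      rw [← minor_cons_cons_expand habove hSlt]
      by_cases hJc : ∃ b, J b = c
      · obtain ⟨b, hb⟩ := hJc
        rw [minor_eq_zero_of_col_eq (a := 0) (a' := b.succ) (Fin.succ_ne_zero b).symm
          (by simp [hb]), mul_zero]
      push Not at hJc
      have h := htn (m + 3) (Fin.cons r' (Fin.cons r S : Fin (m + 2) → Fin k)) (Fin.cons c J)
        (fun a b => by
          have h1 : ∀ b : Fin (m + 3), c ≤ (Fin.cons c J : Fin (m + 3) → Fin n) b :=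
            Fin.cases le_rfl fun b => by simpa using hJ b
          refine lt_of_lt_of_le ?_ (h1 b)
          refine Fin.cases hpc (fun a => ?_) a
          refine Fin.cases ((hp hrr).trans hpc) (fun a => ?_) a
          simpa using (hp ((hSlt a).trans hrr)).trans hpc)
      rw [rowSign_cons, colSign_cons, positionSign_eq_one, positionSign_eq_one, one_mul,
        one_mul] at h
      · exact h
      · exact fun a => by exact_mod_cast lt_of_le_of_ne (hJ a) (Ne.symm (hJc a))
      · refine Fin.cases (by simpa using hrr) fun a => ?_
        simp only [Fin.cons_succ, neg_lt_neg_iff, Nat.cast_lt, Fin.val_fin_lt]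
        exact (hSlt a).trans hrr
    obtain ⟨i, T, rfl⟩ : ∃ i T, S = (Fin.cons i T : Fin (m + 1) → Fin k) :=
      ⟨S 0, Fin.tail S, (Fin.cons_self_tail S).symm⟩
    have hi : r' < i := (hSr 0).resolve_left hbase
    have hi' : ((r' : ℕ) : ℝ) < ((i : ℕ) : ℝ) := by exact_mod_cast hi
    have hT : StrictAnti T := fun a b hab => by
      simpa using hS (Fin.succ_lt_succ_iff.2 hab)
    have hTi : ∀ a, T a < i := fun a => by simpa using hS (Fin.succ_pos a)
    have hTr : ∀ a, T a < r ∨ r' < T a := fun a => by simpa using hSr a.succ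
    have hTs : ∀ a b, p (T a) < J b := fun a b => by simpa using hshape a.succ b
    have his : ∀ b, p i < J b := fun b => by simpa using hshape 0 b
    have hrs : ∀ b, p r < J b := fun b => ((hp hrr).trans hpc).trans_le (hJ b)
    have hrs' : ∀ b, p r' < J b := fun b => hpc.trans_le (hJ b)
    have hsh1 : ∀ x, (∀ b, p x < J b) → ∀ (a : Fin (m + 1)) b,
        p ((Fin.cons x T : Fin (m + 1) → Fin k) a) < J b := fun x hx a b =>
      Fin.cases (hx b) (fun a => by simpa using hTs a b) a
    have hsh2 : ∀ x y, (∀ b, p x < J b) → (∀ b, p y < J b) → ∀ (a : Fin (m + 2)) b,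
        p ((Fin.cons x (Fin.cons y T : Fin (m + 1) → Fin k) : Fin (m + 2) → Fin k) a) < J b :=
      fun x y hx hy a b => Fin.cases (hx b) (fun a => hsh1 y hy a b) a
    -- abbreviations for the signs
    set f : Fin m → ℝ := fun a => -((T a : ℕ) : ℝ) with hf
    -- No row of `T` lies between `r` and `r'`, so the two rows sit at the same position relative to
    -- `T`.
    have hτ : positionSign (-((r' : ℕ) : ℝ)) f = positionSign (-((r : ℕ) : ℝ)) f := by
      refine positionSign_congr fun a => ?_
      rcases hTr a with h | h
      · have h1 : ((T a : ℕ) : ℝ) < ((r : ℕ) : ℝ) := by exact_mod_cast h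
        rw [sign_pos (by simp only [hf]; linarith), sign_pos (by simp only [hf]; linarith)]
      · have h1 : ((r' : ℕ) : ℝ) < ((T a : ℕ) : ℝ) := by exact_mod_cast h
        rw [sign_neg (by simp only [hf]; linarith), sign_neg (by simp only [hf]; linarith)]
    have hcons2 : ∀ x y : Fin k, rowSign (Fin.cons x (Fin.cons y T : Fin (m + 1) → Fin k) :
        Fin (m + 2) → Fin k) = (SignType.sign (((x : ℕ) : ℝ) - ((y : ℕ) : ℝ)) : SignType) *
          positionSign (-((x : ℕ) : ℝ)) f * (positionSign (-((y : ℕ) : ℝ)) f * rowSign T) := by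
      intro x y
      rw [rowSign_cons, rowSign_cons]
      congr 1
      have : (fun a => -(((Fin.cons y T : Fin (m + 1) → Fin k) a : ℕ) : ℝ)) =
          (Fin.cons (-((y : ℕ) : ℝ)) f : Fin (m + 1) → ℝ) := by
        ext a
        refine Fin.cases ?_ (fun a => ?_) a <;> simp [hf]
      rw [this, positionSign_cons, show -((y : ℕ) : ℝ) - -((x : ℕ) : ℝ) = (x : ℕ) - (y : ℕ) by ring]
    have s1 := hcons2 i r
    have s2 := hcons2 i r'
    have s3 := hcons2 r' r
    have s4 := hcons2 r i
    rw [sign_pos (by linarith)] at s1 s2 s3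
    rw [sign_neg (by linarith)] at s4
    rw [hτ] at s2 s3
    have t1 : rowSign (Fin.cons r T : Fin (m + 1) → Fin k) =
        positionSign (-((r : ℕ) : ℝ)) f * rowSign T := rowSign_cons _ _
    have t2 : rowSign (Fin.cons r' T : Fin (m + 1) → Fin k) =
        positionSign (-((r : ℕ) : ℝ)) f * rowSign T := by rw [rowSign_cons, hτ]
    have t3 : rowSign (Fin.cons i T : Fin (m + 1) → Fin k) =
        positionSign (-((i : ℕ) : ℝ)) f * rowSign T := rowSign_cons _ _
    have hτr : positionSign (-((r : ℕ) : ℝ)) f * positionSign (-((r : ℕ) : ℝ)) f = 1 := by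
      refine positionSign_mul_self fun a => ?_
      have : T a ≠ r := by
        rcases hTr a with h | h
        · exact h.ne
        · exact (hrr.trans h).ne'
      simpa [hf, Fin.val_inj] using this
    have he0 : rowSign T * rowSign T = 1 := by
      refine orderSign_mul_self fun a b hab => hT.injective ?_
      simpa [Fin.val_inj] using hab
    simp only [SignType.coe_one, SignType.coe_neg, one_mul] at s1 s2 s3 s4
    set τ := positionSign (-((r : ℕ) : ℝ)) f
    set σ := positionSign (-((i : ℕ) : ℝ)) f
    set e := rowSign T
    set A := minor M (Fin.cons i (Fin.cons r T : Fin (m + 1) → Fin k)) J with hA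
    set B := minor M (Fin.cons i (Fin.cons r' T : Fin (m + 1) → Fin k)) J with hB
    have hA0 : 0 ≤ σ * (τ * e) * colSign J * A := by
      rw [← s1]; exact htn _ _ _ (hsh2 _ _ his hrs)
    have hB0 : 0 ≤ σ * (τ * e) * colSign J * B := by
      rw [← s2]; exact htn _ _ _ (hsh2 _ _ his hrs')
    rw [s4, minor_swap M r i, minor_swap M r' i, ← hA, ← hB]
    suffices h : M r c * (σ * (τ * e) * colSign J * B) ≤ M r' c * (σ * (τ * e) * colSign J * A) by
      linarith
    by_cases hBz : B = 0
    · rw [hBz, mul_zero, mul_zero]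
      exact mul_nonneg hMr'.le hA0
    have hJinj : Function.Injective J := fun b b' h => by
      by_contra hne
      exact hBz (minor_eq_zero_of_col_eq hne h)
    -- Since `B` does not vanish, its expansion along row `i` has a nonzero cofactor. Its column is
    -- the one to delete, so that `E` is positive after signing and can be cancelled at the end.
    obtain ⟨j, hj⟩ : ∃ j : Fin (m + 2),
        minor M (Fin.cons r' T : Fin (m + 1) → Fin k) (J ∘ j.succAbove) ≠ 0 := by
      by_contra! hall
      refine hBz ?_
      rw [hB, minor, Matrix.det_succ_row_zero]
      refine Finset.sum_eq_zero fun j _ => ?_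
      have : (Matrix.submatrix (Matrix.of fun a b => M ((Fin.cons i (Fin.cons r' T :
          Fin (m + 1) → Fin k) : Fin (m + 2) → Fin k) a) (J b)) Fin.succ j.succAbove).det =
          minor M (Fin.cons r' T : Fin (m + 1) → Fin k) (J ∘ j.succAbove) := rfl
      rw [this, hall, mul_zero]
    have hplu := det_three_term (fun b => M i (J b)) (fun b => M r' (J b)) (fun b => M r (J b))
      (fun a b => M (T a) (J b)) j
    have hd2 : ∀ x y : Fin k, (Matrix.of (Fin.cons (fun b => M x (J b)) (Fin.cons
        (fun b => M y (J b)) (fun a b => M (T a) (J b)) : Fin (m + 1) → Fin (m + 2) → ℝ) :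
        Fin (m + 2) → Fin (m + 2) → ℝ)).det =
        minor M (Fin.cons x (Fin.cons y T : Fin (m + 1) → Fin k)) J := by
      intro x y
      rw [minor]
      congr 1
      ext a b
      refine Fin.cases ?_ (fun a => Fin.cases ?_ (fun a => ?_) a) a <;> simp
    have hd1 : ∀ x : Fin k, (Matrix.of fun a b => (Fin.cons (fun b => M x (J b))
        (fun a b => M (T a) (J b)) : Fin (m + 1) → Fin (m + 2) → ℝ) a (j.succAbove b)).det =
        minor M (Fin.cons x T : Fin (m + 1) → Fin k) (J ∘ j.succAbove) := by
      intro x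
      rw [minor]
      congr 1
      ext a b
      refine Fin.cases ?_ (fun a => ?_) a <;> simp
    simp only [hd2, hd1] at hplu
    rw [← hA, ← hB] at hplu
    set G := minor M (Fin.cons r' (Fin.cons r T : Fin (m + 1) → Fin k)) J
    set C := minor M (Fin.cons r T : Fin (m + 1) → Fin k) (J ∘ j.succAbove)
    set E := minor M (Fin.cons r' T : Fin (m + 1) → Fin k) (J ∘ j.succAbove)
    set F := minor M (Fin.cons i T : Fin (m + 1) → Fin k) (J ∘ j.succAbove)
    set u := colSign J
    set v := colSign (J ∘ j.succAbove) with hv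
    have hv2 : v * v = 1 := by
      refine orderSign_mul_self fun a b hab => ?_
      have := hJinj (Fin.val_injective (Nat.cast_injective hab))
      exact Fin.succAbove_right_injective this
    have hC0 := ih T (J ∘ j.succAbove) hT hTr (fun b => hJ _) (fun a b => hTs a _)
    rw [t1] at hC0
    have hE0 : 0 ≤ τ * e * v * E := by
      rw [← t2]; exact htn _ _ _ fun a b => hsh1 r' hrs' a _
    have hF0 : 0 ≤ σ * e * v * F := by
      rw [← t3]; exact htn _ _ _ fun a b => hsh1 i his a _
    have hG0 : 0 ≤ τ * (τ * e) * u * G := by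
      rw [← s3]; exact htn _ _ _ (hsh2 _ _ hrs' hrs)
    have hEpos : 0 < τ * e * v * E := by
      refine lt_of_le_of_ne hE0 (Ne.symm ?_)
      refine mul_ne_zero (mul_ne_zero (mul_ne_zero ?_ ?_) ?_) hj
      · exact left_ne_zero_of_mul_eq_one hτr
      · exact left_ne_zero_of_mul_eq_one he0
      · exact left_ne_zero_of_mul_eq_one hv2
    -- Up to signs the relation is `A E = B C + G F` with all six minors contributing nonnegatively
    -- except `C`, whose comparison with `E` is the induction hypothesis. Dropping `G F` gives the
    -- inequality after division by `E`.
    have key : (σ * (τ * e) * u * A) * (τ * e * v * E) =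
        (σ * (τ * e) * u * B) * (τ * e * v * C) + (τ * (τ * e) * u * G) * (σ * e * v * F) := by
      linear_combination (-(σ * τ ^ 2 * e ^ 2 * u * v)) * hplu
    have h1 : 0 ≤ (τ * (τ * e) * u * G) * (σ * e * v * F) := mul_nonneg hG0 hF0
    have h2 : M r c * (τ * e * v * E) ≤ M r' c * (τ * e * v * C) := by
      simp only [C, E] at hC0 ⊢
      linarith
    have h3 := mul_le_mul_of_nonneg_left h2 hB0
    have h4 := mul_nonneg hMr'.le h1
    refine le_of_mul_le_mul_right ?_ hEpos
    calc M r c * (σ * (τ * e) * u * B) * (τ * e * v * E)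
        = σ * (τ * e) * u * B * (M r c * (τ * e * v * E)) := by ring
      _ ≤ σ * (τ * e) * u * B * (M r' c * (τ * e * v * C)) := h3
      _ ≤ M r' c * ((σ * (τ * e) * u * B) * (τ * e * v * C) +
            (τ * (τ * e) * u * G) * (σ * e * v * F)) := by linarith
      _ = M r' c * (σ * (τ * e) * u * A) * (τ * e * v * E) := by rw [← key]; ring

/-- A sequence of distinct rows containing `r` can be permuted so that `r` comes first, followed by
the other rows in decreasing order. -/
theorem exists_perm_eq_cons {m : ℕ} {I : Fin m → Fin k} (hI : Function.Injective I) {a₀ : Fin m}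
    (ha₀ : I a₀ = r) : ∃ (m' : ℕ) (e : m' + 1 = m) (π : Equiv.Perm (Fin m)) (S : Fin m' → Fin k),
      StrictAnti S ∧ (∀ a, S a ≠ r) ∧
        I ∘ π = fun a => (Fin.cons r S : Fin (m' + 1) → Fin k) (Fin.cast e.symm a) := by
  obtain ⟨m', rfl⟩ : ∃ m', m = m' + 1 := ⟨m - 1, by have := a₀.2; omega⟩
  let f : Fin (m' + 1) → ℤ := fun a => if I a = r then -1 else (k : ℤ) - (I a : ℕ)
  have hf : ∀ a, I a ≠ r → f a = (k : ℤ) - (I a : ℕ) := fun a h => if_neg h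
  have hf' : ∀ a, I a = r → f a = -1 := fun a h => if_pos h
  have hinj : Function.Injective f := by
    intro a b hab
    apply hI
    have := (I a).2
    have := (I b).2
    by_cases h1 : I a = r <;> by_cases h2 : I b = r
    · rw [h1, h2]
    · rw [hf' a h1, hf b h2] at hab; omega
    · rw [hf a h1, hf' b h2] at hab; omega
    · rw [hf a h1, hf b h2] at hab
      exact Fin.ext (by omega)
  let π := Tuple.sort f
  have hmono : StrictMono (f ∘ π) :=
    (Tuple.monotone_sort f).strictMono_of_injective (hinj.comp π.injective)
  have h0 : I (π 0) = r := by
    by_contra h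
    have h1 := hmono.monotone (Fin.zero_le (π.symm a₀))
    simp only [Function.comp_apply, Equiv.apply_symm_apply] at h1
    rw [hf _ h, hf' a₀ ha₀] at h1
    have := (I (π 0)).2
    omega
  have hne : ∀ a : Fin m', I (π a.succ) ≠ r := fun a h => by
    have := π.injective (hI (h.trans h0.symm))
    exact Fin.succ_ne_zero a this
  refine ⟨m', rfl, π, fun a => I (π a.succ), fun a b hab => ?_, hne, ?_⟩
  · have := hmono (Fin.succ_lt_succ_iff.2 hab)
    simp only [Function.comp_apply] at this
    rw [hf _ (hne a), hf _ (hne b)] at this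
    change I (π b.succ) < I (π a.succ)
    exact Fin.lt_def.2 (by omega)
  · ext a
    refine Fin.cases ?_ (fun a => ?_) a
    · simp [h0]
    · simp

/-- Only minors that contain row `r` change, and by linearity they change by a multiple of the minor
with `r` replaced by `r'`. Columns before `c` are zero, so all columns of interest are at least `c`,
as `minor_exchange` requires. -/
theorem IsTotallyNonneg.eliminate (htn : IsTotallyNonneg p M) (hp : StrictMono p) (hrr : r < r')
    (hzero : ∀ s, r < s → s < r' → ∀ j, M s j = 0) (hcol : ∀ j, j < c → ∀ i, M i j = 0)
    (habove : ∀ s, s < r → M s c = 0) (hpc : p r' < c) (hMr' : 0 < M r' c) :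
    IsTotallyNonneg p (Function.update M r fun j => M r j - M r c / M r' c * M r' j) := by
  intro m I J hshape
  set M' := Function.update M r fun j => M r j - M r c / M r' c * M r' j with hM'
  have hM'r : ∀ j, M' r j = M r j - M r c / M r' c * M r' j := fun j => by simp [hM']
  have hM'ne : ∀ i, i ≠ r → M' i = M i := fun i hi => by simp [hM', hi]
  by_cases hex : ∃ a, I a = r
  swap
  · push Not at hex
    have : minor M' I J = minor M I J := by
      rw [minor, minor]
      congr 1
      ext a b
      rw [Matrix.of_apply, hM'ne _ (hex a), Matrix.of_apply]
    rw [this]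
    exact htn m I J hshape
  by_cases hinj : Function.Injective I
  swap
  · simp only [Function.Injective, not_forall] at hinj
    obtain ⟨a, b, h, hne⟩ := hinj
    rw [minor_eq_zero_of_row_eq hne h, mul_zero]
  by_cases hJ : ∀ b, c ≤ J b
  swap
  · push Not at hJ
    obtain ⟨b, hb⟩ := hJ
    rw [minor_eq_zero_of_col b fun a => ?_, mul_zero]
    by_cases h : I a = r
    · rw [h, hM'r, hcol _ hb, hcol _ hb, mul_zero, sub_zero]
    · rw [hM'ne _ h, hcol _ hb]
  obtain ⟨a₀, ha₀⟩ := hex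
  obtain ⟨m', rfl, π, S, hS, hSr, hI⟩ := exists_perm_eq_cons hinj ha₀
  rw [← rowSign_mul_minor_comp_perm M' I J π]
  have hshape' : ∀ a b, p ((I ∘ π) a) < J b := fun a b => hshape _ _
  rw [hI] at hshape' ⊢
  simp only [Fin.cast_refl, id] at hshape' ⊢
  change 0 ≤ rowSign (Fin.cons r S : Fin (m' + 1) → Fin k) * colSign J *
    minor M' (Fin.cons r S : Fin (m' + 1) → Fin k) J
  have hlin : minor M' (Fin.cons r S : Fin (m' + 1) → Fin k) J =
      minor M (Fin.cons r S : Fin (m' + 1) → Fin k) J -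
        M r c / M r' c * minor M (Fin.cons r' S : Fin (m' + 1) → Fin k) J := by
    simp only [minor]
    rw [Matrix.det_succ_row_zero, Matrix.det_succ_row_zero, Matrix.det_succ_row_zero,
      Finset.mul_sum, ← Finset.sum_sub_distrib]
    refine Finset.sum_congr rfl fun b _ => ?_
    have e1 : (Matrix.of fun a b => M' ((Fin.cons r S : Fin (m' + 1) → Fin k) a) (J b)).submatrix
        Fin.succ b.succAbove = Matrix.of fun a b' => M (S a) (J (b.succAbove b')) := by
      ext a b'
      simp [hM'ne _ (hSr a)]
    have e2 : ∀ x : Fin k, (Matrix.of fun a b =>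
        M ((Fin.cons x S : Fin (m' + 1) → Fin k) a) (J b)).submatrix
        Fin.succ b.succAbove = Matrix.of fun a b' => M (S a) (J (b.succAbove b')) := fun x => rfl
    rw [e1, e2, e2]
    simp only [Matrix.of_apply, Fin.cons_zero, hM'r]
    ring
  have hTNr := htn _ _ _ hshape'
  -- If `r'` is already among the rows, the row operation does not affect the minor; if some row
  -- lies strictly between `r` and `r'`, that row is zero. In the remaining case `minor_exchange`
  -- applies.
  by_cases h1 : ∃ a, S a = r'
  · obtain ⟨a, ha⟩ := h1
    rw [hlin, minor_eq_zero_of_row_eq (I := (Fin.cons r' S : Fin (m' + 1) → Fin k)) (a := 0)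
      (a' := a.succ) (Fin.succ_ne_zero a).symm (by simp [ha]), mul_zero, sub_zero]
    exact hTNr
  by_cases h2 : ∃ a, r < S a ∧ S a < r'
  · obtain ⟨a, ha, ha'⟩ := h2
    rw [minor_eq_zero_of_row a.succ fun b => ?_, mul_zero]
    simp [hM'ne _ (hSr a), hzero _ ha ha']
  push Not at h1 h2
  have hex := minor_exchange htn hp hrr habove hpc hMr' m' S J hS (fun a => by
    rcases lt_trichotomy (S a) r with h | h | h
    · exact Or.inl h
    · exact absurd h (hSr a)
    · exact Or.inr (lt_of_le_of_ne (h2 a h) (Ne.symm (h1 a)))) hJ (fun a b => by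
      simpa using hshape' a.succ b)
  rw [hlin]
  have : ∀ x y : ℝ, x - M r c / M r' c * y = (M r' c * x - M r c * y) / M r' c := fun x y => by
    field_simp
  rw [this, ← mul_div_assoc]
  exact div_nonneg hex hMr'.le

/-- After clearing, column `c` is zero, so minors through it vanish and all others are unchanged. -/
theorem IsTotallyNonneg.clear (htn : IsTotallyNonneg p M)
    (hclear : ∀ s, s ≠ r → M s c = 0) :
    IsTotallyNonneg p (Function.update M r (Function.update (M r) c 0)) := by
  intro m I J hshape
  have hval : ∀ i j, Function.update M r (Function.update (M r) c 0) i j =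
      if j = c then 0 else M i j := fun i j => by
    by_cases hi : i = r
    · subst hi
      by_cases hj : j = c
      · subst hj; simp
      · simp [hj]
    · by_cases hj : j = c
      · subst hj; simp [hi, hclear i hi]
      · simp [hi, hj]
  by_cases hJ : ∃ b, J b = c
  · obtain ⟨b, hb⟩ := hJ
    rw [minor_eq_zero_of_col b fun a => by rw [hval, if_pos hb], mul_zero]
  · push Not at hJ
    have : minor (Function.update M r (Function.update (M r) c 0)) I J = minor M I J := by
      rw [minor, minor]
      congr 1
      ext a b
      rw [Matrix.of_apply, hval, if_neg (hJ b), Matrix.of_apply]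
    rw [this]
    exact htn m I J hshape

theorem IsTotallyNonneg.entry (htn : IsTotallyNonneg p M) {i : Fin k} {j : Fin n} (h : p i < j) :
    0 ≤ M i j := by
  have := htn 1 (fun _ => i) (fun _ => j) fun _ _ => h
  simpa [rowSign, colSign, orderSign, minor] using this

/-- This is the source of the Le-rule: if `M r c` and `M s l` are positive, then `M s c` cannot
vanish. -/
theorem IsTotallyNonneg.two (htn : IsTotallyNonneg p M) (hp : StrictMono p) {r s : Fin k}
    {c l : Fin n} (hrs : r < s) (hcl : c < l) (h : p s < c) :
    M s l * M r c ≤ M s c * M r l := by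
  have := htn 2 ![s, r] ![c, l] (by
    have h1 := hp hrs
    intro a b
    fin_cases a <;> fin_cases b
    · exact h
    · exact h.trans hcl
    · exact h1.trans h
    · exact (h1.trans h).trans hcl)
  have h1 : rowSign ![s, r] = 1 := orderSign_of_strictMono (by
    intro a b hab
    fin_cases a <;> fin_cases b <;> first | exact absurd hab (by decide) | skip
    simpa using hrs)
  have h2 : colSign ![c, l] = 1 := orderSign_of_strictMono (by
    intro a b hab
    fin_cases a <;> fin_cases b <;> first | exact absurd hab (by decide) | skip
    simpa using hcl)
  rw [h1, h2, minor, Matrix.det_fin_two] at this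
  simp at this
  linarith

end
end KPSoliton

/-! ### From maximal minors to minors of the unsigned matrix. -/

namespace KPSoliton

section
variable {k n : ℕ}

theorem nonneg_orderSign_mul_det {R : Matrix (Fin k) (Fin n) ℝ}
    (hR : ∀ J : Fin k ↪o Fin n, 0 ≤ (R.submatrix id J).det) (g : Fin k → Fin n) :
    0 ≤ orderSign (fun a => ((g a : ℕ) : ℝ)) * (R.submatrix id g).det := by
  by_cases hg : Function.Injective g
  swap
  · simp only [Function.Injective, not_forall] at hg
    obtain ⟨a, b, h, hne⟩ := hg
    rw [Matrix.det_zero_of_column_eq hne (by intro i; simp [h]), mul_zero]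
  let π := Tuple.sort g
  have hmono : StrictMono (g ∘ π) :=
    (Tuple.monotone_sort g).strictMono_of_injective (hg.comp π.injective)
  have h1 := hR (OrderEmbedding.ofStrictMono _ hmono)
  have h2 : (R.submatrix id (OrderEmbedding.ofStrictMono _ hmono)).det =
      (Equiv.Perm.sign π : ℤ) * (R.submatrix id g).det := by
    rw [← Matrix.det_permute']
    rfl
  have h3 := orderSign_comp_perm (fun a => ((g a : ℕ) : ℝ)) π
  rw [orderSign_of_strictMono (f := (fun a => ((g a : ℕ) : ℝ)) ∘ π)
    fun a b hab => by simpa using hmono hab] at h3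
  rw [h2] at h1
  rcases Int.units_eq_one_or (Equiv.Perm.sign π) with h | h <;> rw [h] at h1 h3
  · simp at h1 h3
    rwa [← h3, one_mul]
  · simp at h1 h3
    rw [show orderSign (fun a => ((g a : ℕ) : ℝ)) = -1 by linarith]
    linarith

/-- A transposition brings entry `i` to the front, where its contribution is a product of position
signs. The sign of the remaining entries is common to the old and the new value and cancels. -/
theorem orderSign_update {m : ℕ} (f : Fin m → ℝ) (i : Fin m) (y : ℝ)
    (hf : ∀ s, s ≠ i → f s ≠ f i) :
    orderSign (Function.update f i y) = (∏ s ∈ Finset.univ.erase i,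
      ((SignType.sign ((f s - y) * (f s - f i)) : SignType) : ℝ)) * orderSign f := by
  obtain ⟨m, rfl⟩ : ∃ m', m = m' + 1 := ⟨m - 1, by have := i.2; omega⟩
  have key : ∀ z, orderSign (Function.update f i z) =
      (Equiv.Perm.sign (Equiv.swap 0 i) : ℤ) *
        ((∏ s ∈ Finset.univ.erase i, ((SignType.sign (f s - z) : SignType) : ℝ)) *
          orderSign (Fin.tail (f ∘ Equiv.swap 0 i))) := by
    intro z
    have h1 := orderSign_comp_perm (Function.update f i z ∘ Equiv.swap 0 i) (Equiv.swap 0 i)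
    rw [Function.comp_assoc, show (Equiv.swap 0 i : Fin (m + 1) → Fin (m + 1)) ∘ Equiv.swap 0 i = id
      from by ext a; simp, Function.comp_id] at h1
    have h2 : Function.update f i z ∘ Equiv.swap 0 i =
        (Fin.cons z (Fin.tail (f ∘ Equiv.swap 0 i)) : Fin (m + 1) → ℝ) := by
      ext a
      refine Fin.cases ?_ (fun a => ?_) a
      · simp
      · have : Equiv.swap 0 i a.succ ≠ i := fun h => by
          rw [Equiv.swap_apply_eq_iff, Equiv.swap_apply_right] at h
          exact Fin.succ_ne_zero a h
        simp [Fin.tail, Function.update_of_ne this]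
    rw [h1, h2, orderSign_cons]
    congr 2
    rw [positionSign]
    have h3 : ∀ g : Fin m → ℝ, (((SignType.sign (∏ a, g a)) : SignType) : ℝ) =
        ∏ a, ((SignType.sign (g a) : SignType) : ℝ) := fun g => by
      rw [show SignType.sign (∏ a, g a) = ∏ a, SignType.sign (g a) from
        map_prod (signHom : ℝ →*₀ SignType) _ _]
      exact map_prod (SignType.castHom : SignType →*₀ ℝ) _ _
    rw [h3]
    refine Finset.prod_bij (fun a _ => Equiv.swap 0 i a.succ) (fun a _ => ?_) (fun a _ b _ h => ?_)
      (fun s hs => ?_) (fun a _ => rfl)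
    · simp only [Finset.mem_erase, Finset.mem_univ, and_true]
      intro h
      rw [Equiv.swap_apply_eq_iff, Equiv.swap_apply_right] at h
      exact Fin.succ_ne_zero a h
    · exact Fin.succ_injective _ ((Equiv.swap 0 i).injective h)
    · have hs' : Equiv.swap 0 i s ≠ 0 := fun h => by
        rw [Equiv.swap_apply_eq_iff, Equiv.swap_apply_left] at h
        exact (Finset.mem_erase.1 hs).1 h
      refine ⟨(Equiv.swap 0 i s).pred hs', Finset.mem_univ _, ?_⟩
      simp
  have h0 := key (f i)
  rw [Function.update_eq_self] at h0
  rw [key y, h0]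
  have hsq : (∏ s ∈ Finset.univ.erase i, ((SignType.sign (f s - f i) : SignType) : ℝ)) *
      (∏ s ∈ Finset.univ.erase i, ((SignType.sign (f s - f i) : SignType) : ℝ)) = 1 := by
    rw [← Finset.prod_mul_distrib]
    exact Finset.prod_eq_one fun s hs =>
      sign_mul_self_eq_one (sub_ne_zero.2 (hf s (Finset.mem_erase.1 hs).1))
  simp only [sign_mul, SignType.coe_mul, Finset.prod_mul_distrib]
  linear_combination (-((Equiv.Perm.sign (Equiv.swap 0 i) : ℤ) *
    ((∏ s ∈ Finset.univ.erase i, ((SignType.sign (f s - y) : SignType) : ℝ)) *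
          orderSign (Fin.tail (f ∘ Equiv.swap 0 i))))) * hsq

/-- The number of pivots strictly between two columns. -/
def countBetween (p : Fin k → Fin n) (i j : Fin n) : ℕ :=
  (Finset.univ.filter fun s => i < p s ∧ p s < j).card

theorem neg_one_pow_countBetween {p : Fin k ↪o Fin n} {i : Fin k} {j : Fin n} (hij : p i < j)
    (hj : j ∉ Set.range p) : (-1 : ℝ) ^ countBetween p (p i) j = ∏ s ∈ Finset.univ.erase i,
      ((SignType.sign ((((p s : ℕ) : ℝ) - (j : ℕ)) * (((p s : ℕ) : ℝ) - (p i : ℕ))) : SignType) :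
        ℝ) := by
  have h1 : ∀ s ∈ Finset.univ.erase i, ((SignType.sign ((((p s : ℕ) : ℝ) - (j : ℕ)) *
      (((p s : ℕ) : ℝ) - (p i : ℕ))) : SignType) : ℝ) =
        if p i < p s ∧ p s < j then -1 else 1 := by
    intro s hs
    have hsi : p s ≠ p i := fun h => (Finset.mem_erase.1 hs).1 (p.injective h)
    have hsj : p s ≠ j := fun h => hj ⟨s, h⟩
    have hij' : ((p i : ℕ) : ℝ) < (j : ℕ) := by exact_mod_cast hij
    rcases lt_or_gt_of_ne hsi with h | h
    · have h' : ((p s : ℕ) : ℝ) < (p i : ℕ) := by exact_mod_cast h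
      rw [if_neg fun h2 => h2.1.not_gt h, sign_pos (mul_pos_of_neg_of_neg (by linarith)
        (by linarith))]
      rfl
    · have h' : ((p i : ℕ) : ℝ) < (p s : ℕ) := by exact_mod_cast h
      rcases lt_or_gt_of_ne hsj with h3 | h3
      · have h3' : ((p s : ℕ) : ℝ) < (j : ℕ) := by exact_mod_cast h3
        rw [if_pos ⟨h, h3⟩, sign_neg (mul_neg_of_neg_of_pos (by linarith) (by linarith))]
        simp
      · have h3' : ((j : ℕ) : ℝ) < (p s : ℕ) := by exact_mod_cast h3
        rw [if_neg fun h2 => h2.2.not_gt h3, sign_pos (mul_pos (by linarith) (by linarith))]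
        rfl
  rw [Finset.prod_congr rfl h1, Finset.prod_ite, Finset.prod_const, Finset.prod_const_one, mul_one,
    countBetween]
  congr 2
  ext s
  simp only [Finset.mem_filter, Finset.mem_univ, true_and, Finset.mem_erase, and_true]
  exact ⟨fun h => ⟨fun e => (e ▸ h.1).ne rfl, h⟩, fun h => h.2⟩

/-- `g` is the identity sequence of pivots with each `p (I a)` exchanged for `J a`. The exchanges
are made one at a time with `orderSign_update`. Pivots in place produce the parity of the pivots
passed over; pivots already exchanged produce in addition the row and column signs. -/
theorem exists_exchange (p : Fin k ↪o Fin n) : ∀ (m : ℕ) (I : Fin m → Fin k) (J : Fin m → Fin n),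
    Function.Injective I → (∀ a b, p (I a) < J b) → (∀ b, J b ∉ Set.range p) →
    ∃ g : Fin k → Fin n, (∀ a, g (I a) = J a) ∧ (∀ s, s ∉ Set.range I → g s = p s) ∧
      orderSign (fun a => ((g a : ℕ) : ℝ)) =
        rowSign I * colSign J * ∏ a, (-1 : ℝ) ^ countBetween p (p (I a)) (J a) := by
  intro m
  induction m with
  | zero =>
    intro I J _ _ _
    refine ⟨p, fun a => a.elim0, fun s _ => rfl, ?_⟩
    rw [orderSign_of_strictMono fun a b hab => by simpa using hab]
    simp [rowSign, colSign, orderSign]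
  | succ m ih =>
    intro I J hI hshape hJ
    obtain ⟨i, I, rfl⟩ : ∃ i T, I = (Fin.cons i T : Fin (m + 1) → Fin k) :=
      ⟨I 0, Fin.tail I, (Fin.cons_self_tail I).symm⟩
    obtain ⟨j, J, rfl⟩ : ∃ i T, J = (Fin.cons i T : Fin (m + 1) → Fin n) :=
      ⟨J 0, Fin.tail J, (Fin.cons_self_tail J).symm⟩
    have hI' := Fin.cons_injective_iff.1 hI
    have hij : p i < j := hshape 0 0
    have hiJ : ∀ b, p i < J b := fun b => by simpa using hshape 0 b.succ
    have hIj : ∀ a, p (I a) < j := fun a => by simpa using hshape a.succ 0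
    obtain ⟨g, hg1, hg2, hg3⟩ := ih I J hI'.2
      (fun a b => by simpa using hshape a.succ b.succ) (fun b => by simpa using hJ b.succ)
    have hgi : g i = p i := hg2 i hI'.1
    refine ⟨Function.update g i j, ?_, ?_, ?_⟩
    · refine Fin.cases (by simp) fun a => ?_
      have : I a ≠ i := fun h => hI'.1 ⟨a, h⟩
      simp [Function.update_of_ne this, hg1]
    · intro s hs
      have h1 : s ≠ i := fun h => hs ⟨0, by simp [h]⟩
      rw [Function.update_of_ne h1]
      exact hg2 s fun ⟨a, ha⟩ => hs ⟨a.succ, by simp [ha]⟩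
    have hup : (fun a => ((Function.update g i j a : ℕ) : ℝ)) =
        Function.update (fun a => ((g a : ℕ) : ℝ)) i (j : ℕ) := by
      ext a
      by_cases h : a = i
      · subst h; simp
      · simp [h]
    rw [hup, orderSign_update _ _ _ fun s hs => ?_, hg3, rowSign_cons, colSign_cons,
      Fin.prod_univ_succ]
    swap
    · simp only [hgi]
      by_cases h : s ∈ Set.range I
      · obtain ⟨a, rfl⟩ := h
        rw [hg1]
        exact fun h => (hiJ a).ne' (Fin.ext (by exact_mod_cast h))
      · rw [hg2 s h]
        exact fun h => hs (p.injective (Fin.ext (by exact_mod_cast h)))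
    simp only [Fin.cons_zero, Fin.cons_succ, hgi]
    rw [neg_one_pow_countBetween hij (hJ 0)]
    have hsplit : ∀ h : Fin k → ℝ, ∏ s ∈ Finset.univ.erase i, h s =
        (∏ s ∈ (Finset.univ.erase i).filter fun s => s ∉ Set.range I, h s) * ∏ a, h (I a) := by
      classical
      intro h
      rw [← Finset.prod_filter_mul_prod_filter_not (Finset.univ.erase i) (fun s => s ∉ Set.range I)]
      congr 1
      symm
      refine Finset.prod_bij (fun a _ => I a) (fun a _ => ?_) (fun a _ b _ hab => hI'.2 hab)
        (fun s hs => ?_) (fun a _ => rfl)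
      · simp only [Finset.mem_filter, Finset.mem_erase, Finset.mem_univ, and_true, not_not]
        exact ⟨fun h => hI'.1 ⟨a, h⟩, a, rfl⟩
      · simp only [Finset.mem_filter, not_not] at hs
        obtain ⟨a, ha⟩ := hs.2
        exact ⟨a, Finset.mem_univ _, ha⟩
    have hpos : ∀ {l : ℕ} (x : ℝ) (f : Fin l → ℝ), positionSign x f =
        ∏ a, ((SignType.sign (f a - x) : SignType) : ℝ) := fun x f => by
      rw [positionSign, show SignType.sign (∏ a, (f a - x)) = ∏ a, SignType.sign (f a - x) from
        map_prod (signHom : ℝ →*₀ SignType) _ _]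
      exact map_prod (SignType.castHom : SignType →*₀ ℝ) _ _
    rw [hsplit, hsplit, hpos, hpos]
    have e1 : ∀ s ∈ (Finset.univ.erase i).filter fun s => s ∉ Set.range I, g s = p s :=
      fun s hs => hg2 s (Finset.mem_filter.1 hs).2
    rw [Finset.prod_congr rfl fun s hs => by rw [e1 s hs]]
    -- For a pivot already exchanged, replacing `J a` by `p (I a)` in its factor costs exactly the
    -- relative sign of the two rows and that of the two columns, because every exchanged pivot lies
    -- below every new column.
    have e2 : (∏ a, ((SignType.sign ((((g (I a) : ℕ) : ℝ) - (j : ℕ)) *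
        (((g (I a) : ℕ) : ℝ) - (p i : ℕ))) : SignType) : ℝ)) =
        (∏ a, ((SignType.sign ((((p (I a) : ℕ) : ℝ) - (j : ℕ)) *
          (((p (I a) : ℕ) : ℝ) - (p i : ℕ))) : SignType) : ℝ)) *
        ((∏ a, ((SignType.sign (-((I a : ℕ) : ℝ) - -((i : ℕ) : ℝ)) : SignType) : ℝ)) *
          ∏ a, ((SignType.sign (((J a : ℕ) : ℝ) - (j : ℕ)) : SignType) : ℝ)) := by
      rw [← Finset.prod_mul_distrib, ← Finset.prod_mul_distrib]
      refine Finset.prod_congr rfl fun a _ => ?_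
      have q1 : ((p i : ℕ) : ℝ) < (J a : ℕ) := by exact_mod_cast hiJ a
      have q2 : ((p (I a) : ℕ) : ℝ) < (j : ℕ) := by exact_mod_cast hIj a
      rw [hg1, sign_mul, sign_pos (sub_pos.2 q1), mul_one, sign_mul,
        sign_neg (sub_neg.2 q2)]
      have hne : I a ≠ i := fun h => hI'.1 ⟨a, h⟩
      rcases lt_or_gt_of_ne hne with h | h
      · have q3 : ((p (I a) : ℕ) : ℝ) < (p i : ℕ) := by exact_mod_cast p.strictMono h
        have q4 : ((I a : ℕ) : ℝ) < (i : ℕ) := by exact_mod_cast h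
        rw [sign_neg (sub_neg.2 q3), sign_pos (show 0 < -((I a : ℕ) : ℝ) - -((i : ℕ) : ℝ) by linarith)]
        simp
      · have q3 : ((p i : ℕ) : ℝ) < (p (I a) : ℕ) := by exact_mod_cast p.strictMono h
        have q4 : ((i : ℕ) : ℝ) < (I a : ℕ) := by exact_mod_cast h
        rw [sign_pos (sub_pos.2 q3), sign_neg (show -((I a : ℕ) : ℝ) - -((i : ℕ) : ℝ) < 0 by linarith)]
        simp
    rw [e2]
    ring

/-- The nonpivot part of a matrix in reduced row echelon form, with the signs removed. -/
noncomputable def unsignedPart (p : Fin k → Fin n) (R : Matrix (Fin k) (Fin n) ℝ) :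
    Fin k → Fin n → ℝ :=
  fun r j => if p r < j then (-1) ^ countBetween p (p r) j * R r j else 0

/-- The columns not exchanged are unit vectors, so the matrix is block triangular with an identity
block. -/
theorem det_submatrix_exchange {p : Fin k ↪o Fin n} {R : Matrix (Fin k) (Fin n) ℝ}
    (hp : ∀ r s, R r (p s) = if r = s then 1 else 0) {m : ℕ} {I : Fin m → Fin k}
    {J : Fin m → Fin n} (hI : Function.Injective I) {g : Fin k → Fin n} (hg1 : ∀ a, g (I a) = J a)
    (hg2 : ∀ s, s ∉ Set.range I → g s = p s) : (R.submatrix id g).det = minor R I J := by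
  classical
  rw [Matrix.twoBlockTriangular_det _ (fun s => s ∉ Set.range I)]
  · have h1 : (R.submatrix id g).toSquareBlockProp (fun s => s ∉ Set.range I) = 1 := by
      ext ⟨i, hi⟩ ⟨j, hj⟩
      simp [Matrix.toSquareBlockProp, hg2 j hj, hp, Matrix.one_apply]
    rw [h1, Matrix.det_one, one_mul]
    let e : Fin m ≃ {s // ¬ (s ∉ Set.range I)} :=
      (Equiv.ofInjective I hI).trans (Equiv.subtypeEquivRight fun s => not_not.symm)
    rw [← Matrix.det_submatrix_equiv_self e]
    unfold minor
    congr 1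
    ext a b
    simp only [Matrix.submatrix_apply, Matrix.toSquareBlockProp, Matrix.of_apply]
    change R (I a) (g (I b)) = _
    rw [hg1]
  · intro i hi j hj
    rw [Matrix.submatrix_apply, id, hg2 j hj, hp, if_neg]
    rintro rfl
    exact hi hj

theorem isTotallyNonneg_unsignedPart {p : Fin k ↪o Fin n} {R : Matrix (Fin k) (Fin n) ℝ}
    (hp : ∀ r s, R r (p s) = if r = s then 1 else 0)
    (hR : ∀ J : Fin k ↪o Fin n, 0 ≤ (R.submatrix id J).det) :
    IsTotallyNonneg p (unsignedPart p R) := by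
  classical
  intro m I J hshape
  by_cases hI : Function.Injective I
  swap
  · simp only [Function.Injective, not_forall] at hI
    obtain ⟨a, b, h, hne⟩ := hI
    rw [minor_eq_zero_of_row_eq hne h, mul_zero]
  by_cases hJ : ∀ b, J b ∉ Set.range p
  swap
  · push Not at hJ
    obtain ⟨b, s, hs⟩ := hJ
    rw [minor_eq_zero_of_col b fun a => ?_, mul_zero]
    have hlt := hshape a b
    rw [unsignedPart, if_pos hlt, ← hs, hp, if_neg, mul_zero]
    rintro rfl
    exact hlt.ne hs
  obtain ⟨g, hg1, hg2, hg3⟩ := exists_exchange p m I J hI hshape hJ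
  have h := nonneg_orderSign_mul_det hR g
  rw [hg3, det_submatrix_exchange hp hI hg1 hg2] at h
  -- The pivots between `p i` and `j` are those before `j` except those up to `p i`. Hence the
  -- parity sign is a row factor times a column factor, and both come out of every minor.
  let u : Fin k → ℝ := fun i => (-1) ^ (Finset.univ.filter fun s => p s ≤ p i).card
  let v : Fin n → ℝ := fun j => (-1) ^ (Finset.univ.filter fun s => p s < j).card
  have huv : ∀ i j, p i < j → (-1 : ℝ) ^ countBetween p (p i) j = u i * v j := by
    intro i j hij
    have hsub : (Finset.univ.filter fun s => p s < j) = (Finset.univ.filter fun s => p s ≤ p i) ∪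
        Finset.univ.filter fun s => p i < p s ∧ p s < j := by
      ext s
      simp only [Finset.mem_filter, Finset.mem_univ, true_and, Finset.mem_union]
      constructor
      · intro h
        by_cases h' : p s ≤ p i
        · exact Or.inl h'
        · exact Or.inr ⟨not_le.1 h', h⟩
      · rintro (h | h)
        · exact h.trans_lt hij
        · exact h.2
    have hdisj : Disjoint (Finset.univ.filter fun s => p s ≤ p i)
        (Finset.univ.filter fun s => p i < p s ∧ p s < j) := by
      rw [Finset.disjoint_filter]
      exact fun s _ h h' => h.not_gt h'.1
    simp only [u, v]
    rw [hsub, Finset.card_union_of_disjoint hdisj, pow_add, ← mul_assoc, ← pow_add, ← two_mul,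
      pow_mul, neg_one_sq, one_pow, one_mul, countBetween]
  have hM : minor (unsignedPart p R) I J =
      (∏ a, (-1 : ℝ) ^ countBetween p (p (I a)) (J a)) * minor R I J := by
    have e1 : (Matrix.of fun a b => unsignedPart p R (I a) (J b)) =
        Matrix.of fun a b => u (I a) * (Matrix.of fun a b => v (J b) * R (I a) (J b)) a b := by
      ext a b
      simp only [Matrix.of_apply, unsignedPart]
      rw [if_pos (hshape a b), huv _ _ (hshape a b), mul_assoc]
    rw [minor, e1, Matrix.det_mul_column, show (Matrix.of fun a b => v (J b) * R (I a) (J b)) =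
      Matrix.of fun a b => v (J b) * (Matrix.of fun a b => R (I a) (J b)) a b from rfl,
      Matrix.det_mul_row, ← mul_assoc, ← Finset.prod_mul_distrib]
    congr 1
    exact Finset.prod_congr rfl fun a _ => (huv _ _ (hshape a a)).symm
  rw [hM, ← mul_assoc]
  exact h

end
end KPSoliton

/-! ### Building the Le-network of a totally nonnegative matrix. -/

namespace KPSoliton

/-- The vector `u` has leading entry `1` in the column `j`. -/
def HasLeadingOne {n : ℕ} (j : Fin n) (u : Fin n → ℝ) : Prop := u j = 1 ∧ ∀ l, l < j → u l = 0

namespace LeDiagram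

variable {k n : ℕ} {D : LeDiagram k n} {w : Fin k × Fin n → ℝ} {Z : Fin k × Fin n → Fin n → ℝ}

theorem hasLeadingOne_single (j : Fin n) : HasLeadingOne j (Pi.single j 1 : Fin n → ℝ) :=
  ⟨by simp, fun l hl => by simp [hl.ne]⟩

/-- The path that always goes straight down reaches the boundary in the column of `v` with weight 1;
any path with a horizontal edge ends in a larger column. -/
theorem IsFlow.hasLeadingOne (h : D.IsFlow w Z) : ∀ v ∈ D.boxes, HasLeadingOne v.2 (Z v) := by
  have key : ∀ m : ℕ, ∀ v ∈ D.boxes, k + n - (v.1 + v.2) ≤ m → HasLeadingOne v.2 (Z v) := by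
    intro m
    induction m with
    | zero =>
      intro v hv hm
      have := v.1.2
      have := v.2.2
      omega
    | succ m ih =>
      intro v hv hm
      have hrow := v.1.2
      have hcol := v.2.2
      have h1 : HasLeadingOne v.2 (D.below Z v) := by
        rcases exists_vertical_or_toBoundary (mem_whites_of_mem_boxes hv) with ⟨b, hb⟩ | hb
        · rw [below_of_vertical hb, ← hb.2.2.1]
          refine ih b hb.2.1 ?_
          rw [hb.2.2.1]
          have := Fin.lt_def.1 hb.2.2.2.1
          omega
        · rw [below_of_toBoundary hb]
          exact hasLeadingOne_single _
      have h2 : ∀ l, l ≤ v.2 → D.leftward w Z v l = 0 := by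
        intro l hl
        by_cases hex : ∃ b, D.Horizontal v b
        · obtain ⟨b, hb⟩ := hex
          have := ih b hb.2.1 (by
            rw [hb.2.2.1]
            have := Fin.lt_def.1 hb.2.2.2.1
            omega)
          rw [leftward_of_horizontal hb, Pi.smul_apply, this.2 l (hl.trans_lt hb.2.2.2.1), smul_zero]
        · rw [leftward_of_not hex, Pi.zero_apply]
      rw [h v hv]
      refine ⟨?_, fun l hl => ?_⟩
      · rw [Pi.add_apply, h1.1, h2 _ le_rfl, add_zero]
      · rw [Pi.add_apply, h1.2 l hl, h2 _ hl.le, add_zero]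
  exact fun v hv => key _ v hv le_rfl

/-- The rows of `M` are the flows out of the boundary sources of a Le-network on `D`. -/
def Realizes (D : LeDiagram k n) (M : Fin k → Fin n → ℝ) : Prop :=
  ∃ (w : Fin k × Fin n → ℝ) (Z : Fin k × Fin n → Fin n → ℝ), (∀ b ∈ D.boxes, 0 < w b) ∧
    D.IsFlow w Z ∧ (∀ r, D.leftward w Z (r, D.pivot r) = M r) ∧
    (∀ b ∈ D.boxes, M b.1 b.2 ≠ 0) ∧ ∀ s l, M s l ≠ 0 → ∃ l' ≤ l, (s, l') ∈ D.boxes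

/-- Adding a box at the top of a column to the right of all boxes of the diagram. -/
theorem Realizes.insert {D' : LeDiagram k n} {M M' : Fin k → Fin n → ℝ} (h : D'.Realizes M')
    {r : Fin k} {c : Fin n} (hcol : ∀ j, j < c → ∀ i, M i j = 0) (hMr : 0 < M r c)
    (hrc : D'.pivot r < c) (hc : c ∉ Set.range D'.pivot)
    (habove : ∀ s, s < r → M s c = 0)
    (hle : ∀ s l, r < s → c < l → M s l ≠ 0 → D'.pivot s < c → M s c ≠ 0)
    (hM' : ∀ s, s ≠ r → M' s = M s) (hM'c : M' r c = 0) (hM'r : ∀ j, M' r j ≠ 0 → M r j ≠ 0)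
    (hstep : (∃ r', r < r' ∧ M r' c ≠ 0 ∧ (∀ s, r < s → s < r' → M s c = 0) ∧
        ∀ j, M r j = M r c / M r' c * M r' j + M' r j) ∨
      ((∀ s, r < s → M s c = 0) ∧ ∀ j, M r j = (if j = c then M r c else 0) + M' r j)) :
    ∃ D : LeDiagram k n, D.pivot = D'.pivot ∧ D.Realizes M := by
  classical
  obtain ⟨w', Z', hw', hZ', hrow', hne', hex'⟩ := h
  have hMne : ∀ s l, M' s l ≠ 0 → M s l ≠ 0 := fun s l hsl => by
    by_cases hs : s = r
    · subst hs; exact hM'r l hsl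
    · rwa [← hM' s hs]
  have hbc : ∀ b ∈ D'.boxes, c ≤ b.2 := fun b hb => by
    by_contra! hlt
    exact hMne _ _ (hne' b hb) (hcol _ hlt _)
  have hrcD : (r, c) ∉ D'.boxes := fun hb => hne' _ hb hM'c
  -- A nonzero entry in column `c` forces a box weakly to the right of it, and no box lies to the
  -- right of column `c`, the first column with nonzero entries.
  have hbox : ∀ s, s ≠ r → M s c ≠ 0 → (s, c) ∈ D'.boxes := fun s hs h => by
    rw [← hM' s hs] at h
    obtain ⟨l, hl, hb⟩ := hex' s c h
    rwa [le_antisymm hl (hbc _ hb)] at hb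
  have hbox0 : ∀ s, (s, c) ∈ D'.boxes → M s c ≠ 0 := fun s hs => hMne _ _ (hne' _ hs)
  have hbne : ∀ b ∈ D'.boxes, b ≠ (r, c) := fun b hb e => hrcD (e ▸ hb)
  let D : LeDiagram k n :=
    { pivot := D'.pivot
      boxes := Insert.insert (r, c) D'.boxes
      isBox := fun b hb => by
        rcases Finset.mem_insert.1 hb with rfl | hb
        · exact ⟨hc, hrc⟩
        · exact D'.isBox b hb
      le_rule := fun x s j l hxs hjl hxj hsl hsj => by
        rcases Finset.mem_insert.1 hxj with hxj' | hxj' <;>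
          rcases Finset.mem_insert.1 hsl with hsl' | hsl'
        · simp only [Prod.mk.injEq] at hxj' hsl'
          exact absurd hxs (by rw [hxj'.1, hsl'.1]; exact lt_irrefl _)
        · simp only [Prod.mk.injEq] at hxj'
          obtain ⟨rfl, rfl⟩ := hxj'
          exact Finset.mem_insert_of_mem (hbox s hxs.ne'
            (hle s l hxs hjl (hMne _ _ (hne' _ hsl')) hsj))
        · simp only [Prod.mk.injEq] at hsl'
          obtain ⟨rfl, rfl⟩ := hsl'
          exact absurd hjl (hbc _ hxj').not_gt
        · exact Finset.mem_insert_of_mem (D'.le_rule x s j l hxs hjl hxj' hsl' hsj) }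
  have hDbox : ∀ b, b ∈ D.boxes ↔ b = (r, c) ∨ b ∈ D'.boxes := fun b => Finset.mem_insert
  have hDw : ∀ v, v ∈ D'.whites → v ∈ D.whites := fun v hv => by
    rcases mem_whites.1 hv with h | h
    · exact mem_whites.2 (Or.inl ((hDbox v).2 (Or.inr h)))
    · exact mem_whites.2 (Or.inr h)
  have hrcb : (r, c) ∈ D.boxes := (hDbox _).2 (Or.inl rfl)
  -- horizontal edges
  have hH0 : D.Horizontal (r, D'.pivot r) (r, c) :=
    ⟨pivot_mem_whites (D := D) r, hrcb, rfl, hrc, fun b hb hb1 _ => by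
      rcases (hDbox b).1 hb with rfl | hb
      · exact le_rfl
      · exact hbc b hb⟩
  have hH1 : ∀ b, D'.Horizontal (r, D'.pivot r) b → D.Horizontal (r, c) b := fun b hb => by
    obtain ⟨-, h2, h3, h4, h5⟩ := hb
    refine ⟨mem_whites_of_mem_boxes hrcb, (hDbox b).2 (Or.inr h2), h3,
      lt_of_le_of_ne (hbc b h2) fun e => hrcD ?_, fun b' hb' e hlt => ?_⟩
    · rwa [show (r, c) = b from Prod.ext h3.symm e]
    · rcases (hDbox b').1 hb' with rfl | hb'
      · exact absurd hlt (lt_irrefl _)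
      · exact h5 b' hb' e (hrc.trans hlt)
  have hH1' : ∀ b, D.Horizontal (r, c) b → D'.Horizontal (r, D'.pivot r) b := fun b hb => by
    obtain ⟨-, h2, h3, h4, h5⟩ := hb
    refine ⟨pivot_mem_whites r, ((hDbox b).1 h2).resolve_left fun e => ?_, h3, hrc.trans h4,
      fun b' hb' e hlt => h5 b' ((hDbox b').2 (Or.inr hb')) e ?_⟩
    · rw [e] at h4; exact lt_irrefl _ h4
    · refine lt_of_le_of_ne (hbc b' hb') fun e' => hrcD ?_
      rwa [show (r, c) = b' from Prod.ext e.symm e']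
  have hH2 : ∀ v b, v ∈ D'.whites → v ≠ (r, D'.pivot r) →
      (D.Horizontal v b ↔ D'.Horizontal v b) := by
    intro v b hv hvr
    have hnot : v.1 = r → c < v.2 := fun e => by
      have hvb : v ∈ D'.boxes := by
        by_contra hvb
        have := eq_pivot_of_not_mem_boxes hv hvb
        rw [e] at this
        exact hvr this
      refine lt_of_le_of_ne (hbc v hvb) fun e' => hrcD ?_
      rwa [show (r, c) = v from Prod.ext e.symm e']
    constructor
    · rintro ⟨-, h2, h3, h4, h5⟩
      refine ⟨hv, ((hDbox b).1 h2).resolve_left fun e => ?_, h3, h4,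
        fun b' hb' e hlt => h5 b' ((hDbox b').2 (Or.inr hb')) e hlt⟩
      subst e
      exact (hnot h3.symm).not_gt h4
    · rintro ⟨-, h2, h3, h4, h5⟩
      refine ⟨hDw v hv, (hDbox b).2 (Or.inr h2), h3, h4, fun b' hb' e hlt => ?_⟩
      rcases (hDbox b').1 hb' with rfl | hb'
      · exact absurd hlt (hnot e.symm).not_gt
      · exact h5 b' hb' e hlt
  -- vertical edges
  have hV : ∀ v b, v ∈ D'.boxes → (D.Vertical v b ↔ D'.Vertical v b) := by
    intro v b hv
    have hnot : v.2 = c → r < v.1 := fun e => by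
      by_contra! hlt
      have hv' : (v.1, c) ∈ D'.boxes := by rw [← e]; exact hv
      rcases hlt.lt_or_eq with hlt | hlt
      · exact hbox0 _ hv' (habove _ hlt)
      · rw [hlt] at hv'
        exact hrcD hv'
    constructor
    · rintro ⟨-, h2, h3, h4, h5⟩
      refine ⟨mem_whites_of_mem_boxes hv, ((hDbox b).1 h2).resolve_left fun e => ?_, h3, h4,
        fun b' hb' e hlt => h5 b' ((hDbox b').2 (Or.inr hb')) e hlt⟩
      subst e
      exact (hnot h3.symm).not_gt h4
    · rintro ⟨-, h2, h3, h4, h5⟩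
      refine ⟨hDw v (mem_whites_of_mem_boxes hv), (hDbox b).2 (Or.inr h2), h3, h4,
        fun b' hb' e hlt => ?_⟩
      rcases (hDbox b').1 hb' with rfl | hb'
      · exact absurd hlt (hnot e.symm).not_gt
      · exact h5 b' hb' e hlt
  -- the weights and the flow
  let w : Fin k × Fin n → ℝ := fun b => if b = (r, c) then M r c else
    if D'.Horizontal (r, D'.pivot r) b then w' b / M r c else w' b
  -- The new box receives the first horizontal edge of row `r`, of weight `M r c`, so its flow has
  -- to be row `r` divided by this number. The edge that used to leave the pivot vertex now starts
  -- at the new box, which explains the division of its weight.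
  let Z : Fin k × Fin n → Fin n → ℝ := fun b => if b = (r, c) then (M r c)⁻¹ • M r else Z' b
  have hwrc : w (r, c) = M r c := if_pos rfl
  have hZrc : Z (r, c) = (M r c)⁻¹ • M r := if_pos rfl
  have hZne : ∀ b ∈ D'.boxes, Z b = Z' b := fun b hb => if_neg (hbne b hb)
  have hw1 : ∀ b, D'.Horizontal (r, D'.pivot r) b → w b = w' b / M r c := fun b hb => by
    simp only [w]
    rw [if_neg (hbne b hb.2.1), if_pos hb]
  have hw2 : ∀ v b, D'.Horizontal v b → v ≠ (r, D'.pivot r) → w b = w' b := fun v b hb hv => by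
    simp only [w]
    rw [if_neg (hbne b hb.2.1), if_neg fun h => hv (hb.left_unique h)]
  have hleft : ∀ v ∈ D'.whites, v ≠ (r, D'.pivot r) → D.leftward w Z v = D'.leftward w' Z' v := by
    intro v hv hvr
    by_cases hex : ∃ b, D'.Horizontal v b
    · obtain ⟨b, hb⟩ := hex
      rw [leftward_of_horizontal hb, leftward_of_horizontal ((hH2 v b hv hvr).2 hb),
        hZne b hb.2.1, hw2 v b hb hvr]
    · rw [leftward_of_not hex, leftward_of_not]
      rintro ⟨b, hb⟩
      exact hex ⟨b, (hH2 v b hv hvr).1 hb⟩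
  have hleftrc : D.leftward w Z (r, c) = (M r c)⁻¹ • M' r := by
    rw [← hrow' r]
    by_cases hex : ∃ b, D'.Horizontal (r, D'.pivot r) b
    · obtain ⟨b, hb⟩ := hex
      rw [leftward_of_horizontal (hH1 b hb), leftward_of_horizontal hb, hZne b hb.2.1, hw1 b hb,
        smul_smul, div_eq_inv_mul]
    · rw [leftward_of_not hex, leftward_of_not, smul_zero]
      rintro ⟨b, hb⟩
      exact hex ⟨b, hH1' b hb⟩
  refine ⟨D, rfl, w, Z, fun b hb => ?_, fun v hv => ?_, fun s => ?_, fun b hb => ?_,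
    fun s l hsl => ?_⟩
  · rcases (hDbox b).1 hb with rfl | hb
    · rw [hwrc]; exact hMr
    · simp only [w]
      rw [if_neg (hbne b hb)]
      split_ifs
      · exact div_pos (hw' b hb) hMr
      · exact hw' b hb
  · rcases (hDbox v).1 hv with rfl | hv
    · rw [hZrc, hleftrc]
      -- Divided by `M r c`, the elimination identity is the flow equation at the new box. Its
      -- vertical neighbour is `(r', c)`, the first box in its row, whose flow is row `r'` divided
      -- by `M r' c`. In the second case the column has no lower box and the vertical edge ends at
      -- the boundary.
      rcases hstep with ⟨r', hrr', hr'c, hbetween, heq⟩ | ⟨hbelow, heq⟩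
      · have hb' : (r', c) ∈ D'.boxes := hbox r' hrr'.ne' hr'c
        have hvert : D.Vertical (r, c) (r', c) :=
          ⟨mem_whites_of_mem_boxes hrcb, (hDbox _).2 (Or.inr hb'), rfl, hrr', fun b hb e hlt => by
            rcases (hDbox b).1 hb with rfl | hb
            · exact absurd hlt (lt_irrefl _)
            · by_contra! hlt'
              refine hbox0 b.1 ?_ (hbetween b.1 hlt hlt')
              rwa [show (b.1, c) = b from Prod.ext rfl e.symm]⟩
        have hhor : D'.Horizontal (r', D'.pivot r') (r', c) :=
          ⟨pivot_mem_whites r', hb', rfl, pivot_lt_col hb', fun b hb _ _ => hbc b hb⟩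
        have hrow := hrow' r'
        rw [leftward_of_horizontal hhor, hM' r' hrr'.ne'] at hrow
        have hlead := (hZ'.hasLeadingOne _ hb').1
        have hwv : w' (r', c) = M r' c := by
          rw [← hrow, Pi.smul_apply, hlead, smul_eq_mul, mul_one]
        rw [below_of_vertical hvert, hZne _ hb']
        ext j
        have hj := congrFun hrow j
        simp only [Pi.smul_apply, smul_eq_mul, Pi.add_apply] at hj ⊢
        rw [heq j, ← hj, hwv]
        field_simp
      · have htb : D.ToBoundary (r, c) := ⟨mem_whites_of_mem_boxes hrcb, fun b hb e hlt => by
          rcases (hDbox b).1 hb with rfl | hb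
          · exact absurd hlt (lt_irrefl _)
          · refine hbox0 b.1 ?_ (hbelow b.1 hlt)
            rwa [show (b.1, c) = b from Prod.ext rfl e.symm]⟩
        rw [below_of_toBoundary htb]
        ext j
        simp only [Pi.smul_apply, smul_eq_mul, Pi.add_apply, Pi.single_apply]
        rw [heq j]
        split_ifs
        · field_simp
        · simp
    · rw [hZne v hv, hZ' v hv, hleft v (mem_whites_of_mem_boxes hv) fun e => by
        rw [e] at hv; exact col_ne_pivot hv r rfl]
      congr 1
      rcases exists_vertical_or_toBoundary (D := D') (mem_whites_of_mem_boxes hv) with ⟨b, hb⟩ | hb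
      · rw [below_of_vertical hb, below_of_vertical ((hV v b hv).2 hb), hZne b hb.2.1]
      · have : D.ToBoundary v := by
          refine (exists_vertical_or_toBoundary (hDw v (mem_whites_of_mem_boxes hv))).resolve_left ?_
          rintro ⟨b, hb'⟩
          exact ((hV v b hv).1 hb').not_toBoundary hb
        rw [below_of_toBoundary hb, below_of_toBoundary this]
  · by_cases hs : s = r
    · subst hs
      change D.leftward w Z (s, D'.pivot s) = M s
      rw [leftward_of_horizontal hH0, hZrc, hwrc, smul_smul, mul_inv_cancel₀ hMr.ne', one_smul]
    · change D.leftward w Z (s, D'.pivot s) = M s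
      rw [hleft _ (pivot_mem_whites s) fun e => hs (congrArg Prod.fst e), hrow', hM' s hs]
  · rcases (hDbox b).1 hb with rfl | hb
    · exact hMr.ne'
    · exact hMne _ _ (hne' b hb)
  · by_cases hs : s = r
    · subst hs
      refine ⟨c, ?_, hrcb⟩
      by_contra! hlt
      exact hsl (hcol l hlt s)
    · rw [← hM' s hs] at hsl
      obtain ⟨l', hl', hb⟩ := hex' s l hsl
      exact ⟨l', hl', (hDbox _).2 (Or.inr hb)⟩

/-- Induction on the number of nonzero entries. The topmost nonzero entry of the first nonzero
column is eliminated against the next nonzero entry below it, or erased if it is alone in its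
column; `Realizes.insert` restores the corresponding box. -/
theorem exists_realizes (p : Fin k ↪o Fin n) : ∀ (N : ℕ) (M : Fin k → Fin n → ℝ),
    (∀ r j, M r j ≠ 0 → p r < j ∧ j ∉ Set.range p) → IsTotallyNonneg p M →
    (Finset.univ.filter fun b : Fin k × Fin n => M b.1 b.2 ≠ 0).card ≤ N →
    ∃ D : LeDiagram k n, D.pivot = p ∧ D.Realizes M := by
  classical
  intro N
  induction N with
  | zero =>
    intro M _ _ hcard
    have h0 : ∀ r j, M r j = 0 := fun r j => by
      have := Finset.card_eq_zero.1 (Nat.le_zero.1 hcard)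
      rw [Finset.filter_eq_empty_iff] at this
      exact not_not.1 (this (Finset.mem_univ (r, j)))
    refine ⟨⟨p, ∅, by simp, by simp⟩, rfl, 1, 0, by simp, fun v hv => by simp at hv, fun r => ?_,
      by simp, fun s l h => absurd (h0 s l) h⟩
    rw [leftward_of_not]
    · exact (funext (h0 r)).symm
    · rintro ⟨b, hb⟩
      simpa using hb.2.1
  | succ N ih =>
    intro M hsupp htn hcard
    by_cases hM : ∃ j r, M r j ≠ 0
    swap
    · push Not at hM
      refine ih M hsupp htn ?_
      rw [Finset.filter_false_of_mem fun b _ => by simpa using hM b.2 b.1]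
      simp
    obtain ⟨c, hcmem, hcmin⟩ := (Finset.univ.filter fun j => ∃ r, M r j ≠ 0).exists_min_image id
      (by obtain ⟨j, hj⟩ := hM; exact ⟨j, by simpa using hj⟩)
    simp only [Finset.mem_filter, Finset.mem_univ, true_and, id] at hcmem hcmin
    have hcol : ∀ j, j < c → ∀ i, M i j = 0 := fun j hj i => by
      by_contra hne
      exact (hcmin j ⟨i, hne⟩).not_gt hj
    obtain ⟨r, hrmem, hrmin⟩ := (Finset.univ.filter fun r => M r c ≠ 0).exists_min_image id
      (by obtain ⟨r, hr⟩ := hcmem; exact ⟨r, by simpa using hr⟩)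
    simp only [Finset.mem_filter, Finset.mem_univ, true_and, id] at hrmem hrmin
    have habove : ∀ s, s < r → M s c = 0 := fun s hs => by
      by_contra hne
      exact (hrmin s hne).not_gt hs
    have hpos : ∀ i j, M i j ≠ 0 → 0 < M i j := fun i j h =>
      lt_of_le_of_ne (htn.entry (hsupp i j h).1) h.symm
    have hnn : ∀ i j, 0 ≤ M i j := fun i j => by
      by_cases h : M i j = 0
      · exact h.ge
      · exact (hpos i j h).le
    have hMr := hpos r c hrmem
    obtain ⟨hrc, hc⟩ := hsupp r c hrmem
    have htwo : ∀ s l, r < s → c < l → M s l ≠ 0 → p s < c → M s c ≠ 0 := by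
      intro s l hrs hcl hsl hsc h0
      have := htn.two p.strictMono hrs hcl hsc
      rw [h0, zero_mul] at this
      exact (mul_pos (hpos s l hsl) hMr).not_ge this
    suffices h : ∃ M' : Fin k → Fin n → ℝ, IsTotallyNonneg p M' ∧ (∀ s, s ≠ r → M' s = M s) ∧
        M' r c = 0 ∧ (∀ j, M' r j ≠ 0 → M r j ≠ 0) ∧
        ((∃ r', r < r' ∧ M r' c ≠ 0 ∧ (∀ s, r < s → s < r' → M s c = 0) ∧
          ∀ j, M r j = M r c / M r' c * M r' j + M' r j) ∨
        ((∀ s, r < s → M s c = 0) ∧ ∀ j, M r j = (if j = c then M r c else 0) + M' r j)) by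
      obtain ⟨M', htn', hM', hM'c, hM'r, hstep⟩ := h
      have hMne : ∀ s l, M' s l ≠ 0 → M s l ≠ 0 := fun s l hsl => by
        by_cases hs : s = r
        · subst hs; exact hM'r l hsl
        · rwa [← hM' s hs]
      obtain ⟨D', hD', hreal⟩ := ih M' (fun i j h => hsupp i j (hMne i j h)) htn' (by
        have : (Finset.univ.filter fun b : Fin k × Fin n => M' b.1 b.2 ≠ 0).card <
            (Finset.univ.filter fun b : Fin k × Fin n => M b.1 b.2 ≠ 0).card := by
          refine Finset.card_lt_card ⟨fun b hb => ?_, fun hsub => ?_⟩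
          · simp only [Finset.mem_filter, Finset.mem_univ, true_and] at hb ⊢
            exact hMne _ _ hb
          · have := hsub (Finset.mem_filter.2 ⟨Finset.mem_univ (r, c), hrmem⟩)
            simp [hM'c] at this
        omega)
      obtain ⟨D, hD, hDr⟩ := hreal.insert hcol hMr (by rwa [hD']) (by rwa [hD']) habove
        (by rwa [hD']) hM' hM'c hM'r hstep
      exact ⟨D, hD.trans hD', hDr⟩
    by_cases hr' : ∃ r', r < r' ∧ M r' c ≠ 0
    · obtain ⟨r', hr'mem, hr'min⟩ := (Finset.univ.filter fun s => r < s ∧ M s c ≠ 0).exists_min_image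
        id (by obtain ⟨s, hs⟩ := hr'; exact ⟨s, by simpa using hs⟩)
      simp only [Finset.mem_filter, Finset.mem_univ, true_and, id] at hr'mem hr'min
      obtain ⟨hrr, hr'c⟩ := hr'mem
      have hbetween : ∀ s, r < s → s < r' → M s c = 0 := fun s h1 h2 => by
        by_contra hne
        exact (hr'min s ⟨h1, hne⟩).not_gt h2
      have hpc := (hsupp r' c hr'c).1
      have hMr' := hpos r' c hr'c
      -- A nonzero entry of such a row would lie to the left of `c`, and the 2 by 2 minor with `(r,
      -- c)` would force the entry in column `c` to be nonzero as well.
      have hzero : ∀ s, r < s → s < r' → ∀ j, M s j = 0 := by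
        intro s h1 h2 j
        by_contra hne
        rcases lt_trichotomy j c with h | h | h
        · exact hne (hcol j h s)
        · subst h; exact hne (hbetween s h1 h2)
        · exact htwo s j h1 h hne ((p.strictMono h2).trans hpc) (hbetween s h1 h2)
      have htn' := htn.eliminate p.strictMono hrr hzero hcol habove hpc hMr'
      refine ⟨_, htn', fun s hs => by simp [hs], ?_, fun j hj => ?_,
        Or.inl ⟨r', hrr, hr'c, hbetween, fun j => by simp⟩⟩
      · simp [hr'c]
      -- The support does not grow: where row `r` is zero, the new entry is minus a nonnegative
      -- number, but total nonnegativity makes it nonnegative.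
      · intro h0
        rcases lt_or_ge c j with h | h
        · have := htn'.entry (hrc.trans h)
          simp only [Function.update_self, h0, zero_sub] at this hj
          have h3 := mul_nonneg (div_nonneg hMr.le hMr'.le) (hnn r' j)
          exact hj (by linarith)
        · rcases h.lt_or_eq with h | h
          · simp [hcol j h] at hj
          · subst h
            exact hrmem h0
    · push Not at hr'
      refine ⟨_, htn.clear (r := r) (c := c) fun s hs => ?_, fun s hs => by simp [hs], by simp,
        fun j hj => ?_, Or.inr ⟨hr', fun j => ?_⟩⟩
      · rcases lt_or_gt_of_ne hs with h | h
        · exact habove s h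
        · exact hr' s h
      · by_cases h : j = c
        · subst h; simp at hj
        · simpa [h] using hj
      · by_cases h : j = c
        · subst h; simp
        · simp [h]

/-- The factor from `SamePoint` has positive determinant, so the maximal minors of `R` are
nonnegative too. The signs removed in `unsignedPart` are the ones that `networkMatrix` puts back. -/
theorem exists_represents {A R : Matrix (Fin k) (Fin n) ℝ} (hA : IsTNN A) (hR : IsRREF R)
    (hAR : SamePoint A R) : ∃ D : LeDiagram k n, D.Represents R := by
  obtain ⟨g, hg, rfl⟩ := hAR
  obtain ⟨p, hp, hp0⟩ := hR
  have hnn : ∀ J : Fin k ↪o Fin n, 0 ≤ ((g * A).submatrix id J).det := fun J => by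
    rw [Matrix.submatrix_mul _ _ id id J Function.bijective_id, Matrix.submatrix_id_id,
      Matrix.det_mul]
    exact mul_nonneg hg.le (hA.2 J)
  have htn := isTotallyNonneg_unsignedPart hp hnn
  obtain ⟨D, rfl, w, Z, hw, hZ, hrow, -, -⟩ := exists_realizes p _ _ (fun r j h => by
    rw [unsignedPart] at h
    split_ifs at h with hlt
    · refine ⟨hlt, ?_⟩
      rintro ⟨s, rfl⟩
      rw [hp, if_neg, mul_zero] at h
      · exact h rfl
      · rintro rfl
        exact lt_irrefl _ hlt
    · exact absurd rfl h) htn le_rfl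
  refine ⟨D, w, hw, ?_⟩
  ext r j
  rw [networkMatrix_of_isFlow hZ, hrow]
  split_ifs with h1 h2
  · exact (hp0 r j h1).symm
  · rw [h2, hp, if_pos rfl]
  · have hlt : D.pivot r < j := lt_of_le_of_ne (not_lt.1 h1) (Ne.symm h2)
    rw [unsignedPart, if_pos hlt, pivotsBetween, countBetween, ← mul_assoc, ← pow_add, ← two_mul,
      pow_mul, neg_one_sq, one_pow, one_mul]

end LeDiagram
end KPSoliton

/-! ### Linear combinations of exponentials in the KP times. -/

namespace KPSoliton

theorem theta_add (ζ : ℂ) (s t : Times) : theta ζ (s + t) = theta ζ s + theta ζ t := by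
  rw [theta, Finsupp.sum_add_index' (by simp) (by intros; ring)]
  rfl

theorem theta_smul (ζ : ℂ) (x : ℂ) (t : Times) : theta ζ (x • t) = x * theta ζ t := by
  rw [theta, Finsupp.sum_smul_index' (by simp), theta, Finsupp.mul_sum]
  refine Finsupp.sum_congr fun l _ => ?_
  rw [smul_eq_mul]
  ring

theorem theta_zero (ζ : ℂ) : theta ζ 0 = 0 := by simp [theta]

theorem theta_sub (ζ : ℂ) (s t : Times) : theta ζ (s - t) = theta ζ s - theta ζ t := by
  rw [sub_eq_add_neg, theta_add, ← neg_one_smul ℂ t, theta_smul]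
  ring

theorem theta_single (ζ : ℂ) (l : ℕ+) (a : ℂ) : theta ζ (Finsupp.single l a) = ζ ^ (l : ℕ) * a := by
  simp [theta]

theorem theta_sum (ζ : ℂ) {m : ℕ} (f : Fin m → Times) :
    theta ζ (∑ i, f i) = ∑ i, theta ζ (f i) := by
  induction m with
  | zero => simp [theta_zero]
  | succ m ih => rw [Fin.sum_univ_succ, Fin.sum_univ_succ, theta_add, ih]

/-- The real version of `theta`. -/
noncomputable def realTheta (x : ℝ) (t : RealTimes) : ℝ := t.sum fun l a => x ^ (l : ℕ) * a

theorem realTheta_add (x : ℝ) (s t : RealTimes) :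
    realTheta x (s + t) = realTheta x s + realTheta x t := by
  rw [realTheta, Finsupp.sum_add_index' (by simp) (by intros; ring)]
  rfl

theorem realTheta_single (x : ℝ) (l : ℕ+) (a : ℝ) :
    realTheta x (Finsupp.single l a) = x ^ (l : ℕ) * a := by
  simp [realTheta]

theorem theta_toComplex (x : ℝ) (t : RealTimes) : theta (x : ℂ) t.toComplex = realTheta x t := by
  rw [theta, RealTimes.toComplex, Finsupp.sum_mapRange_index (by simp), realTheta, Finsupp.sum,
    Finsupp.sum]
  push_cast
  rfl

section
variable {n : ℕ}

/-- The linear combination of the normalized exponentials `exp θ(κ_j, t - t₀)`. -/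
noncomputable def expCombination (κ : Fin n → ℝ) (t₀ : RealTimes) (c : Fin n → ℂ) (t : Times) : ℂ :=
  ∑ j, c j * Complex.exp (theta (κ j : ℂ) (t - t₀.toComplex))

variable {κ : Fin n → ℝ} {t₀ : RealTimes}

theorem expCombination_add (c d : Fin n → ℂ) (t : Times) :
    expCombination κ t₀ (c + d) t = expCombination κ t₀ c t + expCombination κ t₀ d t := by
  simp only [expCombination, Pi.add_apply, add_mul, Finset.sum_add_distrib]

theorem expCombination_smul (x : ℂ) (c : Fin n → ℂ) (t : Times) :
    expCombination κ t₀ (x • c) t = x * expCombination κ t₀ c t := by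
  simp only [expCombination, Pi.smul_apply, smul_eq_mul, mul_assoc, Finset.mul_sum]

theorem expCombination_sub (c d : Fin n → ℂ) (t : Times) :
    expCombination κ t₀ (c - d) t = expCombination κ t₀ c t - expCombination κ t₀ d t := by
  simp only [expCombination, Pi.sub_apply, sub_mul, Finset.sum_sub_distrib]

theorem expCombination_single (j : Fin n) (t : Times) :
    expCombination κ t₀ (Pi.single j 1) t = Complex.exp (theta (κ j : ℂ) (t - t₀.toComplex)) := by
  classical
  rw [expCombination, Finset.sum_eq_single j (fun i _ hi => by simp [hi]) (by simp)]
  simp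

theorem expCombination_initial (c : Fin n → ℂ) :
    expCombination κ t₀ c t₀.toComplex = ∑ j, c j := by
  simp [expCombination, theta_zero]

theorem isEntire_expCombination (c : Fin n → ℂ) : IsEntire (expCombination κ t₀ c) := by
  intro t m v
  have : (fun x : Fin m → ℂ => expCombination κ t₀ c (t + ∑ i, x i • v i)) = fun x =>
      ∑ j, c j * Complex.exp (theta (κ j : ℂ) (t - t₀.toComplex) +
        ∑ i, x i * theta (κ j : ℂ) (v i)) := by
    ext x
    refine Finset.sum_congr rfl fun j _ => ?_
    rw [theta_sub, theta_add, theta_sum, theta_sub]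
    simp only [theta_smul]
    ring_nf
  rw [this]
  fun_prop

theorem isEntire_exp_theta (ζ : ℂ) :
    IsEntire fun t => Complex.exp (theta ζ (t - t₀.toComplex)) := by
  intro t m v
  have : (fun x : Fin m → ℂ => Complex.exp (theta ζ (t + ∑ i, x i • v i - t₀.toComplex))) = fun x =>
      Complex.exp (theta ζ (t - t₀.toComplex) + ∑ i, x i * theta ζ (v i)) := by
    ext x
    rw [theta_sub, theta_add, theta_sum, theta_sub]
    simp only [theta_smul]
    congr 1
    ring
  rw [this]
  fun_prop

theorem iteratedDeriv_sum_mul_exp (c a : Fin n → ℂ) (m : ℕ) :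
    iteratedDeriv m (fun s : ℂ => ∑ j, c j * Complex.exp (a j * s)) =
      fun s => ∑ j, c j * a j ^ m * Complex.exp (a j * s) := by
  induction m with
  | zero => simp
  | succ m ih =>
    rw [iteratedDeriv_succ, ih]
    ext s
    refine HasDerivAt.deriv (HasDerivAt.fun_sum fun j _ => ?_)
    have h1 : HasDerivAt (fun s => a j * s) (a j) s := by
      simpa using (hasDerivAt_id s).const_mul (a j)
    have h2 := (h1.cexp).const_mul (c j * a j ^ m)
    exact h2.congr_deriv (by ring)

theorem solvesHeatHierarchy_expCombination (c : Fin n → ℂ) :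
    SolvesHeatHierarchy (expCombination κ t₀ c) := by
  intro t l
  have h : ∀ l : ℕ+, (fun s : ℂ => expCombination κ t₀ c (t + Finsupp.single l s)) = fun s =>
      ∑ j, (c j * Complex.exp (theta (κ j : ℂ) (t - t₀.toComplex))) *
        Complex.exp ((κ j : ℂ) ^ (l : ℕ) * s) := by
    intro l
    ext s
    refine Finset.sum_congr rfl fun j _ => ?_
    rw [mul_assoc, ← Complex.exp_add, theta_sub, theta_add, theta_single, theta_sub]
    ring_nf
  rw [h, h, ← iteratedDeriv_one, iteratedDeriv_sum_mul_exp, iteratedDeriv_sum_mul_exp]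
  simp

theorem expCombination_toComplex (c : Fin n → ℝ) (t : RealTimes) :
    ∃ x : ℝ, expCombination κ t₀ (fun j => (c j : ℂ)) t.toComplex = x := by
  refine ⟨∑ j, c j * Real.exp (realTheta (κ j) t - realTheta (κ j) t₀), ?_⟩
  rw [expCombination]
  push_cast
  refine Finset.sum_congr rfl fun j _ => ?_
  rw [theta_sub, theta_toComplex, theta_toComplex]

/-- The exponentials are characters of the additive group of real times, already distinguished by
t₁, and distinct characters are linearly independent. -/
theorem eq_zero_of_expCombination_eq_zero (hκ : Function.Injective κ) {c : Fin n → ℂ}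
    (h : ∀ t : RealTimes, expCombination κ t₀ c t.toComplex = 0) : c = 0 := by
  let χ : Fin n → (Multiplicative RealTimes →* ℂ) := fun j =>
    { toFun := fun t => Complex.exp (realTheta (κ j) t.toAdd)
      map_one' := by simp [realTheta]
      map_mul' := fun s t => by
        rw [← Complex.exp_add, toAdd_mul, realTheta_add]
        push_cast
        rfl }
  have hχ : Function.Injective χ := by
    intro i j hij
    have h1 := DFunLike.congr_fun hij (Multiplicative.ofAdd (Finsupp.single 1 1))
    simp only [χ, MonoidHom.coe_mk, OneHom.coe_mk, toAdd_ofAdd, realTheta_single] at h1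
    have h2 : Real.exp (κ i) = Real.exp (κ j) := by
      have h3 : ((Real.exp (κ i) : ℝ) : ℂ) = (Real.exp (κ j) : ℝ) := by
        push_cast
        simpa using h1
      exact_mod_cast h3
    exact hκ (Real.exp_injective h2)
  have hli := (linearIndependent_monoidHom (Multiplicative RealTimes) ℂ).comp χ hχ
  rw [Fintype.linearIndependent_iff] at hli
  ext j
  have := hli (fun j => c j * Complex.exp (-(realTheta (κ j) t₀ : ℝ))) (by
    ext t
    have ht := h t.toAdd
    rw [expCombination] at ht
    simp only [Finset.sum_apply, Pi.smul_apply, Function.comp_apply, smul_eq_mul, Pi.zero_apply]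
    rw [← ht]
    refine Finset.sum_congr rfl fun j _ => ?_
    rw [theta_sub, theta_toComplex, theta_toComplex, mul_assoc]
    congr 1
    rw [sub_eq_neg_add, Complex.exp_add]
    rfl) j
  simpa using this

theorem expCombination_injective (hκ : Function.Injective κ) {c d : Fin n → ℂ}
    (h : ∀ t : RealTimes, expCombination κ t₀ c t.toComplex = expCombination κ t₀ d t.toComplex) :
    c = d :=
  sub_eq_zero.1 (eq_zero_of_expCombination_eq_zero hκ fun t => by
    rw [expCombination_sub, h, sub_self])

end
end KPSoliton

/-! ### The initial time and the normalized network. -/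

namespace KPSoliton

/-- After division by the exponential of `κ j * x`, all terms beyond the leading one tend to 0 at
-∞, since κ increases, and the leading one is the constant 1. -/
theorem eventually_pos_of_hasLeadingOne {n : ℕ} {κ : Fin n → ℝ} (hκ : StrictMono κ) {j : Fin n}
    {u : Fin n → ℝ} (hu : HasLeadingOne j u) :
    ∀ᶠ x : ℝ in atBot, 0 < ∑ l, u l * Real.exp (κ l * x) := by
  have h : Tendsto (fun x : ℝ => ∑ l, u l * Real.exp ((κ l - κ j) * x)) atBot
      (𝓝 (∑ l, if l = j then 1 else 0)) := by
    refine tendsto_finsetSum _ fun l _ => ?_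
    rcases lt_trichotomy l j with hl | rfl | hl
    · simp [hu.2 l hl, hl.ne]
    · simp [hu.1]
    · rw [if_neg hl.ne']
      have h1 : Tendsto (fun x : ℝ => (κ l - κ j) * x) atBot atBot :=
        tendsto_id.const_mul_atBot (sub_pos.2 (hκ hl))
      simpa using (Real.tendsto_exp_atBot.comp h1).const_mul (u l)
  simp only [Finset.sum_ite_eq', Finset.mem_univ, if_true] at h
  filter_upwards [h.eventually (lt_mem_nhds zero_lt_one)] with x hx
  have : ∑ l, u l * Real.exp (κ l * x) =
      Real.exp (κ j * x) * ∑ l, u l * Real.exp ((κ l - κ j) * x) := by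
    rw [Finset.mul_sum]
    refine Finset.sum_congr rfl fun l _ => ?_
    rw [mul_left_comm, ← Real.exp_add]
    ring_nf
  rw [this]
  positivity

namespace LeDiagram

variable {k n : ℕ} {D : LeDiagram k n}

/-- `a v` are the coefficients of the normalized vacuum edge wave function above the white vertex
`v` (in terms of normalized exponentials), and `γ v` are the coordinates of the divisor points. -/
structure IsVacuumNetwork (D : LeDiagram k n) (a : Fin k × Fin n → Fin n → ℝ)
    (γ : Fin k × Fin n → ℝ) : Prop where
  sum_one : ∀ v ∈ D.whites, ∑ j, a v j = 1
  before : ∀ v ∈ D.whites, ∀ l, l < v.2 → a v l = 0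
  lead : ∀ v ∈ D.whites, a v v.2 ≠ 0
  step : ∀ v b, D.Horizontal v b → a v = (1 - γ v) • D.below a v + γ v • a b
  last : ∀ v ∈ D.whites, (¬ ∃ b, D.Horizontal v b) → a v = D.below a v
  gamma_pos : ∀ v b, D.Horizontal v b → Even (D.pivotsBetween v.2 b.2) → 0 < γ v ∧ γ v < 1
  gamma_neg : ∀ v b, D.Horizontal v b → Odd (D.pivotsBetween v.2 b.2) → γ v < 0

theorem pivotsBetween_self (j : Fin n) : D.pivotsBetween j j = 0 := by
  rw [pivotsBetween, Finset.card_eq_zero, Finset.filter_eq_empty_iff]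
  exact fun s _ h => h.1.not_gt h.2

theorem pivotsBetween_add {i j l : Fin n} (hij : i < j) (hjl : j ≤ l) (hj : ∀ r, j ≠ D.pivot r) :
    D.pivotsBetween i l = D.pivotsBetween i j + D.pivotsBetween j l := by
  rw [pivotsBetween, pivotsBetween, pivotsBetween, ← Finset.card_union_of_disjoint]
  · congr 1
    ext s
    simp only [Finset.mem_filter, Finset.mem_univ, true_and, Finset.mem_union]
    constructor
    · rintro ⟨h1, h2⟩
      rcases lt_or_gt_of_ne (hj s) with h | h
      · exact Or.inr ⟨h, h2⟩
      · exact Or.inl ⟨h1, h⟩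
    · rintro (⟨h1, h2⟩ | ⟨h1, h2⟩)
      · exact ⟨h1, h2.trans_le hjl⟩
      · exact ⟨hij.trans h1, h2⟩
  · rw [Finset.disjoint_filter]
    exact fun s _ h h' => h.2.not_gt h'.1

open Classical in
/-- The flow with the signs restored, together with the rows of the network matrix. -/
noncomputable def signedFlow (D : LeDiagram k n) (w : Fin k × Fin n → ℝ)
    (R : Matrix (Fin k) (Fin n) ℝ) (v : Fin k × Fin n) (l : Fin n) : ℝ :=
  if v ∈ D.boxes then (-1) ^ D.pivotsBetween v.2 l * D.flow w v l else R v.1 l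

variable {w : Fin k × Fin n → ℝ}

theorem signedFlow_box {R : Matrix (Fin k) (Fin n) ℝ} {b : Fin k × Fin n} (hb : b ∈ D.boxes) :
    D.signedFlow w R b = fun l => (-1) ^ D.pivotsBetween b.2 l * D.flow w b l := by
  ext l
  rw [signedFlow, if_pos hb]

theorem signedFlow_pivot {R : Matrix (Fin k) (Fin n) ℝ} (r : Fin k) :
    D.signedFlow w R (r, D.pivot r) = R r := by
  ext l
  rw [signedFlow, if_neg fun h => col_ne_pivot h r rfl]

theorem hasLeadingOne_signedFlow {v : Fin k × Fin n} (hv : v ∈ D.whites) :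
    HasLeadingOne v.2 (D.signedFlow w (D.networkMatrix w) v) := by
  by_cases hb : v ∈ D.boxes
  · have := isFlow_flow (w := w).hasLeadingOne v hb
    rw [signedFlow_box hb]
    exact ⟨by beta_reduce; rw [this.1, pivotsBetween_self]; simp,
      fun l hl => by beta_reduce; rw [this.2 l hl, mul_zero]⟩
  · rw [eq_pivot_of_not_mem_boxes hv hb, signedFlow_pivot]
    exact ⟨by rw [networkMatrix, if_neg (lt_irrefl _), if_pos rfl],
      fun l hl => by rw [networkMatrix, if_pos hl]⟩

theorem signedFlow_eq {v : Fin k × Fin n} (hv : v ∈ D.whites) (l : Fin n) :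
    D.signedFlow w (D.networkMatrix w) v l = D.below (D.signedFlow w (D.networkMatrix w)) v l +
      (-1) ^ D.pivotsBetween v.2 l * D.leftward w (D.flow w) v l := by
  by_cases hb : v ∈ D.boxes
  · rw [signedFlow_box hb, isFlow_flow v hb]
    beta_reduce
    rw [Pi.add_apply, mul_add]
    congr 1
    rcases exists_vertical_or_toBoundary hv with ⟨b, h⟩ | h
    · rw [below_of_vertical h, below_of_vertical h, signedFlow_box h.2.1, h.2.2.1]
    · rw [below_of_toBoundary h, below_of_toBoundary h]
      by_cases hl : l = v.2
      · rw [hl, pivotsBetween_self]; simp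
      · simp [hl]
  · obtain ⟨r, rfl⟩ : ∃ r, v = (r, D.pivot r) := ⟨v.1, eq_pivot_of_not_mem_boxes hv hb⟩
    rw [signedFlow_pivot, below_of_toBoundary (toBoundary_pivot r),
      networkMatrix_of_isFlow isFlow_flow]
    have h0 : ∀ l, l ≤ D.pivot r → D.leftward w (D.flow w) (r, D.pivot r) l = 0 := by
      intro l hl
      by_cases hex : ∃ b, D.Horizontal (r, D.pivot r) b
      · obtain ⟨b, hb⟩ := hex
        rw [leftward_of_horizontal hb, Pi.smul_apply, (isFlow_flow.hasLeadingOne b hb.2.1).2 l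
          (hl.trans_lt hb.2.2.2.1), smul_zero]
      · rw [leftward_of_not hex, Pi.zero_apply]
    split_ifs with h1 h2
    · rw [h0 l h1.le]
      simp [h1.ne]
    · rw [h0 l h2.le]
      simp [h2]
    · simp [h2]

/-- A path through the edge ends in a column not before that of `b`, which is not a pivot. So the
parity of the pivots it passes splits at `b`, and the sign of the first part can be attached to the
weight of the edge. -/
theorem signedFlow_step {v b : Fin k × Fin n} (h : D.Horizontal v b) :
    D.signedFlow w (D.networkMatrix w) v = D.below (D.signedFlow w (D.networkMatrix w)) v +
      ((-1) ^ D.pivotsBetween v.2 b.2 * w b) • D.signedFlow w (D.networkMatrix w) b := by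
  ext l
  rw [signedFlow_eq h.1, leftward_of_horizontal h, Pi.add_apply, Pi.smul_apply, Pi.smul_apply,
    signedFlow_box h.2.1]
  congr 1
  simp only [smul_eq_mul]
  rcases lt_or_ge l b.2 with hl | hl
  · rw [(isFlow_flow.hasLeadingOne b h.2.1).2 l hl]
    simp
  · rw [pivotsBetween_add h.2.2.2.1 hl (col_ne_pivot h.2.1), pow_add]
    ring

/-- All signed flows are normalized by their exponential sums at one time at which these sums are
positive. `γ v` is the share of the left neighbour in the sum at `v`, and `1 - γ v` is the share of
the lower neighbour. -/
theorem exists_isVacuumNetwork {R : Matrix (Fin k) (Fin n) ℝ} (hR : D.Represents R)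
    {κ : Fin n → ℝ} (hκ : StrictMono κ) : ∃ t₀ : RealTimes,
      (∀ r, generator κ R r t₀.toComplex ≠ 0) ∧ ∃ a γ, D.IsVacuumNetwork a γ ∧
        ∀ r t, generator κ R r t / generator κ R r t₀.toComplex =
          expCombination κ t₀ (fun j => (a (r, D.pivot r) j : ℂ)) t := by
  obtain ⟨w, hw, rfl⟩ := hR
  set U := D.signedFlow w (D.networkMatrix w) with hU
  -- One value of t₁, sufficiently negative, serves all of the finitely many white vertices.
  obtain ⟨x, hx⟩ : ∃ x : ℝ, ∀ v ∈ D.whites, 0 < ∑ l, U v l * Real.exp (κ l * x) :=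
    ((Filter.eventually_all_finset D.whites).2 fun v hv =>
      eventually_pos_of_hasLeadingOne hκ (hasLeadingOne_signedFlow hv)).exists
  let S : (Fin n → ℝ) → ℝ := fun u => ∑ l, u l * Real.exp (κ l * x)
  let N : (Fin n → ℝ) → Fin n → ℝ := fun u j => u j * Real.exp (κ j * x) / S u
  have hSadd : ∀ u v, S (u + v) = S u + S v := fun u v => by
    simp only [S, Pi.add_apply, add_mul, Finset.sum_add_distrib]
  have hSsmul : ∀ (y : ℝ) u, S (y • u) = y * S u := fun y u => by
    simp only [S, Pi.smul_apply, smul_eq_mul, mul_assoc, Finset.mul_sum]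
  have hSsingle : ∀ j, S (Pi.single j 1) = Real.exp (κ j * x) := fun j => by
    simp only [S]
    rw [Finset.sum_eq_single j (fun i _ hi => by simp [hi]) (by simp)]
    simp
  have hNsingle : ∀ j, N (Pi.single j 1) = Pi.single j 1 := fun j => by
    ext l
    simp only [N, hSsingle]
    by_cases h : l = j
    · subst h; simp
    · simp [h]
  have hSbelow : ∀ v ∈ D.whites, 0 < S (D.below U v) := fun v hv => by
    rcases exists_vertical_or_toBoundary hv with ⟨b, h⟩ | h
    · rw [below_of_vertical h]; exact hx b (mem_whites_of_mem_boxes h.2.1)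
    · rw [below_of_toBoundary h, hSsingle]; positivity
  have hNbelow : ∀ v ∈ D.whites, D.below (fun v => N (U v)) v = N (D.below U v) := fun v hv => by
    rcases exists_vertical_or_toBoundary hv with ⟨b, h⟩ | h
    · rw [below_of_vertical h, below_of_vertical h]
    · rw [below_of_toBoundary h, below_of_toBoundary h, hNsingle]
  -- Both sides are `γ v`. The left form shows that it is less than 1, the right form shows its
  -- sign.
  have hγ : ∀ v b, D.Horizontal v b → 1 - S (D.below U v) / S (U v) =
      (-1) ^ D.pivotsBetween v.2 b.2 * (w b * S (U b) / S (U v)) := fun v b h => by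
    have h1 : S (U v) ≠ 0 := (hx v h.1).ne'
    have h2 := congrArg S (signedFlow_step (w := w) h)
    rw [hSadd, hSsmul] at h2
    simp only [← hU] at h2
    field_simp
    rw [h2]
    ring
  let t₀ : RealTimes := Finsupp.single 1 x
  have hexp : ∀ j t, Complex.exp (theta (κ j : ℂ) t) =
      (Real.exp (κ j * x) : ℝ) * Complex.exp (theta (κ j : ℂ) (t - t₀.toComplex)) := fun j t => by
    push_cast
    rw [← Complex.exp_add, theta_sub, theta_toComplex, realTheta_single]
    push_cast
    simp
  have hgen : ∀ r t, generator κ (D.networkMatrix w) r t = S (U (r, D.pivot r)) *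
      expCombination κ t₀ (fun j => (N (U (r, D.pivot r)) j : ℂ)) t := fun r t => by
    have h1 : ((S (U (r, D.pivot r)) : ℝ) : ℂ) ≠ 0 := by
      exact_mod_cast (hx _ (pivot_mem_whites r)).ne'
    rw [generator, expCombination, Finset.mul_sum]
    refine Finset.sum_congr rfl fun j _ => ?_
    rw [hexp j t, ← signedFlow_pivot (w := w) (R := D.networkMatrix w) r, ← hU]
    simp only [N]
    push_cast
    field_simp
  have hNsum : ∀ v ∈ D.whites, ∑ j, N (U v) j = 1 := fun v hv => by
    simp only [N]
    rw [← Finset.sum_div]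
    exact div_self (hx v hv).ne'
  have hgen0 : ∀ r, generator κ (D.networkMatrix w) r t₀.toComplex = S (U (r, D.pivot r)) :=
    fun r => by
      rw [hgen, expCombination_initial, ← Complex.ofReal_sum, hNsum _ (pivot_mem_whites r),
        Complex.ofReal_one, mul_one]
  have hS0 : ∀ r, ((S (U (r, D.pivot r)) : ℝ) : ℂ) ≠ 0 := fun r => by
    exact_mod_cast (hx _ (pivot_mem_whites r)).ne'
  refine ⟨t₀, fun r => by rw [hgen0]; exact hS0 r, fun v => N (U v),
    fun v => 1 - S (D.below U v) / S (U v), ⟨hNsum, fun v hv l hl => ?_, fun v hv => ?_,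
    fun v b h => ?_, fun v hv h => ?_, fun v b h he => ?_, fun v b h ho => ?_⟩, fun r t => ?_⟩
  · simp only [N]
    rw [hU, (hasLeadingOne_signedFlow hv).2 l hl, zero_mul, zero_div]
  · simp only [N]
    rw [hU, (hasLeadingOne_signedFlow hv).1, one_mul]
    have : 0 < S (D.signedFlow w (D.networkMatrix w) v) := hx v hv
    positivity
  · have h1 : S (U v) ≠ 0 := (hx v h.1).ne'
    have h2 : S (U b) ≠ 0 := (hx b (mem_whites_of_mem_boxes h.2.1)).ne'
    have h3 : S (D.below U v) ≠ 0 := (hSbelow v h.1).ne'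
    rw [hγ v b h, hNbelow v h.1, ← hγ v b h, sub_sub_cancel, hγ v b h]
    ext j
    have h4 := congrFun (signedFlow_step (w := w) h) j
    rw [← hU] at h4
    simp only [Pi.add_apply, Pi.smul_apply, smul_eq_mul, N] at h4 ⊢
    rw [h4]
    field_simp
  · rw [hNbelow v hv]
    congr 1
    ext l
    rw [hU, signedFlow_eq hv, leftward_of_not h]
    simp
  · have h1 : 0 < S (U v) := hx v h.1
    have h2 : 0 < S (U b) := hx b (mem_whites_of_mem_boxes h.2.1)
    have h3 := hSbelow v h.1
    have h4 := hw b h.2.1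
    refine ⟨?_, by have := div_pos h3 h1; linarith⟩
    rw [hγ v b h, he.neg_one_pow]
    positivity
  · have h1 : 0 < S (U v) := hx v h.1
    have h2 : 0 < S (U b) := hx b (mem_whites_of_mem_boxes h.2.1)
    have h4 := hw b h.2.1
    rw [hγ v b h, ho.neg_one_pow]
    have : 0 < w b * S (U b) / S (U v) := by positivity
    linarith
  · rw [hgen0, hgen, mul_div_cancel_left₀ _ (hS0 r)]

end LeDiagram
end KPSoliton

/-! ### Meromorphic functions on the sphere with at most one simple pole. -/

namespace KPSoliton

theorem tendsto_coe_cobounded : Tendsto ((↑) : ℂ → OnePoint ℂ) (Bornology.cobounded ℂ)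
    (𝓝 OnePoint.infty) := by
  rw [Metric.cobounded_eq_cocompact, ← coclosedCompact_eq_cocompact]
  exact OnePoint.tendsto_coe_infty

theorem tendsto_localPoint (a : OnePoint ℂ) : Tendsto (localPoint a) (𝓝[≠] 0) (𝓝 a) := by
  induction a using OnePoint.rec with
  | infty => exact tendsto_coe_cobounded.comp tendsto_inv₀_nhdsNE_zero
  | coe a =>
    have h1 : Continuous fun z : ℂ => ((a + z : ℂ) : OnePoint ℂ) :=
      OnePoint.continuous_coe.comp (continuous_const.add continuous_id)
    have h2 : Tendsto (fun z : ℂ => ((a + z : ℂ) : OnePoint ℂ)) (𝓝 0) (𝓝 ((a : ℂ) : OnePoint ℂ)) := by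
      simpa using h1.tendsto 0
    exact h2.mono_left nhdsWithin_le_nhds

variable {f g : OnePoint ℂ → OnePoint ℂ} {m : OnePoint ℂ → ℕ}

theorem IsMeromorphicWithPoles.exists_eq_coe (hf : IsMeromorphicWithPoles f m) {a : OnePoint ℂ}
    (ha : m a = 0) : ∃ c : ℂ, f a = (c : OnePoint ℂ) := by
  obtain ⟨h, hh, he⟩ := hf.2 a
  refine ⟨h 0, tendsto_nhds_unique ((hf.1.tendsto a).comp (tendsto_localPoint a)) ?_⟩
  have h1 : Tendsto (fun z => ((h z : ℂ) : OnePoint ℂ)) (𝓝[≠] 0) (𝓝 ((h 0 : ℂ) : OnePoint ℂ)) :=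
    (OnePoint.continuous_coe.tendsto _).comp (hh.continuousAt.tendsto.mono_left nhdsWithin_le_nhds)
  refine h1.congr' ?_
  filter_upwards [he] with z hz
  simp [hz, ha]

theorem tendsto_cocompact_of_continuous (hf : Continuous f) {F : ℂ → ℂ} {c : ℂ}
    (hF : ∀ᶠ z : ℂ in cocompact ℂ, f z = (F z : OnePoint ℂ)) (hc : f OnePoint.infty = (c : OnePoint ℂ)) :
    Tendsto F (cocompact ℂ) (𝓝 c) := by
  have h1 : Tendsto (fun z : ℂ => f z) (cocompact ℂ) (𝓝 (c : OnePoint ℂ)) := by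
    rw [← hc, ← Metric.cobounded_eq_cocompact]
    exact (hf.tendsto _).comp tendsto_coe_cobounded
  have h2 : Tendsto (fun z : ℂ => ((F z : ℂ) : OnePoint ℂ)) (cocompact ℂ) (𝓝 (c : OnePoint ℂ)) :=
    h1.congr' hF
  rwa [OnePoint.isOpenEmbedding_coe.isInducing.nhds_eq_comap, tendsto_comap_iff]

/-- A meromorphic function on the sphere with finite value `c` at infinity and at most one simple
pole at `γ` is of the form `c + d / (z - γ)`. -/
theorem IsMeromorphicWithPoles.exists_eq_add_div (hf : IsMeromorphicWithPoles f m) {γ c : ℂ}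
    (hm : ∀ z : ℂ, z ≠ γ → m z = 0) (hγ : m γ ≤ 1) (hc : f OnePoint.infty = (c : OnePoint ℂ)) :
    ∃ d : ℂ, ∀ z : ℂ, z ≠ γ → f z = ((c + d / (z - γ) : ℂ) : OnePoint ℂ) := by
  classical
  have hex : ∀ z : ℂ, ∃ y : ℂ, z ≠ γ → f z = (y : OnePoint ℂ) := fun z => by
    by_cases hz : z = γ
    · exact ⟨0, fun h => absurd hz h⟩
    · obtain ⟨y, hy⟩ := hf.exists_eq_coe (hm z hz)
      exact ⟨y, fun _ => hy⟩
  choose F hF using hex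
  obtain ⟨h, hh, he⟩ : ∃ h : ℂ → ℂ, AnalyticAt ℂ h 0 ∧
      ∀ᶠ z in 𝓝[≠] (0 : ℂ), F (γ + z) = h z / z := by
    obtain ⟨h, hh, he⟩ := hf.2 γ
    -- The extra power treats the bounds 0 and 1 on the pole order uniformly.
    refine ⟨fun z => z ^ (1 - m γ) * h z, (by fun_prop), ?_⟩
    filter_upwards [he, self_mem_nhdsWithin] with z hz hz0
    have hz0 : z ≠ 0 := hz0
    have h1 : ((F (γ + z) : ℂ) : OnePoint ℂ) = ((h z / z ^ m γ : ℂ) : OnePoint ℂ) := by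
      rw [← hz, ← hF (γ + z) (by simpa using hz0)]
      rfl
    rw [OnePoint.coe_injective h1]
    have h2 : z ^ (1 - m γ) * z ^ m γ = z := by rw [← pow_add, Nat.sub_add_cancel hγ, pow_one]
    rw [div_eq_div_iff (pow_ne_zero _ hz0) hz0]
    linear_combination -(h z) * h2
  set d := h 0
  -- `H` is `F` without its principal part, completed at `γ` by the value that removes the
  -- singularity. It is entire and tends to `c` at infinity, hence constant by Liouville.
  let H : ℂ → ℂ := fun z => if z = γ then deriv h 0 else F z - d / (z - γ)
  have hHγ : AnalyticAt ℂ H γ := by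
    have h1 : AnalyticAt ℂ (fun z => dslope h 0 (z - γ)) γ := by
      have h2 : AnalyticAt ℂ (dslope h 0) (γ - γ) := by
        rw [sub_self]
        obtain ⟨s, hs, hs'⟩ := hh.eventually_analyticAt.exists_mem
        have h3 : DifferentiableOn ℂ (dslope h 0) s :=
          (Complex.differentiableOn_dslope hs).2 fun z hz =>
            (hs' z hz).differentiableAt.differentiableWithinAt
        exact h3.analyticAt hs
      exact h2.comp_of_eq (by fun_prop) rfl
    refine h1.congr ?_
    have h4 : ∀ᶠ z in 𝓝[≠] γ, F z = h (z - γ) / (z - γ) := by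
      have h5 : Tendsto (fun z : ℂ => z - γ) (𝓝[≠] γ) (𝓝[≠] 0) := by
        refine tendsto_nhdsWithin_iff.2 ⟨?_, ?_⟩
        · have : Continuous fun z : ℂ => z - γ := by fun_prop
          simpa using (this.tendsto γ).mono_left nhdsWithin_le_nhds
        · filter_upwards [self_mem_nhdsWithin] with z hz
          exact sub_ne_zero.2 hz
      filter_upwards [h5.eventually he] with z hz
      simpa using hz
    rw [eventually_nhdsWithin_iff] at h4
    filter_upwards [h4] with z hz
    by_cases hzγ : z = γ
    · simp [H, hzγ]
    · have h6 : z - γ ≠ 0 := sub_ne_zero.2 hzγ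
      simp only [H, if_neg hzγ]
      rw [dslope_of_ne _ h6, hz hzγ, slope_def_field]
      simp only [sub_zero]
      rw [← sub_div]
  have hFd : ∀ z, z ≠ γ → DifferentiableAt ℂ F z := by
    intro a ha
    have hev : ∀ᶠ z : ℂ in 𝓝 a, f z = (F z : OnePoint ℂ) := by
      filter_upwards [isOpen_ne.mem_nhds ha] with z hz using hF z hz
    have hcont : ContinuousAt F a := by
      have h1 : Tendsto (fun z : ℂ => ((F z : ℂ) : OnePoint ℂ)) (𝓝 a) (𝓝 (F a : OnePoint ℂ)) := by
        rw [← hF a ha]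
        refine ((hf.1.comp OnePoint.continuous_coe).tendsto a).congr' ?_
        filter_upwards [hev] with z hz using hz
      rw [ContinuousAt, OnePoint.isOpenEmbedding_coe.isInducing.nhds_eq_comap (F a),
        tendsto_comap_iff]
      exact h1
    refine (Complex.analyticAt_of_differentiable_on_punctured_nhds_of_continuousAt ?_
      hcont).differentiableAt
    obtain ⟨h, hh, he⟩ := hf.2 a
    simp only [hm a ha, pow_zero, div_one] at he
    have h5 : Tendsto (fun z : ℂ => z - a) (𝓝[≠] a) (𝓝[≠] 0) := by
      refine tendsto_nhdsWithin_iff.2 ⟨?_, ?_⟩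
      · have : Continuous fun z : ℂ => z - a := by fun_prop
        simpa using (this.tendsto a).mono_left nhdsWithin_le_nhds
      · filter_upwards [self_mem_nhdsWithin] with z hz
        exact sub_ne_zero.2 hz
    have h6 : ∀ᶠ z in 𝓝[≠] a, F z = h (z - a) := by
      filter_upwards [h5.eventually he, hev.filter_mono nhdsWithin_le_nhds] with z hz hz'
      have h7 : localPoint a (z - a) = (z : OnePoint ℂ) := by
        change ((a + (z - a) : ℂ) : OnePoint ℂ) = z
        rw [add_sub_cancel]
      rw [h7, hz'] at hz
      exact OnePoint.coe_injective hz
    have h8 : ∀ᶠ z in 𝓝[≠] a, AnalyticAt ℂ h (z - a) :=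
      (h5.mono_right nhdsWithin_le_nhds).eventually hh.eventually_analyticAt
    have h9 := eventually_eventually_nhdsWithin.2 h6
    filter_upwards [h9, h8, self_mem_nhdsWithin] with z hz hz' hza
    have h10 : F =ᶠ[𝓝 z] fun z => h (z - a) := by
      have := hz
      rwa [IsOpen.nhdsWithin_eq isOpen_compl_singleton hza] at this
    have h11 : DifferentiableAt ℂ (fun z => h (z - a)) z :=
      DifferentiableAt.comp z hz'.differentiableAt (by fun_prop)
    exact h11.congr_of_eventuallyEq h10
  have hH : Differentiable ℂ H := by
    intro z
    by_cases hz : z = γ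
    · rw [hz]; exact hHγ.differentiableAt
    · have h1 : DifferentiableAt ℂ (fun z => F z - d / (z - γ)) z := by
        refine (hFd z hz).sub ?_
        refine DifferentiableAt.div (by fun_prop) (by fun_prop) (sub_ne_zero.2 hz)
      refine h1.congr_of_eventuallyEq ?_
      filter_upwards [isOpen_ne.mem_nhds hz] with y hy
      simp only [H]
      rw [if_neg hy]
  have hne : ∀ᶠ z in cocompact ℂ, z ≠ γ := (isCompact_singleton (x := γ)).compl_mem_cocompact
  have hlim : Tendsto H (cocompact ℂ) (𝓝 c) := by
    have h1 := tendsto_cocompact_of_continuous hf.1 (hne.mono fun z hz => hF z hz) hc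
    have h2 : Tendsto (fun z : ℂ => d / (z - γ)) (cocompact ℂ) (𝓝 0) := by
      have h3 : Tendsto (fun z : ℂ => (z - γ)⁻¹) (cocompact ℂ) (𝓝 0) := by
        rw [← Metric.cobounded_eq_cocompact]
        refine tendsto_inv₀_cobounded.comp ?_
        simp [sub_eq_add_neg, tendsto_add_const_cobounded]
      simpa [div_eq_mul_inv] using h3.const_mul d
    have h4 := h1.sub h2
    rw [sub_zero] at h4
    refine h4.congr' (hne.mono fun z hz => ?_)
    simp only [H]
    rw [if_neg hz]
  refine ⟨d, fun z hz => ?_⟩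
  have := hH.apply_eq_of_tendsto_cocompact z hlim
  simp only [H] at this
  rw [if_neg hz] at this
  rw [hF z hz, ← this, sub_add_cancel]

theorem eq_of_forall_ne (hf : Continuous f) (hg : Continuous g) {γ : ℂ}
    (h : ∀ z : ℂ, z ≠ γ → f z = g z) : f = g := by
  have h1 : f ∘ ((↑) : ℂ → OnePoint ℂ) = g ∘ ((↑) : ℂ → OnePoint ℂ) :=
    Continuous.ext_on (dense_compl_singleton γ) (hf.comp OnePoint.continuous_coe)
      (hg.comp OnePoint.continuous_coe) fun z hz => h z hz
  exact OnePoint.denseRange_coe.equalizer hf hg h1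

/-- A function without poles can be written with a fictitious pole at 0 and also with one at 1;
comparison at two points shows that the residue is zero. -/
theorem IsMeromorphicWithPoles.eq_const (hf : IsMeromorphicWithPoles f m)
    (hm : ∀ z : ℂ, m z = 0) {c : ℂ} (hc : f OnePoint.infty = (c : OnePoint ℂ)) (z : OnePoint ℂ) :
    f z = (c : OnePoint ℂ) := by
  obtain ⟨d, hd⟩ := hf.exists_eq_add_div (γ := 0) (fun z _ => hm z) ((hm 0).le.trans zero_le_one) hc
  obtain ⟨d', hd'⟩ := hf.exists_eq_add_div (γ := 1) (fun z _ => hm z) ((hm 1).le.trans zero_le_one) hc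
  have h1 := OnePoint.coe_injective ((hd 2 (by norm_num)).symm.trans (hd' 2 (by norm_num)))
  have h2 := OnePoint.coe_injective ((hd (-1) (by norm_num)).symm.trans (hd' (-1) (by norm_num)))
  have hd0 : d = 0 := by
    field_simp at h1 h2
    norm_num at h1 h2
    have h3 : 3 * d = 0 := by linear_combination -h1 - 2 * h2
    simpa using h3
  refine congrFun (eq_of_forall_ne hf.1 continuous_const (γ := 0) (g := fun _ => (c : OnePoint ℂ))
    fun z hz => ?_) z
  rw [hd z hz, hd0]
  simp

theorem isMeromorphicWithPoles_const (c : ℂ) : IsMeromorphicWithPoles (fun _ => (c : OnePoint ℂ)) m := by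
  refine ⟨continuous_const, fun a => ⟨fun z => c * z ^ m a, by fun_prop, ?_⟩⟩
  filter_upwards [self_mem_nhdsWithin] with z hz
  have hz : z ≠ 0 := hz
  congr 1
  field_simp

open Classical in
/-- The meromorphic function `c + d / (z - γ)` on the sphere. -/
noncomputable def poleFunction (c d γ : ℂ) : OnePoint ℂ → OnePoint ℂ
  | OnePoint.infty => (c : OnePoint ℂ)
  | OnePoint.some z => if z = γ then (if d = 0 then (c : OnePoint ℂ) else OnePoint.infty) else
      ((c + d / (z - γ) : ℂ) : OnePoint ℂ)

theorem poleFunction_infty (c d γ : ℂ) : poleFunction c d γ OnePoint.infty = (c : OnePoint ℂ) := rfl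

theorem poleFunction_of_ne {c d γ z : ℂ} (h : z ≠ γ) :
    poleFunction c d γ z = ((c + d / (z - γ) : ℂ) : OnePoint ℂ) := if_neg h

theorem poleFunction_self {c d γ : ℂ} (h : d ≠ 0) : poleFunction c d γ γ = OnePoint.infty :=
  (if_pos rfl).trans (if_neg h)

theorem poleFunction_zero (c γ : ℂ) : poleFunction c 0 γ = fun _ => (c : OnePoint ℂ) := by
  ext z
  induction z using OnePoint.rec with
  | infty => rfl
  | coe z =>
    by_cases h : z = γ
    · subst h
      exact (if_pos rfl).trans (if_pos rfl)
    · rw [poleFunction_of_ne h, zero_div, add_zero]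

theorem isMeromorphicWithPoles_poleFunction (c d γ : ℂ) (hγ : m γ = 1)
    (hm : ∀ z, z ≠ (γ : OnePoint ℂ) → m z = 0) :
    IsMeromorphicWithPoles (poleFunction c d γ) m := by
  by_cases hd : d = 0
  · rw [hd, poleFunction_zero]
    exact isMeromorphicWithPoles_const c
  have hne : ∀ᶠ z in cocompact ℂ, z ≠ γ := (isCompact_singleton (x := γ)).compl_mem_cocompact
  refine ⟨continuous_iff_continuousAt.2 fun a => ?_, fun a => ?_⟩
  · induction a using OnePoint.rec with
    | infty =>
      rw [OnePoint.continuousAt_infty', poleFunction_infty, coclosedCompact_eq_cocompact]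
      have h3 : Tendsto (fun z : ℂ => c + d * (z - γ)⁻¹) (cocompact ℂ) (𝓝 (c + d * 0)) := by
        refine Tendsto.const_add c (Tendsto.const_mul d ?_)
        rw [← Metric.cobounded_eq_cocompact]
        refine tendsto_inv₀_cobounded.comp ?_
        simp [sub_eq_add_neg, tendsto_add_const_cobounded]
      rw [mul_zero, add_zero] at h3
      refine ((OnePoint.continuous_coe.tendsto _).comp h3).congr' (hne.mono fun z hz => ?_)
      simp only [Function.comp_apply]
      rw [poleFunction_of_ne hz, div_eq_mul_inv]
    | coe a =>
      rw [OnePoint.continuousAt_coe]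
      by_cases ha : a = γ
      · subst ha
        rw [continuousAt_iff_punctured_nhds, Function.comp_apply, poleFunction_self hd]
        have h1 : Tendsto (fun z : ℂ => c + d * (z - a)⁻¹) (𝓝[≠] a) (Bornology.cobounded ℂ) := by
          refine (tendsto_const_add_cobounded c).comp ?_
          refine (tendsto_mul_left_cobounded hd).comp ?_
          refine tendsto_inv₀_nhdsNE_zero.comp ?_
          refine tendsto_nhdsWithin_iff.2 ⟨?_, ?_⟩
          · have : Continuous fun z : ℂ => z - a := by fun_prop
            simpa using (this.tendsto a).mono_left nhdsWithin_le_nhds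
          · filter_upwards [self_mem_nhdsWithin] with z hz
            exact sub_ne_zero.2 hz
        refine (tendsto_coe_cobounded.comp h1).congr' ?_
        filter_upwards [self_mem_nhdsWithin] with z hz
        simp only [Function.comp_apply]
        rw [poleFunction_of_ne hz, div_eq_mul_inv]
      · have h1 : ContinuousAt (fun z : ℂ => c + d / (z - γ)) a := by
          refine ContinuousAt.add (by fun_prop) (ContinuousAt.div (by fun_prop) (by fun_prop)
            (sub_ne_zero.2 ha))
        have h2 := OnePoint.continuous_coe.continuousAt.comp h1
        refine h2.congr ?_
        filter_upwards [isOpen_ne.mem_nhds ha] with z hz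
        simp only [Function.comp_apply]
        rw [poleFunction_of_ne hz]
  · induction a using OnePoint.rec with
    | infty =>
      refine ⟨fun z => c + d * z / (1 - γ * z), ?_, ?_⟩
      · refine analyticAt_const.add (AnalyticAt.div (by fun_prop) (by fun_prop) (by simp))
      · have h1 : ∀ᶠ z in 𝓝[≠] (0 : ℂ), z⁻¹ ≠ γ := by
          have := (tendsto_inv₀_nhdsNE_zero (α := ℂ))
          rw [Metric.cobounded_eq_cocompact] at this
          exact this.eventually hne
        filter_upwards [h1, self_mem_nhdsWithin] with z hz hz0
        have hz0 : z ≠ 0 := hz0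
        change poleFunction c d γ ((z⁻¹ : ℂ) : OnePoint ℂ) = _
        rw [poleFunction_of_ne hz, hm _ (OnePoint.infty_ne_coe γ), pow_zero, div_one]
        have h2 : 1 - γ * z ≠ 0 := fun h => hz (by field_simp; linear_combination h)
        have h3 : z⁻¹ - γ ≠ 0 := sub_ne_zero.2 hz
        congr 2
        rw [div_eq_div_iff h3 h2]
        field_simp
    | coe a =>
      by_cases ha : a = γ
      · subst ha
        refine ⟨fun z => c * z + d, by fun_prop, ?_⟩
        filter_upwards [self_mem_nhdsWithin] with z hz0
        have hz0 : z ≠ 0 := hz0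
        change poleFunction c d a ((a + z : ℂ) : OnePoint ℂ) = _
        rw [poleFunction_of_ne (by simpa using hz0), hγ, add_sub_cancel_left]
        congr 1
        field_simp
      · refine ⟨fun z => c + d / (a + z - γ), ?_, ?_⟩
        · refine analyticAt_const.add (AnalyticAt.div (by fun_prop) (by fun_prop) ?_)
          simpa using sub_ne_zero.2 ha
        · have h1 : ∀ᶠ z in 𝓝 (0 : ℂ), a + z ≠ γ := by
            have h2 : ContinuousAt (fun z : ℂ => a + z) 0 := by fun_prop
            exact h2.eventually_ne (by simpa using ha)
          filter_upwards [h1.filter_mono nhdsWithin_le_nhds] with z hz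
          change poleFunction c d γ ((a + z : ℂ) : OnePoint ℂ) = _
          rw [poleFunction_of_ne hz, hm _ (fun h => ha (OnePoint.coe_injective h)), pow_zero, div_one]

end KPSoliton

/-! ### The wave function and its divisor. -/

namespace KPSoliton
namespace LeDiagram

variable {k n : ℕ} {D : LeDiagram k n} {a : Fin k × Fin n → Fin n → ℝ} {γ : Fin k × Fin n → ℝ}

/-- There is a horizontal edge to the left of the white vertex `v`. -/
def HasLeft (D : LeDiagram k n) (v : Fin k × Fin n) : Prop := ∃ b, D.Horizontal v b

theorem IsVacuumNetwork.gamma_lt_one (h : D.IsVacuumNetwork a γ) {v : Fin k × Fin n}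
    (hv : D.HasLeft v) : γ v < 1 := by
  obtain ⟨b, hb⟩ := hv
  rcases Nat.even_or_odd (D.pivotsBetween v.2 b.2) with he | ho
  · exact (h.gamma_pos v b hb he).2
  · exact (h.gamma_neg v b hb ho).trans one_pos

theorem IsVacuumNetwork.gamma_ne_zero (h : D.IsVacuumNetwork a γ) {v : Fin k × Fin n}
    (hv : D.HasLeft v) : γ v ≠ 0 := by
  obtain ⟨b, hb⟩ := hv
  rcases Nat.even_or_odd (D.pivotsBetween v.2 b.2) with he | ho
  · exact (h.gamma_pos v b hb he).1.ne'
  · exact (h.gamma_neg v b hb ho).ne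

/-- The point with coordinate `γ v` on the component of the white vertex `v`. -/
noncomputable def whitePoint (D : LeDiagram k n) (γ : Fin k × Fin n → ℝ)
    (v : {v : Fin k × Fin n // v ∈ D.whites}) : D.Point :=
  (.white v, ((γ v.1 : ℂ) : OnePoint ℂ))

theorem whitePoint_injective : Function.Injective (D.whitePoint γ) := fun v v' h => by
  have := congrArg Prod.fst h
  simpa [whitePoint] using this

open Classical in
/-- The divisor with the points of coordinates `γ`. -/
noncomputable def divisor (D : LeDiagram k n) (γ : Fin k × Fin n → ℝ) : D.Point →₀ ℕ :=
  Finsupp.indicator ((Finset.univ.filter fun v : {v // v ∈ D.whites} => D.HasLeft v.1).image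
    (D.whitePoint γ)) fun _ _ => 1

theorem divisor_whitePoint {v : {v // v ∈ D.whites}} (hv : D.HasLeft v.1) :
    D.divisor γ (D.whitePoint γ v) = 1 := by
  classical
  rw [divisor, Finsupp.indicator_apply, dif_pos]
  exact Finset.mem_image_of_mem _ (Finset.mem_filter.2 ⟨Finset.mem_univ _, hv⟩)

theorem divisor_ne_zero {x : D.Point} (hx : D.divisor γ x ≠ 0) :
    ∃ v : {v // v ∈ D.whites}, D.HasLeft v.1 ∧ x = D.whitePoint γ v := by
  classical
  rw [divisor, Finsupp.indicator_apply] at hx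
  split_ifs at hx with h
  · obtain ⟨v, hv, rfl⟩ := Finset.mem_image.1 h
    exact ⟨v, (Finset.mem_filter.1 hv).2, rfl⟩
  · exact absurd rfl hx

theorem divisor_eq_zero {x : D.Point}
    (hx : ∀ v : {v // v ∈ D.whites}, D.HasLeft v.1 → x ≠ D.whitePoint γ v) :
    D.divisor γ x = 0 := by
  by_contra h
  obtain ⟨v, hv, e⟩ := divisor_ne_zero h
  exact hx v hv e

open Classical in
theorem degreeOn_divisor (S : Set D.Point) : degreeOn (D.divisor γ) S =
    (Finset.univ.filter fun v : {v // v ∈ D.whites} =>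
      D.HasLeft v.1 ∧ D.whitePoint γ v ∈ S).card := by
  classical
  rw [degreeOn, Finset.card_eq_sum_ones]
  symm
  refine Finset.sum_bij (fun v _ => D.whitePoint γ v) (fun v hv => ?_)
    (fun v _ v' _ h => whitePoint_injective h) (fun x hx => ?_) (fun v hv => ?_)
  · have := (Finset.mem_filter.1 hv).2
    rw [Finset.mem_filter, Finsupp.mem_support_iff, divisor_whitePoint this.1]
    exact ⟨one_ne_zero, this.2⟩
  · rw [Finset.mem_filter, Finsupp.mem_support_iff] at hx
    obtain ⟨v, hv, rfl⟩ := divisor_ne_zero hx.1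
    exact ⟨v, Finset.mem_filter.2 ⟨Finset.mem_univ _, hv, hx.2⟩, rfl⟩
  · exact (divisor_whitePoint (Finset.mem_filter.1 hv).2.1).symm

open Classical in
-- Every box is the left neighbour of exactly one white vertex, so divisor points correspond to
-- boxes and the degree is the dimension of the cell.
theorem card_hasLeft : (Finset.univ.filter fun v : {v // v ∈ D.whites} => D.HasLeft v.1).card =
    D.dim := by
  classical
  refine Finset.card_bij (fun v hv => (Finset.mem_filter.1 hv).2.choose) (fun v hv => ?_)
    (fun v hv v' hv' h => ?_) (fun b hb => ?_)
  · exact (Finset.mem_filter.1 hv).2.choose_spec.2.1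
  · have h1 := (Finset.mem_filter.1 hv).2.choose_spec
    have h2 := (Finset.mem_filter.1 hv').2.choose_spec
    rw [← h] at h2
    exact Subtype.ext (h1.left_unique h2)
  · obtain ⟨v, hv⟩ := exists_horizontal_right hb
    refine ⟨⟨v, hv.1⟩, Finset.mem_filter.2 ⟨Finset.mem_univ _, b, hv⟩, ?_⟩
    exact (Exists.choose_spec (⟨b, hv⟩ : ∃ b, D.Horizontal v b)).right_unique hv

/-- Real coefficients as complex coefficients. -/
noncomputable def complexify (u : Fin n → ℝ) : Fin n → ℂ := fun j => (u j : ℂ)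

theorem complexify_add (u v : Fin n → ℝ) : complexify (u + v) = complexify u + complexify v := by
  ext; simp [complexify]

theorem complexify_sub (u v : Fin n → ℝ) : complexify (u - v) = complexify u - complexify v := by
  ext; simp [complexify]

theorem complexify_smul (x : ℝ) (u : Fin n → ℝ) :
    complexify (x • u) = (x : ℂ) • complexify u := by
  ext; simp [complexify]

theorem complexify_single (j : Fin n) :
    complexify (Pi.single j 1 : Fin n → ℝ) = Pi.single j 1 := by
  ext l
  by_cases h : l = j
  · subst h; simp [complexify]
  · simp [complexify, h]

open Classical in
/-- The residues of the wave function on the component of the white vertex `v`. -/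
noncomputable def residue (D : LeDiagram k n) (a : Fin k × Fin n → Fin n → ℝ)
    (γ : Fin k × Fin n → ℝ) (v : Fin k × Fin n) : Fin n → ℝ :=
  if D.HasLeft v then γ v • (a v - D.leftward 1 a v) else 0

theorem residue_of_horizontal {v b : Fin k × Fin n} (h : D.Horizontal v b) :
    D.residue a γ v = γ v • (a v - a b) := by
  rw [residue, if_pos ⟨b, h⟩, leftward_of_horizontal h, Pi.one_apply, one_smul]

theorem residue_of_not {v : Fin k × Fin n} (h : ¬ D.HasLeft v) : D.residue a γ v = 0 := if_neg h

/-- The vacuum wave function. -/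
noncomputable def wave (D : LeDiagram k n) (κ : Fin n → ℝ) (t₀ : RealTimes)
    (a : Fin k × Fin n → Fin n → ℝ) (γ : Fin k × Fin n → ℝ) (x : D.Point) (t : Times) :
    OnePoint ℂ :=
  match x with
  | (.base, OnePoint.some ζ) => ((Complex.exp (theta ζ (t - t₀.toComplex)) : ℂ) : OnePoint ℂ)
  | (.base, OnePoint.infty) => OnePoint.infty
  | (.black b, _) => ((expCombination κ t₀ (complexify (a b.1)) t : ℂ) : OnePoint ℂ)
  | (.white v, z) => poleFunction (expCombination κ t₀ (complexify (a v.1)) t)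
      (expCombination κ t₀ (complexify (D.residue a γ v.1)) t) (γ v.1) z

variable {κ : Fin n → ℝ} {t₀ : RealTimes}

theorem wave_base (ζ : ℂ) (t : Times) : D.wave κ t₀ a γ (.base, (ζ : OnePoint ℂ)) t =
    ((Complex.exp (theta ζ (t - t₀.toComplex)) : ℂ) : OnePoint ℂ) := rfl

theorem wave_black (b : {b // b ∈ D.boxes}) (z : OnePoint ℂ) (t : Times) :
    D.wave κ t₀ a γ (.black b, z) t =
      ((expCombination κ t₀ (complexify (a b.1)) t : ℂ) : OnePoint ℂ) := by
  cases z <;> rfl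

theorem wave_white (v : {v // v ∈ D.whites}) (z : OnePoint ℂ) (t : Times) :
    D.wave κ t₀ a γ (.white v, z) t = poleFunction (expCombination κ t₀ (complexify (a v.1)) t)
      (expCombination κ t₀ (complexify (D.residue a γ v.1)) t) (γ v.1) z := by
  cases z <;> rfl

theorem wave_white_infty (v : {v // v ∈ D.whites}) (t : Times) :
    D.wave κ t₀ a γ (.white v, OnePoint.infty) t =
      ((expCombination κ t₀ (complexify (a v.1)) t : ℂ) : OnePoint ℂ) := by
  rw [wave_white, poleFunction_infty]

theorem wave_white_of_ne (v : {v // v ∈ D.whites}) {z : ℂ} (hz : z ≠ γ v.1) (t : Times) :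
    D.wave κ t₀ a γ (.white v, (z : OnePoint ℂ)) t =
      ((expCombination κ t₀ (complexify (a v.1) +
        (z - γ v.1)⁻¹ • complexify (D.residue a γ v.1)) t : ℂ) : OnePoint ℂ) := by
  rw [wave_white, poleFunction_of_ne hz, expCombination_add, expCombination_smul, div_eq_inv_mul]

theorem wave_white_of_not (v : {v // v ∈ D.whites}) (hv : ¬ D.HasLeft v.1) (z : OnePoint ℂ)
    (t : Times) : D.wave κ t₀ a γ (.white v, z) t =
      ((expCombination κ t₀ (complexify (a v.1)) t : ℂ) : OnePoint ℂ) := by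
  have h0 : expCombination κ t₀ (complexify (0 : Fin n → ℝ)) t = 0 := by
    simp [expCombination, complexify]
  rw [wave_white, residue_of_not hv, h0, poleFunction_zero]

/-- Away from the divisor the coefficients of the exponentials depend only on the point, which
yields both the heat hierarchy and regularity in the times. -/
theorem exists_wave_eq_expCombination {x : D.Point} (hx : x.1 ≠ .base)
    (hδ : D.divisor γ x = 0) :
    ∃ c : Fin n → ℂ, ∀ t, D.wave κ t₀ a γ x t = ((expCombination κ t₀ c t : ℂ) : OnePoint ℂ) := by
  obtain ⟨c, z⟩ := x
  cases c with
  | base => exact absurd rfl hx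
  | black b => exact ⟨_, fun t => wave_black b z t⟩
  | white v =>
    by_cases hv : D.HasLeft v.1
    · induction z using OnePoint.rec with
      | infty => exact ⟨_, fun t => wave_white_infty v t⟩
      | coe z =>
        refine ⟨_, fun t => wave_white_of_ne v (fun e => ?_) t⟩
        have := divisor_whitePoint (γ := γ) hv
        rw [whitePoint, ← e, hδ] at this
        exact zero_ne_one this
    · exact ⟨_, fun t => wave_white_of_not v hv z t⟩

/-- The residue `γ v (a v - a b)` is the one for which the function with value `a v` at ∞ takes the
value `a b` at 0. -/
theorem IsVacuumNetwork.wave_zero (h : D.IsVacuumNetwork a γ) {v : {v // v ∈ D.whites}}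
    {b : Fin k × Fin n} (hb : D.Horizontal v.1 b) (t : Times) :
    D.wave κ t₀ a γ (.white v, ((0 : ℂ) : OnePoint ℂ)) t =
      ((expCombination κ t₀ (complexify (a b)) t : ℂ) : OnePoint ℂ) := by
  have hγ : (γ v.1 : ℂ) ≠ 0 := by exact_mod_cast h.gamma_ne_zero ⟨b, hb⟩
  rw [wave_white_of_ne v hγ.symm]
  congr 2
  rw [residue_of_horizontal hb, complexify_smul, complexify_sub, smul_smul]
  ext j
  simp only [Pi.add_apply, Pi.smul_apply, Pi.sub_apply, smul_eq_mul, zero_sub]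
  field_simp
  ring

/-- With the residue fixed by the value at 0, the value at 1 is `(a v - γ v a b) / (1 - γ v)`, which
is the contribution from below by the network relation. -/
theorem IsVacuumNetwork.wave_one (h : D.IsVacuumNetwork a γ) (v : {v // v ∈ D.whites}) (t : Times) :
    D.wave κ t₀ a γ (.white v, ((1 : ℂ) : OnePoint ℂ)) t =
      ((expCombination κ t₀ (complexify (D.below a v.1)) t : ℂ) : OnePoint ℂ) := by
  by_cases hv : D.HasLeft v.1
  · obtain ⟨b, hb⟩ := hv
    have hγ : (1 - γ v.1 : ℂ) ≠ 0 := by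
      exact_mod_cast (sub_pos.2 (h.gamma_lt_one ⟨b, hb⟩)).ne'
    rw [wave_white_of_ne v (sub_ne_zero.1 hγ)]
    congr 2
    rw [residue_of_horizontal hb, complexify_smul, complexify_sub, h.step _ _ hb, complexify_add,
      complexify_smul, complexify_smul, smul_smul]
    ext j
    simp only [Pi.add_apply, Pi.smul_apply, Pi.sub_apply, smul_eq_mul]
    push_cast
    field_simp
    ring
  · rw [wave_white_of_not v hv, h.last v.1 v.2 hv]

theorem realPoint_cases (p : D.RealPoint) : p.2 = ⊤ ∨ ∃ x : ℝ, p.2 = (x : WithTop ℝ) := by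
  obtain ⟨c, y⟩ := p
  cases y
  · exact Or.inl rfl
  · exact Or.inr ⟨_, rfl⟩

theorem toSphere_coe (x : ℝ) : toSphere (x : WithTop ℝ) = ((x : ℂ) : OnePoint ℂ) := rfl

theorem IsVacuumNetwork.isVacuumWaveFunction (h : D.IsVacuumNetwork a γ) :
    D.IsVacuumWaveFunction κ t₀ (D.divisor γ) (D.wave κ t₀ a γ) where
  initial x hx := by
    have hsum : ∀ v ∈ D.whites, expCombination κ t₀ (complexify (a v)) t₀.toComplex = 1 :=
      fun v hv => by
        rw [expCombination_initial]
        simp only [complexify]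
        exact_mod_cast h.sum_one v hv
    obtain ⟨c, z⟩ := x
    cases c with
    | base =>
      induction z using OnePoint.rec with
      | infty => exact absurd rfl hx
      | coe ζ => rw [wave_base, sub_self, theta_zero, Complex.exp_zero]
    | black b => rw [wave_black, hsum _ (mem_whites_of_mem_boxes b.2)]
    | white v =>
      -- At the initial time all normalized values are 1, so the residue vanishes and the pole
      -- disappears.
      have hres : expCombination κ t₀ (complexify (D.residue a γ v.1)) t₀.toComplex = 0 := by
        by_cases hv : D.HasLeft v.1
        · obtain ⟨b, hb⟩ := hv
          rw [residue_of_horizontal hb, complexify_smul, complexify_sub, expCombination_smul,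
            expCombination_sub, hsum _ v.2, hsum _ (mem_whites_of_mem_boxes hb.2.1), sub_self,
            mul_zero]
        · rw [residue_of_not hv]
          simp [expCombination, complexify]
      rw [wave_white, hres, poleFunction_zero, hsum _ v.2]
  on_base ζ t := rfl
  heat x hx hδ := by
    obtain ⟨c, hc⟩ := exists_wave_eq_expCombination (κ := κ) (t₀ := t₀) (a := a) hx hδ
    exact ⟨_, hc, solvesHeatHierarchy_expCombination c⟩
  real p hp t := by
    have hreal : ∀ u : Fin n → ℝ, ∃ x : ℝ, expCombination κ t₀ (complexify u) t.toComplex = x :=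
      fun u => expCombination_toComplex u t
    obtain ⟨c, y⟩ := p
    cases c with
    | base =>
      rcases realPoint_cases (D := D) (.base, y) with hy | ⟨x, hy⟩
      · simp only at hy
        subst hy
        exact absurd rfl hp
      · simp only at hy
        subst hy
        refine ⟨((Real.exp (realTheta x t - realTheta x t₀) : ℝ) : WithTop ℝ), ?_⟩
        rw [toSphere_coe]
        change _ = D.wave κ t₀ a γ (.base, ((x : ℂ) : OnePoint ℂ)) t.toComplex
        rw [wave_base, theta_sub, theta_toComplex, theta_toComplex]
        push_cast
        rfl
    | black b =>
      obtain ⟨x, hx⟩ := hreal (a b.1)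
      refine ⟨(x : WithTop ℝ), ?_⟩
      rw [RealPoint.toPoint, wave_black, hx, toSphere_coe]
    | white v =>
      obtain ⟨x, hx⟩ := hreal (a v.1)
      obtain ⟨d, hd⟩ := hreal (D.residue a γ v.1)
      rw [RealPoint.toPoint, wave_white, hx, hd]
      rcases realPoint_cases (D := D) (.white v, y) with hy | ⟨y, hy⟩ <;> simp only at hy <;> subst hy
      · exact ⟨(x : WithTop ℝ), rfl⟩
      · rw [toSphere_coe]
        by_cases hyγ : y = γ v.1
        · by_cases hd0 : (d : ℂ) = 0
          · rw [hd0, poleFunction_zero]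
            exact ⟨(x : WithTop ℝ), rfl⟩
          · rw [hyγ, poleFunction_self hd0]
            exact ⟨⊤, rfl⟩
        · rw [poleFunction_of_ne (by exact_mod_cast hyγ)]
          refine ⟨((x + d / (y - γ v.1) : ℝ) : WithTop ℝ), ?_⟩
          rw [toSphere_coe]
          push_cast
          rfl
  glued p q hpq t := by
    cases hpq with
    | horizontal v b hb =>
      simp only [RealPoint.toPoint, toSphere_coe, wave_black, Complex.ofReal_zero]
      exact h.wave_zero hb t
    | middle v b e =>
      simp only [RealPoint.toPoint, wave_black]
      rw [← e]
      exact wave_white_infty v t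
    | vertical v b hb =>
      simp only [RealPoint.toPoint, toSphere_coe, wave_black, Complex.ofReal_one]
      rw [h.wave_one, below_of_vertical hb]
    | boundary v hb =>
      simp only [RealPoint.toPoint, toSphere_coe, Complex.ofReal_one]
      rw [h.wave_one, below_of_toBoundary hb, wave_base, complexify_single, expCombination_single]
  meromorphic c hc t := by
    cases c with
    | base => exact absurd rfl hc
    | black b =>
      simp only [wave_black]
      exact isMeromorphicWithPoles_const _
    | white v =>
      by_cases hv : D.HasLeft v.1
      · simp only [wave_white]
        refine isMeromorphicWithPoles_poleFunction _ _ _ (divisor_whitePoint hv) fun z hz => ?_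
        refine divisor_eq_zero fun v' _ e => hz ?_
        have h1 : Component.white v = Component.white v' := congrArg Prod.fst e
        have h2 : z = _ := congrArg Prod.snd e
        rw [Component.white.injEq] at h1
        rw [h2, ← h1]
        rfl
      · simp only [wave_white_of_not v hv]
        exact isMeromorphicWithPoles_const _
  regular x hx hδ := by
    by_cases hb : x.1 = .base
    · obtain ⟨c, z⟩ := x
      simp only at hb
      subst hb
      induction z using OnePoint.rec with
      | infty => exact absurd rfl hx
      | coe ζ => exact ⟨_, fun t => rfl, isEntire_exp_theta ζ⟩
    · obtain ⟨c, hc⟩ := exists_wave_eq_expCombination (κ := κ) (t₀ := t₀) (a := a) hb hδ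
      exact ⟨_, hc, isEntire_expCombination c⟩

/-- In the column of `v` the coefficient of `a v` is nonzero while that of its left neighbour
vanishes. -/
theorem IsVacuumNetwork.residue_ne_zero (h : D.IsVacuumNetwork a γ) {v : Fin k × Fin n}
    (hv : D.HasLeft v) : D.residue a γ v ≠ 0 := fun h0 => by
  have hγ := h.gamma_ne_zero hv
  obtain ⟨b, hb⟩ := hv
  have h1 := congrFun h0 v.2
  rw [residue_of_horizontal hb, Pi.smul_apply, Pi.sub_apply,
    h.before b (mem_whites_of_mem_boxes hb.2.1) v.2 hb.2.2.2.1, sub_zero, smul_eq_mul] at h1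
  exact mul_ne_zero hγ (h.lead v hb.1) h1

theorem IsVacuumNetwork.exists_wave_eq_infty (h : D.IsVacuumNetwork a γ)
    (hκ : Function.Injective κ) {x : D.Point} (hx : D.divisor γ x ≠ 0) :
    ∃ t : RealTimes, D.wave κ t₀ a γ x t.toComplex = OnePoint.infty := by
  obtain ⟨v, hv, rfl⟩ := divisor_ne_zero hx
  by_contra! hne
  refine h.residue_ne_zero hv ?_
  have h0 : complexify (D.residue a γ v.1) = 0 :=
    eq_zero_of_expCombination_eq_zero (t₀ := t₀) hκ fun t => by
      by_contra hd
      exact hne t (by rw [whitePoint, wave_white, poleFunction_self hd])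
  ext j
  simpa [complexify] using congrFun h0 j

/-- White components meet `Γ₀` only at coordinate 1, whereas the coordinates of the divisor points
are less than 1. -/
theorem IsVacuumNetwork.not_onBase (h : D.IsVacuumNetwork a γ) {x : D.Point}
    (hx : D.divisor γ x ≠ 0) : ¬ D.OnBase κ x := by
  obtain ⟨v, hv, rfl⟩ := divisor_ne_zero hx
  rintro (hb | ⟨p, q, hp, hpq | hpq, hq⟩)
  · simp [whitePoint] at hb
  · cases hpq with
    | horizontal v b hb => simp at hq
    | middle v b e => simp at hq
    | vertical v b hb => simp at hq
    | boundary v' hb =>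
      simp only [whitePoint, RealPoint.toPoint, toSphere_coe, Prod.mk.injEq,
        Component.white.injEq] at hp
      have := OnePoint.coe_injective hp.2
      exact (h.gamma_lt_one hv).ne (by exact_mod_cast this)
  · cases hpq <;> simp at hq

end LeDiagram
end KPSoliton

/-! ### Uniqueness of the divisor and of the wave function. -/

namespace KPSoliton

/-- A family of functions with at most one simple pole, at a point independent of the parameter, and
with finite values `c`, `u`, `l` at `∞`, `1`, `0`. -/
theorem IsMeromorphicWithPoles.cases_of_simple_pole {T : Type*} {f : T → OnePoint ℂ → OnePoint ℂ}
    {m : OnePoint ℂ → ℕ} (hf : ∀ t, IsMeromorphicWithPoles (f t) m) {p : OnePoint ℂ} (hp : m p = 1)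
    (hm : ∀ z, z ≠ p → m z = 0) {c u l : T → ℂ}
    (hc : ∀ t, f t OnePoint.infty = (c t : OnePoint ℂ))
    (hu : ∀ t, f t ((1 : ℂ) : OnePoint ℂ) = (u t : OnePoint ℂ))
    (hl : ∀ t, f t ((0 : ℂ) : OnePoint ℂ) = (l t : OnePoint ℂ)) :
    (∀ t, c t = u t ∧ c t = l t) ∨ ∃ g : ℂ, p = (g : OnePoint ℂ) ∧ g ≠ 0 ∧ g ≠ 1 ∧
      ∀ t, c t = (1 - g) * u t + g * l t ∧
        ∀ z, f t z = poleFunction (c t) (g * (c t - l t)) g z := by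
  induction p using OnePoint.rec with
  | infty =>
    left
    intro t
    have h := (hf t).eq_const (fun z => hm z (OnePoint.coe_ne_infty z)) (hc t)
    exact ⟨OnePoint.coe_injective ((h _).symm.trans (hu t)),
      OnePoint.coe_injective ((h _).symm.trans (hl t))⟩
  | coe g =>
    have hd : ∀ t, ∃ d : ℂ, f t = poleFunction (c t) d g := fun t => by
      obtain ⟨d, hd⟩ := (hf t).exists_eq_add_div
        (fun z hz => hm z fun e => hz (OnePoint.coe_injective e)) hp.le (hc t)
      exact ⟨d, eq_of_forall_ne (hf t).1 (isMeromorphicWithPoles_poleFunction _ _ _ hp hm).1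
        fun z hz => by rw [hd z hz, poleFunction_of_ne hz]⟩
    -- A divisor point at 0 or 1 cannot be an actual pole, since the value there is finite; the
    -- function is then constant.
    by_cases hg : g = 0 ∨ g = 1
    · left
      intro t
      obtain ⟨d, hd⟩ := hd t
      have hd0 : d = 0 := by
        by_contra hne
        have h1 := poleFunction_self (c := c t) (γ := g) hne
        rw [← hd] at h1
        rcases hg with rfl | rfl
        · rw [hl] at h1
          exact OnePoint.coe_ne_infty _ h1
        · rw [hu] at h1
          exact OnePoint.coe_ne_infty _ h1
      rw [hd0, poleFunction_zero] at hd
      have h1 := hu t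
      have h0 := hl t
      rw [hd] at h1 h0
      exact ⟨OnePoint.coe_injective h1, OnePoint.coe_injective h0⟩
    · right
      push Not at hg
      refine ⟨g, rfl, hg.1, hg.2, fun t => ?_⟩
      obtain ⟨d, hd⟩ := hd t
      have h1 := hu t
      have h0 := hl t
      rw [hd, poleFunction_of_ne hg.2.symm] at h1
      rw [hd, poleFunction_of_ne hg.1.symm] at h0
      have h1 := OnePoint.coe_injective h1
      have h0 := OnePoint.coe_injective h0
      have hg0 := hg.1
      have hg1 : (1 : ℂ) - g ≠ 0 := sub_ne_zero.2 hg.2.symm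
      have hd' : d = g * (c t - l t) := by
        rw [zero_sub, div_neg] at h0
        rw [← h0]
        field_simp
        ring
      refine ⟨?_, fun z => by rw [hd, hd']⟩
      rw [← h1, hd']
      field_simp
      ring

namespace LeDiagram

variable {k n : ℕ} {D : LeDiagram k n} {a : Fin k × Fin n → Fin n → ℝ} {γ : Fin k × Fin n → ℝ}
  {κ : Fin n → ℝ} {t₀ : RealTimes} {δ : D.Point →₀ ℕ} {ψ : D.Point → Times → OnePoint ℂ}

theorem exists_of_degreeOn_eq_one {S : Set D.Point} (h : degreeOn δ S = 1) :
    ∃ x ∈ S, δ x = 1 ∧ ∀ y ∈ S, y ≠ x → δ y = 0 := by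
  classical
  rw [degreeOn] at h
  obtain ⟨x, hx, hx0⟩ := Finset.exists_ne_zero_of_sum_ne_zero (h.trans_ne one_ne_zero)
  have h1 := Finset.add_sum_erase _ (fun x => δ x) hx
  rw [h] at h1
  refine ⟨x, (Finset.mem_filter.1 hx).2, by omega, fun y hy hyx => ?_⟩
  have h2 : ∑ y ∈ (δ.support.filter fun p => p ∈ S).erase x, δ y = 0 := by omega
  by_contra hne
  exact hne (Finset.sum_eq_zero_iff.1 h2 y (Finset.mem_erase.2 ⟨hyx, Finset.mem_filter.2
    ⟨Finsupp.mem_support_iff.2 hne, hy⟩⟩))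

/-- The components with a horizontal edge to the left carry one point each, and their number is the
degree. Nothing remains for other points. -/
theorem IsRealRegularDivisor.eq_zero (hδ : D.IsRealRegularDivisor κ δ) {x : D.Point}
    (hx : ∀ v : {v // v ∈ D.whites}, D.HasLeft v.1 → x.1 ≠ .white v) : δ x = 0 := by
  classical
  by_contra hne
  let T : Finset D.Point := (Finset.univ.filter fun v : {v // v ∈ D.whites} =>
    D.HasLeft v.1).biUnion fun v => δ.support.filter fun y => y ∈ {y : D.Point | y.1 = .white v}
  have hT : ∑ y ∈ T, δ y = D.dim := by
    rw [Finset.sum_biUnion, ← card_hasLeft, Finset.card_eq_sum_ones]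
    · exact Finset.sum_congr rfl fun v hv => hδ.one_point v (Finset.mem_filter.1 hv).2
    · intro v _ v' _ hvv'
      rw [Function.onFun, Finset.disjoint_left]
      intro y hy hy'
      have h1 : y.1 = .white v := (Finset.mem_filter.1 hy).2
      have h2 : y.1 = .white v' := (Finset.mem_filter.1 hy').2
      rw [h1, Component.white.injEq] at h2
      exact hvv' h2
  have hsub : T ⊆ δ.support.erase x := by
    intro y hy
    obtain ⟨v, hv, hy⟩ := Finset.mem_biUnion.1 hy
    refine Finset.mem_erase.2 ⟨?_, (Finset.mem_filter.1 hy).1⟩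
    rintro rfl
    exact hx v (Finset.mem_filter.1 hv).2 (Finset.mem_filter.1 hy).2
  have h1 : ∑ y ∈ T, δ y ≤ ∑ y ∈ δ.support.erase x, δ y :=
    Finset.sum_le_sum_of_subset hsub
  have h2 := Finset.add_sum_erase _ (fun x => δ x) (Finsupp.mem_support_iff.2 hne)
  have h3 : ∑ y ∈ δ.support, δ y = D.dim := by
    rw [← hδ.degree_eq, degreeOn]
    refine Finset.sum_congr ?_ fun _ _ => rfl
    simp
  omega

theorem toSphere_one : toSphere ((1 : ℝ) : WithTop ℝ) = ((1 : ℂ) : OnePoint ℂ) := by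
  rw [toSphere_coe, Complex.ofReal_one]

theorem toSphere_zero : toSphere ((0 : ℝ) : WithTop ℝ) = ((0 : ℂ) : OnePoint ℂ) := by
  rw [toSphere_coe, Complex.ofReal_zero]

theorem IsVacuumWaveFunction.exists_black (hψ : D.IsVacuumWaveFunction κ t₀ δ ψ)
    (hδ : D.IsRealRegularDivisor κ δ) (b : {b // b ∈ D.boxes}) :
    ∃ F : Times → ℂ, ∀ z t, ψ (.black b, z) t = (F t : OnePoint ℂ) := by
  have h0 : ∀ z, δ (.black b, z) = 0 := fun z => hδ.eq_zero fun v _ => by simp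
  obtain ⟨F, hF, -⟩ := hψ.regular (.black b, OnePoint.infty) (by simp [P0]) (h0 _)
  exact ⟨F, fun z t => (hψ.meromorphic (.black b) (by simp) t).eq_const (fun z => h0 z) (hF t) z⟩

/-- A wave function with the prescribed Darboux values has the divisor and the values determined by the
network. -/
theorem IsVacuumNetwork.unique (h : D.IsVacuumNetwork a γ) (hκ : Function.Injective κ)
    (hδ : D.IsRealRegularDivisor κ δ) (hψ : D.IsVacuumWaveFunction κ t₀ δ ψ)
    (hdar : ∀ r t, ψ (D.darboux r) t =
      ((expCombination κ t₀ (complexify (a (r, D.pivot r))) t : ℂ) : OnePoint ℂ)) :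
    δ = D.divisor γ ∧ ∀ x, x ≠ D.P0 → ψ x = D.wave κ t₀ a γ x := by
  classical
  choose F hF using fun b => hψ.exists_black hδ b
  -- values at the marked points
  have htop : ∀ (v : Fin k × Fin n) (hv : v ∈ D.boxes) t,
      ψ (.white ⟨v, mem_whites_of_mem_boxes hv⟩, OnePoint.infty) t = (F ⟨v, hv⟩ t : OnePoint ℂ) :=
    fun v hv t => (hψ.glued _ _ (Glued.middle ⟨v, mem_whites_of_mem_boxes hv⟩ ⟨v, hv⟩ rfl) t).trans
      (hF ⟨v, hv⟩ _ t)
  have hzero : ∀ (v : {v // v ∈ D.whites}) b (hb : D.Horizontal v.1 b) t,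
      ψ (.white v, ((0 : ℂ) : OnePoint ℂ)) t = (F ⟨b, hb.2.1⟩ t : OnePoint ℂ) := fun v b hb t => by
    have := (hψ.glued _ _ (Glued.horizontal v ⟨b, hb.2.1⟩ hb) t).trans (hF ⟨b, hb.2.1⟩ _ t)
    rwa [RealPoint.toPoint, toSphere_zero] at this
  have hone : ∀ (v : {v // v ∈ D.whites}) b (hb : D.Vertical v.1 b) t,
      ψ (.white v, ((1 : ℂ) : OnePoint ℂ)) t = (F ⟨b, hb.2.1⟩ t : OnePoint ℂ) := fun v b hb t => by
    have := (hψ.glued _ _ (Glued.vertical v ⟨b, hb.2.1⟩ hb) t).trans (hF ⟨b, hb.2.1⟩ _ t)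
    rwa [RealPoint.toPoint, toSphere_one] at this
  have hbd : ∀ (v : {v // v ∈ D.whites}) (_ : D.ToBoundary v.1) t,
      ψ (.white v, ((1 : ℂ) : OnePoint ℂ)) t =
        ((expCombination κ t₀ (Pi.single v.1.2 1) t : ℂ) : OnePoint ℂ) := fun v hb t => by
    have := hψ.glued _ _ (Glued.boundary v hb) t
    rw [RealPoint.toPoint, toSphere_one, RealPoint.toPoint, toSphere_coe, hψ.on_base] at this
    rw [expCombination_single, this]
  -- components without a divisor point
  have hconst : ∀ (v : {v // v ∈ D.whites}), ¬ D.HasLeft v.1 → ∀ (c : Times → ℂ) t,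
      ψ (.white v, OnePoint.infty) t = (c t : OnePoint ℂ) → ∀ z, ψ (.white v, z) t = c t := by
    intro v hv c t hc
    exact (hψ.meromorphic (.white v) (by simp) t).eq_const (fun z => hδ.eq_zero fun v' hv' e => by
      rw [Component.white.injEq] at e
      exact hv (e ▸ hv')) hc
  -- components with a divisor point
  have hpole : ∀ (v : {v // v ∈ D.whites}) b (hb : D.Horizontal v.1 b) (c u : Times → ℂ),
      (∀ t, ψ (.white v, OnePoint.infty) t = (c t : OnePoint ℂ)) →
      (∀ t, ψ (.white v, ((1 : ℂ) : OnePoint ℂ)) t = (u t : OnePoint ℂ)) →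
      (∀ t, c t = u t ∧ c t = F ⟨b, hb.2.1⟩ t) ∨ ∃ g : ℂ, g ≠ 0 ∧ g ≠ 1 ∧
        (δ (.white v, (g : OnePoint ℂ)) = 1) ∧
        (∀ z, z ≠ (g : OnePoint ℂ) → δ (.white v, z) = 0) ∧
        ∀ t, c t = (1 - g) * u t + g * F ⟨b, hb.2.1⟩ t ∧ ∀ z, ψ (.white v, z) t =
          poleFunction (c t) (g * (c t - F ⟨b, hb.2.1⟩ t)) g z := by
    intro v b hb c u hc hu
    obtain ⟨⟨c', p⟩, hx, hx1, hx0⟩ := exists_of_degreeOn_eq_one (hδ.one_point v ⟨b, hb⟩)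
    simp only [Set.mem_ofPred_eq] at hx
    subst hx
    have hm0 : ∀ z, z ≠ p → δ (.white v, z) = 0 := fun z hz =>
      hx0 (.white v, z) rfl fun e => hz (congrArg Prod.snd e)
    rcases IsMeromorphicWithPoles.cases_of_simple_pole (f := fun t z => ψ (.white v, z) t)
      (m := fun z => δ (.white v, z)) (fun t => hψ.meromorphic (.white v) (by simp) t) hx1 hm0 hc hu
      (hzero v b hb) with h1 | ⟨g, rfl, hg0, hg1, h1⟩
    · exact Or.inl h1
    · exact Or.inr ⟨g, hg0, hg1, hx1, hm0, h1⟩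
  -- triangularity
  have htri : ∀ m : ℕ, ∀ v (hv : v ∈ D.boxes), k + n - (v.1 + v.2) ≤ m → ∃ c : Fin n → ℂ,
      (∀ t, F ⟨v, hv⟩ t = expCombination κ t₀ c t) ∧ ∀ l, l < v.2 → c l = 0 := by
    intro m
    induction m with
    | zero =>
      intro v hv hm
      have := v.1.2
      have := v.2.2
      omega
    | succ m ih =>
      intro v hv hm
      have hrow := v.1.2
      have hcol := v.2.2
      have hvw := mem_whites_of_mem_boxes hv
      obtain ⟨d, hd, hd0⟩ : ∃ d : Fin n → ℂ,
          (∀ t, ψ (.white ⟨v, hvw⟩, ((1 : ℂ) : OnePoint ℂ)) t =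
            ((expCombination κ t₀ d t : ℂ) : OnePoint ℂ)) ∧ ∀ l, l < v.2 → d l = 0 := by
        rcases exists_vertical_or_toBoundary hvw with ⟨b, hb⟩ | hb
        · obtain ⟨d, hd, hd0⟩ := ih b hb.2.1 (by
            rw [hb.2.2.1]
            have := Fin.lt_def.1 hb.2.2.2.1
            omega)
          refine ⟨d, fun t => ?_, hb.2.2.1 ▸ hd0⟩
          rw [← hd t]
          exact hone ⟨v, hvw⟩ b hb t
        · exact ⟨_, hbd ⟨v, hvw⟩ hb, fun l hl => by simp [hl.ne]⟩
      by_cases hleft : D.HasLeft v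
      · obtain ⟨b, hb⟩ := hleft
        rcases hpole ⟨v, hvw⟩ b hb _ _ (htop v hv) hd with h1 | ⟨g, -, -, -, -, h1⟩
        · exact ⟨d, fun t => (h1 t).1, hd0⟩
        · obtain ⟨c, hc, hc0⟩ := ih b hb.2.1 (by
            rw [hb.2.2.1]
            have := Fin.lt_def.1 hb.2.2.2.1
            omega)
          refine ⟨(1 - g) • d + g • c, fun t => ?_, fun l hl => ?_⟩
          · rw [(h1 t).1, hc, expCombination_add, expCombination_smul, expCombination_smul]
          · simp [hd0 l hl, hc0 l (hl.trans hb.2.2.2.1)]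
      · refine ⟨d, fun t => ?_, hd0⟩
        have := hconst ⟨v, hvw⟩ hleft (F ⟨v, hv⟩) t (htop v hv t) ((1 : ℂ) : OnePoint ℂ)
        rw [hd] at this
        exact (OnePoint.coe_injective this).symm
  -- propagation along a horizontal edge
  have hstep : ∀ (v : {v // v ∈ D.whites}) b (hb : D.Horizontal v.1 b),
      (∀ t, ψ (.white v, OnePoint.infty) t =
        ((expCombination κ t₀ (complexify (a v.1)) t : ℂ) : OnePoint ℂ)) →
      (∀ t, ψ (.white v, ((1 : ℂ) : OnePoint ℂ)) t =
        ((expCombination κ t₀ (complexify (D.below a v.1)) t : ℂ) : OnePoint ℂ)) →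
      (∀ t, F ⟨b, hb.2.1⟩ t = expCombination κ t₀ (complexify (a b)) t) ∧
        (∀ z, δ (.white v, z) = D.divisor γ (.white v, z)) ∧
        ∀ z t, ψ (.white v, z) t = D.wave κ t₀ a γ (.white v, z) t := by
    intro v b hb hc hu
    -- Triangularity is all that is known at this stage about the value at the left neighbour: it
    -- has no coefficient in the column of `v`.
    obtain ⟨c, hcF, hc0⟩ := htri _ b hb.2.1 le_rfl
    have hstep := h.step v.1 b hb
    have hγ0 := h.gamma_ne_zero ⟨b, hb⟩
    have hab := h.before b (mem_whites_of_mem_boxes hb.2.1) v.1.2 hb.2.2.2.1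
    have hlead := h.lead v.1 v.2
    have hcol := congrFun hstep v.1.2
    simp only [Pi.add_apply, Pi.smul_apply, smul_eq_mul, hab, mul_zero, add_zero] at hcol
    have hbelow : D.below a v.1 v.1.2 ≠ 0 := fun h0 => by
      rw [h0, mul_zero] at hcol
      exact hlead hcol
    -- If the function were constant, `a v` would equal the contribution from below, against `γ v ≠
    -- 0` in the column of `v`. Otherwise the coefficient in this column gives `g = γ v`, and
    -- cancelling the vertical contribution gives the value at `b`.
    rcases hpole v b hb _ _ hc hu with h1 | ⟨g, hg0, hg1, hδ1, hδ0, h1⟩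
    · have h2 := expCombination_injective hκ fun t => (h1 t.toComplex).1
      have h3 := congrFun h2 v.1.2
      simp only [complexify, Complex.ofReal_inj] at h3
      rw [h3] at hcol
      have h4 : γ v.1 * D.below a v.1 v.1.2 = 0 := by linarith
      exact absurd h4 (mul_ne_zero hγ0 hbelow)
    · have h2 : complexify (a v.1) = (1 - g) • complexify (D.below a v.1) + g • c :=
        expCombination_injective (t₀ := t₀) hκ fun t => by
          rw [(h1 _).1, hcF, expCombination_add, expCombination_smul, expCombination_smul]
      have h3 := congrFun h2 v.1.2
      simp only [complexify, Pi.add_apply, Pi.smul_apply, smul_eq_mul, hc0 _ hb.2.2.2.1, mul_zero,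
        add_zero, hcol] at h3
      have hgγ : g = γ v.1 := by
        push_cast at h3
        have := mul_right_cancel₀ (by exact_mod_cast hbelow) h3
        linear_combination this
      have hca : c = complexify (a b) := by
        rw [hstep, complexify_add, complexify_smul, complexify_smul, ← hgγ] at h2
        push_cast at h2
        rw [← hgγ] at h2
        have h4 := add_left_cancel h2
        exact (smul_right_injective _ hg0 h4).symm
      refine ⟨fun t => by rw [hcF, hca], fun z => ?_, fun z t => ?_⟩
      · by_cases hz : z = (g : OnePoint ℂ)
        · rw [hz, hδ1, hgγ]
          exact (divisor_whitePoint ⟨b, hb⟩).symm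
        · rw [hδ0 z hz, divisor_eq_zero]
          intro v' _ e
          refine hz ?_
          have e1 : Component.white v = Component.white v' := congrArg Prod.fst e
          have e2 : z = (D.whitePoint γ v').2 := congrArg Prod.snd e
          rw [Component.white.injEq] at e1
          rw [e2, ← e1, hgγ]
          rfl
      · rw [(h1 t).2 z, wave_white, residue_of_horizontal hb, complexify_smul, complexify_sub,
          expCombination_smul, expCombination_sub, hcF, hca, hgγ]
  -- induction over the rows from the bottom, and in each row from the pivot to the left
  have hdown : ∀ v : {v // v ∈ D.whites}, (∀ b (hb : b ∈ D.boxes), v.1.1 < b.1 →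
      ∀ t, F ⟨b, hb⟩ t = expCombination κ t₀ (complexify (a b)) t) → ∀ t,
      ψ (.white v, ((1 : ℂ) : OnePoint ℂ)) t =
        ((expCombination κ t₀ (complexify (D.below a v.1)) t : ℂ) : OnePoint ℂ) := by
    intro v hlow t
    rcases exists_vertical_or_toBoundary v.2 with ⟨b, hb⟩ | hb
    · rw [below_of_vertical hb, ← hlow b hb.2.1 hb.2.2.2.1]
      exact hone v b hb t
    · rw [below_of_toBoundary hb, complexify_single]
      exact hbd v hb t
  have hrows : ∀ N : ℕ, ∀ b (hb : b ∈ D.boxes), k - b.1 ≤ N →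
      ∀ t, F ⟨b, hb⟩ t = expCombination κ t₀ (complexify (a b)) t := by
    intro N
    induction N with
    | zero =>
      intro b hb hN
      have := b.1.2
      omega
    | succ N ih =>
      have hcols : ∀ M : ℕ, ∀ b (hb : b ∈ D.boxes), k - b.1 ≤ N + 1 → (b.2 : ℕ) ≤ M →
          ∀ t, F ⟨b, hb⟩ t = expCombination κ t₀ (complexify (a b)) t := by
        intro M
        induction M with
        | zero =>
          intro b hb _ hM
          have := Fin.lt_def.1 (pivot_lt_col hb)
          omega
        | succ M ihM =>
          intro b hb hN hM
          obtain ⟨v, hv⟩ := exists_horizontal_right hb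
          have hv1 : (v.1 : ℕ) = b.1 := by rw [hv.2.2.1]
          have hv2 := Fin.lt_def.1 hv.2.2.2.1
          refine (hstep ⟨v, hv.1⟩ b hv (fun t => ?_) (hdown ⟨v, hv.1⟩ fun b' hb' hlt => ?_)).1
          · by_cases hvb : v ∈ D.boxes
            · rw [htop v hvb, ihM v hvb (by omega) (by omega)]
            · have e := eq_pivot_of_not_mem_boxes hv.1 hvb
              have h1 := hdar v.1 t
              rw [← e] at h1
              rw [← h1]
              congr 3
              exact Subtype.ext e
          · have := Fin.lt_def.1 hlt
            simp only at this
            exact ih b' hb' (by omega)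
      exact fun b hb hN => hcols _ b hb hN le_rfl
  have hblack : ∀ b (hb : b ∈ D.boxes) t,
      F ⟨b, hb⟩ t = expCombination κ t₀ (complexify (a b)) t := fun b hb => hrows _ b hb le_rfl
  have hinf : ∀ (v : {v // v ∈ D.whites}) t, ψ (.white v, OnePoint.infty) t =
      ((expCombination κ t₀ (complexify (a v.1)) t : ℂ) : OnePoint ℂ) := by
    intro v t
    by_cases hvb : v.1 ∈ D.boxes
    · rw [← hblack _ hvb]
      exact htop v.1 hvb t
    · have e := eq_pivot_of_not_mem_boxes v.2 hvb
      have h1 := hdar v.1.1 t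
      rw [← e] at h1
      rw [← h1]
      congr 3
      exact Subtype.ext e
  have hall := fun (v : {v // v ∈ D.whites}) b hb => hstep v b hb (hinf v)
    (hdown v fun b hb _ => hblack b hb)
  refine ⟨Finsupp.ext fun x => ?_, fun x hx => funext fun t => ?_⟩
  · by_cases hx : ∃ v : {v // v ∈ D.whites}, D.HasLeft v.1 ∧ x.1 = .white v
    · obtain ⟨v, ⟨b, hb⟩, hxv⟩ := hx
      have := (hall v b hb).2.1 x.2
      rwa [← hxv] at this
    · push Not at hx
      rw [hδ.eq_zero hx, divisor_eq_zero]
      rintro v hv rfl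
      exact hx v hv rfl
  · obtain ⟨c, z⟩ := x
    cases c with
    | base =>
      induction z using OnePoint.rec with
      | infty => exact absurd rfl hx
      | coe ζ => rw [hψ.on_base, wave_base]
    | black b => rw [hF, hblack, wave_black]
    | white v =>
      by_cases hv : D.HasLeft v.1
      · obtain ⟨b, hb⟩ := hv
        exact (hall v b hb).2.2 z t
      · rw [wave_white_of_not v hv]
        exact hconst v hv _ t (hinf v t) z

end LeDiagram
end KPSoliton

/-! ### Arcs and double points of the curve. -/

namespace KPSoliton

theorem toSphere_injective : Function.Injective toSphere := by
  intro x y h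
  cases x with
  | top =>
    cases y with
    | top => rfl
    | coe y => exact absurd h.symm (OnePoint.coe_ne_infty _)
  | coe x =>
    cases y with
    | top => exact absurd h (OnePoint.coe_ne_infty _)
    | coe y =>
      have h1 : (x : ℂ) = (y : ℂ) := OnePoint.coe_injective h
      rw [Complex.ofReal_inj.1 h1]

theorem mem_openArc {a b x : WithTop ℝ} :
    x ∈ openArc a b ↔ (a < b ∧ a < x ∧ x < b) ∨ (¬ a < b ∧ (a < x ∨ x < b)) := by
  rw [openArc]
  split_ifs with h <;> simp [h]

namespace LeDiagram

variable {k n : ℕ} {D : LeDiagram k n} {κ : Fin n → ℝ}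

theorem RealPoint.toPoint_injective : Function.Injective (RealPoint.toPoint (D := D)) := by
  rintro ⟨c, x⟩ ⟨c', x'⟩ h
  have h1 : c = c' := congrArg Prod.fst h
  have h2 : toSphere x = toSphere x' := congrArg Prod.snd h
  rw [h1, toSphere_injective h2]

/-! ### Arcs -/

/-- Neither end can lie on the open arc towards the other, because ends are double points; the rest
is cyclic order. -/
theorem IsArc.end_unique {c : D.Component} {a b b' : WithTop ℝ} (h : D.IsArc κ c a b)
    (h' : D.IsArc κ c a b') : b = b' := by
  have h1 : b' ∉ openArc a b := fun hb => h.2.2 _ hb h'.2.1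
  have h2 : b ∉ openArc a b' := fun hb => h'.2.2 _ hb h.2.1
  rw [mem_openArc] at h1 h2
  grind

theorem IsArc.start_unique {c : D.Component} {a a' b : WithTop ℝ} (h : D.IsArc κ c a b)
    (h' : D.IsArc κ c a' b) : a = a' := by
  have h1 : a' ∉ openArc a b := fun hb => h.2.2 _ hb h'.1
  have h2 : a ∉ openArc a' b := fun hb => h'.2.2 _ hb h.1
  rw [mem_openArc] at h1 h2
  grind

theorem IsArc.eq_of_mem {c : D.Component} {a a' b b' x : WithTop ℝ} (h : D.IsArc κ c a b)
    (h' : D.IsArc κ c a' b') (hx : x ∈ openArc a b) (hx' : x ∈ openArc a' b') : a = a' := by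
  have h1 : a' ∉ openArc a b := fun hb => h.2.2 _ hb h'.1
  have h2 : a ∉ openArc a' b' := fun hb => h'.2.2 _ hb h.1
  rw [mem_openArc] at h1 h2 hx hx'
  grind

theorem isDouble_white {v : {v // v ∈ D.whites}} {x : WithTop ℝ} : D.IsDouble κ (.white v, x) ↔
    (x = ((0 : ℝ) : WithTop ℝ) ∧ D.HasLeft v.1) ∨ x = ((1 : ℝ) : WithTop ℝ) ∨
      (x = ⊤ ∧ v.1 ∈ D.boxes) := by
  constructor
  · rintro ⟨q, hq | hq⟩
    · cases hq with
      | horizontal _ b h => exact Or.inl ⟨rfl, b.1, h⟩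
      | middle _ b h => exact Or.inr (Or.inr ⟨rfl, h ▸ b.2⟩)
      | vertical _ b h => exact Or.inr (Or.inl rfl)
      | boundary _ h => exact Or.inr (Or.inl rfl)
    · cases hq
  · rintro (⟨rfl, b, h⟩ | rfl | ⟨rfl, h⟩)
    · exact ⟨_, Or.inl (.horizontal v ⟨b, h.2.1⟩ h)⟩
    · rcases exists_vertical_or_toBoundary v.2 with ⟨b, h⟩ | h
      · exact ⟨_, Or.inl (.vertical v ⟨b, h.2.1⟩ h)⟩
      · exact ⟨_, Or.inl (.boundary v h)⟩
    · exact ⟨_, Or.inl (.middle v ⟨v.1, h⟩ rfl)⟩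

theorem isDouble_black {b : {b // b ∈ D.boxes}} {x : WithTop ℝ} : D.IsDouble κ (.black b, x) ↔
    x = ((0 : ℝ) : WithTop ℝ) ∨ x = ((1 : ℝ) : WithTop ℝ) ∨ (x = ⊤ ∧ ∃ v, D.Vertical v b.1) := by
  constructor
  · rintro ⟨q, hq | hq⟩
    · cases hq
    · cases hq with
      | horizontal v _ h => exact Or.inr (Or.inl rfl)
      | middle v _ h => exact Or.inl rfl
      | vertical v _ h => exact Or.inr (Or.inr ⟨rfl, _, h⟩)
  · rintro (rfl | rfl | ⟨rfl, v, h⟩)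
    · exact ⟨_, Or.inr (.middle ⟨b.1, mem_whites_of_mem_boxes b.2⟩ b rfl)⟩
    · obtain ⟨v, h⟩ := exists_horizontal_right b.2
      exact ⟨_, Or.inr (.horizontal ⟨v, h.1⟩ b h)⟩
    · exact ⟨_, Or.inr (.vertical ⟨v, h.1⟩ b h)⟩

/-- Every column with a white vertex has a lowest one, which is joined to the boundary. -/
theorem isDouble_base {x : WithTop ℝ} : D.IsDouble κ (.base, x) ↔
    ∃ v ∈ D.whites, x = ((κ v.2 : ℝ) : WithTop ℝ) := by
  constructor
  · rintro ⟨q, hq | hq⟩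
    · cases hq
    · cases hq with
      | boundary v h => exact ⟨v.1, v.2, rfl⟩
  · rintro ⟨v, hv, rfl⟩
    obtain ⟨u, hu, e, -⟩ := exists_toBoundary hv
    rw [← e]
    exact ⟨_, Or.inr (.boundary ⟨u, hu.1⟩ hu)⟩

section whiteArcs

variable {v : {v // v ∈ D.whites}}

theorem isArc_white_zero_one (h : D.HasLeft v.1) :
    D.IsArc κ (.white v) ((0 : ℝ) : WithTop ℝ) ((1 : ℝ) : WithTop ℝ) := by
  refine ⟨isDouble_white.2 (by simp [h]), isDouble_white.2 (by simp), fun x hx => ?_⟩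
  rw [isDouble_white]
  rw [mem_openArc] at hx
  rintro (⟨rfl, -⟩ | rfl | ⟨rfl, -⟩) <;> simp at hx

theorem isArc_white_one_top (h : v.1 ∈ D.boxes) :
    D.IsArc κ (.white v) ((1 : ℝ) : WithTop ℝ) ⊤ := by
  refine ⟨isDouble_white.2 (by simp), isDouble_white.2 (by simp [h]), fun x hx => ?_⟩
  rw [isDouble_white]
  rw [mem_openArc] at hx
  rintro (⟨rfl, -⟩ | rfl | ⟨rfl, -⟩) <;> simp at hx
  exact absurd hx (by norm_num)

theorem isArc_white_top_zero (h : v.1 ∈ D.boxes) (h' : D.HasLeft v.1) :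
    D.IsArc κ (.white v) ⊤ ((0 : ℝ) : WithTop ℝ) := by
  refine ⟨isDouble_white.2 (by simp [h]), isDouble_white.2 (by simp [h']), fun x hx => ?_⟩
  rw [isDouble_white]
  rw [mem_openArc] at hx
  rintro (⟨rfl, -⟩ | rfl | ⟨rfl, -⟩) <;> simp at hx
  exact absurd hx (by norm_num)

theorem isArc_white_top_one (h : v.1 ∈ D.boxes) (h' : ¬ D.HasLeft v.1) :
    D.IsArc κ (.white v) ⊤ ((1 : ℝ) : WithTop ℝ) := by
  refine ⟨isDouble_white.2 (by simp [h]), isDouble_white.2 (by simp), fun x hx => ?_⟩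
  rw [isDouble_white]
  rw [mem_openArc] at hx
  rintro (⟨-, hl⟩ | rfl | ⟨rfl, -⟩)
  · exact h' hl
  · simp at hx
  · simp at hx

theorem isArc_white_one_zero (h : v.1 ∉ D.boxes) (h' : D.HasLeft v.1) :
    D.IsArc κ (.white v) ((1 : ℝ) : WithTop ℝ) ((0 : ℝ) : WithTop ℝ) := by
  refine ⟨isDouble_white.2 (by simp), isDouble_white.2 (by simp [h']), fun x hx => ?_⟩
  rw [isDouble_white]
  rw [mem_openArc] at hx
  rintro (⟨rfl, -⟩ | rfl | ⟨-, hb⟩)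
  · simp at hx
    exact absurd hx (by norm_num)
  · simp at hx
    exact absurd hx (by norm_num)
  · exact h hb

theorem isArc_white_one_one (h : v.1 ∉ D.boxes) (h' : ¬ D.HasLeft v.1) :
    D.IsArc κ (.white v) ((1 : ℝ) : WithTop ℝ) ((1 : ℝ) : WithTop ℝ) := by
  refine ⟨isDouble_white.2 (by simp), isDouble_white.2 (by simp), fun x hx => ?_⟩
  rw [isDouble_white]
  rw [mem_openArc] at hx
  rintro (⟨-, hl⟩ | rfl | ⟨-, hb⟩)
  · exact h' hl
  · simp at hx
  · exact h hb

end whiteArcs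

section blackArcs

variable {b : {b // b ∈ D.boxes}}

theorem isArc_black_zero_one :
    D.IsArc κ (.black b) ((0 : ℝ) : WithTop ℝ) ((1 : ℝ) : WithTop ℝ) := by
  refine ⟨isDouble_black.2 (by simp), isDouble_black.2 (by simp), fun x hx => ?_⟩
  rw [isDouble_black]
  rw [mem_openArc] at hx
  rintro (rfl | rfl | ⟨rfl, -⟩) <;> simp at hx

theorem isArc_black_one_top (h : ∃ v, D.Vertical v b.1) :
    D.IsArc κ (.black b) ((1 : ℝ) : WithTop ℝ) ⊤ := by
  refine ⟨isDouble_black.2 (by simp), isDouble_black.2 (by simp [h]), fun x hx => ?_⟩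
  rw [isDouble_black]
  rw [mem_openArc] at hx
  rintro (rfl | rfl | ⟨rfl, -⟩) <;> simp at hx
  exact absurd hx (by norm_num)

theorem isArc_black_top_zero (h : ∃ v, D.Vertical v b.1) :
    D.IsArc κ (.black b) ⊤ ((0 : ℝ) : WithTop ℝ) := by
  refine ⟨isDouble_black.2 (by simp [h]), isDouble_black.2 (by simp), fun x hx => ?_⟩
  rw [isDouble_black]
  rw [mem_openArc] at hx
  rintro (rfl | rfl | ⟨rfl, -⟩) <;> simp at hx
  exact absurd hx (by norm_num)

theorem isArc_black_one_zero (h : ¬ ∃ v, D.Vertical v b.1) :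
    D.IsArc κ (.black b) ((1 : ℝ) : WithTop ℝ) ((0 : ℝ) : WithTop ℝ) := by
  refine ⟨isDouble_black.2 (by simp), isDouble_black.2 (by simp), fun x hx => ?_⟩
  rw [isDouble_black]
  rw [mem_openArc] at hx
  rintro (rfl | rfl | ⟨-, hv⟩)
  · simp at hx
    exact absurd hx (by norm_num)
  · simp at hx
    exact absurd hx (by norm_num)
  · exact h hv

end blackArcs

theorem isArc_base (hκ : StrictMono κ) {v w : Fin k × Fin n} (hv : v ∈ D.whites)
    (hw : w ∈ D.whites) (hvw : v.2 < w.2) (hmin : ∀ x ∈ D.whites, v.2 < x.2 → w.2 ≤ x.2) :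
    D.IsArc κ .base ((κ v.2 : ℝ) : WithTop ℝ) ((κ w.2 : ℝ) : WithTop ℝ) := by
  refine ⟨isDouble_base.2 ⟨v, hv, rfl⟩, isDouble_base.2 ⟨w, hw, rfl⟩, fun x hx => ?_⟩
  rw [isDouble_base]
  rw [mem_openArc] at hx
  rintro ⟨u, hu, rfl⟩
  simp only [WithTop.coe_lt_coe, hκ.lt_iff_lt] at hx
  rcases hx with hx | hx
  · exact (hmin u hu hx.2.1).not_gt hx.2.2
  · exact hx.1 hvw

/-- This arc runs from the largest marked point of `Γ₀` through ∞ to the smallest; it is the one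
that contains P₀. -/
theorem isArc_base_wrap (hκ : StrictMono κ) {v w : Fin k × Fin n} (hv : v ∈ D.whites)
    (hw : w ∈ D.whites) (hmax : ∀ x ∈ D.whites, x.2 ≤ v.2) (hmin : ∀ x ∈ D.whites, w.2 ≤ x.2) :
    D.IsArc κ .base ((κ v.2 : ℝ) : WithTop ℝ) ((κ w.2 : ℝ) : WithTop ℝ) := by
  refine ⟨isDouble_base.2 ⟨v, hv, rfl⟩, isDouble_base.2 ⟨w, hw, rfl⟩, fun x hx => ?_⟩
  rw [isDouble_base]
  rw [mem_openArc] at hx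
  rintro ⟨u, hu, rfl⟩
  simp only [WithTop.coe_lt_coe, hκ.lt_iff_lt] at hx
  have h1 := hmax u hu
  have h2 := hmin u hu
  grind

/-! ### Double points -/

/-- The possible positions of a double point: the marked points of the components. -/
inductive Mark (D : LeDiagram k n) : Type
  | zero (v : {v : Fin k × Fin n // v ∈ D.whites}) : Mark D
  | one (v : {v : Fin k × Fin n // v ∈ D.whites}) : Mark D
  | infty (v : {v : Fin k × Fin n // v ∈ D.whites}) : Mark D
  | blackZero (b : {b : Fin k × Fin n // b ∈ D.boxes}) : Mark D
  | blackOne (b : {b : Fin k × Fin n // b ∈ D.boxes}) : Mark D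
  | blackInfty (b : {b : Fin k × Fin n // b ∈ D.boxes}) : Mark D
  | base (j : Fin n) : Mark D

namespace Mark

instance : Finite D.Mark := by
  let W := {v : Fin k × Fin n // v ∈ D.whites}
  let B := {b : Fin k × Fin n // b ∈ D.boxes}
  let f : W ⊕ W ⊕ W ⊕ B ⊕ B ⊕ B ⊕ Fin n → D.Mark :=
    Sum.elim zero (Sum.elim one (Sum.elim infty (Sum.elim blackZero (Sum.elim blackOne
      (Sum.elim blackInfty base)))))
  refine Finite.of_surjective f fun p => ?_
  cases p with
  | zero v => exact ⟨.inl v, rfl⟩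
  | one v => exact ⟨.inr (.inl v), rfl⟩
  | infty v => exact ⟨.inr (.inr (.inl v)), rfl⟩
  | blackZero b => exact ⟨.inr (.inr (.inr (.inl b))), rfl⟩
  | blackOne b => exact ⟨.inr (.inr (.inr (.inr (.inl b)))), rfl⟩
  | blackInfty b => exact ⟨.inr (.inr (.inr (.inr (.inr (.inl b))))), rfl⟩
  | base j => exact ⟨.inr (.inr (.inr (.inr (.inr (.inr j))))), rfl⟩

/-- The point at a given position. -/
noncomputable def toReal (κ : Fin n → ℝ) : D.Mark → D.RealPoint
  | zero v => (.white v, ((0 : ℝ) : WithTop ℝ))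
  | one v => (.white v, ((1 : ℝ) : WithTop ℝ))
  | infty v => (.white v, ⊤)
  | blackZero b => (.black b, ((0 : ℝ) : WithTop ℝ))
  | blackOne b => (.black b, ((1 : ℝ) : WithTop ℝ))
  | blackInfty b => (.black b, ⊤)
  | base j => (.base, ((κ j : ℝ) : WithTop ℝ))

theorem toReal_injective (hκ : Function.Injective κ) :
    Function.Injective (toReal (D := D) κ) := by
  intro p q h
  cases p <;> cases q <;> simp [toReal] at h ⊢ <;> first | exact h | exact hκ h

/-- The pairs of glued marked points. -/
inductive Glue : D.Mark → D.Mark → Prop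
  | horizontal (v b) (h : D.Horizontal v.1 b.1) : Glue (zero v) (blackOne b)
  | middle (v b) (h : v.1 = b.1) : Glue (infty v) (blackZero b)
  | vertical (v b) (h : D.Vertical v.1 b.1) : Glue (one v) (blackInfty b)
  | boundary (v) (j) (h : D.ToBoundary v.1) (e : v.1.2 = j) : Glue (one v) (base j)

theorem exists_glue {p q : D.RealPoint} (h : D.Glued κ p q) :
    ∃ x y : D.Mark, Glue x y ∧ p = x.toReal κ ∧ q = y.toReal κ := by
  cases h with
  | horizontal v b h => exact ⟨_, _, .horizontal v b h, rfl, rfl⟩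
  | middle v b h => exact ⟨_, _, .middle v b h, rfl, rfl⟩
  | vertical v b h => exact ⟨_, _, .vertical v b h, rfl, rfl⟩
  | boundary v h => exact ⟨_, _, .boundary v _ h rfl, rfl, rfl⟩

theorem Glue.right_unique {x y y' : D.Mark} (h : Glue x y) (h' : Glue x y') : y = y' := by
  cases h with
  | horizontal v b h =>
    cases h' with | horizontal _ b' h' => rw [Subtype.ext (h.right_unique h')]
  | middle v b h => cases h' with | middle _ b' h' => rw [Subtype.ext (h.symm.trans h')]
  | vertical v b h =>
    cases h' with
    | vertical _ b' h' => rw [Subtype.ext (h.right_unique h')]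
    | boundary _ j h' e => exact absurd h' h.not_toBoundary
  | boundary v j h e =>
    cases h' with
    | vertical _ b' h' => exact absurd h h'.not_toBoundary
    | boundary _ j h' e' => rw [← e, e']

theorem Glue.left_unique {x x' y : D.Mark} (h : Glue x y) (h' : Glue x' y) : x = x' := by
  cases h with
  | horizontal v b h =>
    cases h' with | horizontal v' _ h' => rw [Subtype.ext (h.left_unique h')]
  | middle v b h => cases h' with | middle v' _ h' => rw [Subtype.ext (h.trans h'.symm)]
  | vertical v b h => cases h' with | vertical v' _ h' => rw [Subtype.ext (h.left_unique h')]
  | boundary v j h e =>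
    cases h' with | boundary v' _ h' e' => rw [Subtype.ext (h.unique h' (e.trans e'.symm))]

theorem Glue.not_glue {x y z : D.Mark} (h : Glue x y) (h' : Glue y z) : False := by
  cases h <;> cases h'

end Mark

theorem Partner.unique (hκ : Function.Injective κ) {p q q' : D.RealPoint} (h : D.Partner κ p q)
    (h' : D.Partner κ p q') : q = q' := by
  have hinj := Mark.toReal_injective (D := D) hκ
  rcases h with h | h <;> rcases h' with h' | h' <;> obtain ⟨x, y, hg, e1, e2⟩ := Mark.exists_glue h <;>
    obtain ⟨x', y', hg', e1', e2'⟩ := Mark.exists_glue h'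
  · obtain rfl := hinj (e1.symm.trans e1')
    rw [e2, e2', hg.right_unique hg']
  · obtain rfl := hinj (e1.symm.trans e2')
    exact (hg'.not_glue hg).elim
  · obtain rfl := hinj (e2.symm.trans e1')
    exact (hg.not_glue hg').elim
  · obtain rfl := hinj (e2.symm.trans e2')
    rw [e1, e1', hg.left_unique hg']

theorem Partner.symm {p q : D.RealPoint} (h : D.Partner κ p q) : D.Partner κ q p := Or.symm h

/-- Together with `NextArc.left_unique` this makes the successor relation a partial injection, so
that ovals are cycles. -/
theorem NextArc.right_unique (hκ : Function.Injective κ) {p q q' : D.RealPoint}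
    (h : D.NextArc κ p q) (h' : D.NextArc κ p q') : q = q' := by
  obtain ⟨b, hb, h⟩ := h
  obtain ⟨b', hb', h'⟩ := h'
  rw [hb.end_unique hb'] at h
  exact h.unique hκ h'

theorem NextArc.left_unique (hκ : Function.Injective κ) {p p' q : D.RealPoint}
    (h : D.NextArc κ p q) (h' : D.NextArc κ p' q) : p = p' := by
  obtain ⟨b, hb, h⟩ := h
  obtain ⟨b', hb', h'⟩ := h'
  have e := h.symm.unique hκ h'.symm
  obtain ⟨e1, e2⟩ := Prod.mk.inj e
  rw [e1, e2] at hb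
  exact Prod.ext e1 (hb.start_unique hb')

end LeDiagram
end KPSoliton

/-! ### Ovals as faces of the Le-graph. -/

namespace KPSoliton
namespace LeDiagram

variable {k n : ℕ} {D : LeDiagram k n} {κ : Fin n → ℝ}

namespace Mark

/-- The order in which the ovals pass through the double points; a double point stands for the arc
that starts there. -/
inductive Next : D.Mark → D.Mark → Prop
  | zero_blackInfty (v b) (hl : D.HasLeft v.1) (h : D.Vertical v.1 b.1) :
      Next (zero v) (blackInfty b)
  | zero_base (v j) (hl : D.HasLeft v.1) (h : D.ToBoundary v.1) (e : v.1.2 = j) :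
      Next (zero v) (base j)
  | one_blackZero (v b) (e : v.1 = b.1) : Next (one v) (blackZero b)
  | one_blackOne (v b) (hv : v.1 ∉ D.boxes) (h : D.Horizontal v.1 b.1) : Next (one v) (blackOne b)
  | one_base (v j) (hv : v.1 ∉ D.boxes) (hl : ¬ D.HasLeft v.1) (e : v.1.2 = j) :
      Next (one v) (base j)
  | infty_blackOne (v b) (hv : v.1 ∈ D.boxes) (h : D.Horizontal v.1 b.1) :
      Next (infty v) (blackOne b)
  | infty_blackInfty (v b) (hl : ¬ D.HasLeft v.1) (h : D.Vertical v.1 b.1) :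
      Next (infty v) (blackInfty b)
  | infty_base (v j) (hv : v.1 ∈ D.boxes) (hl : ¬ D.HasLeft v.1) (h : D.ToBoundary v.1)
      (e : v.1.2 = j) : Next (infty v) (base j)
  | blackZero_zero (b v) (h : D.Horizontal v.1 b.1) : Next (blackZero b) (zero v)
  | blackOne_one (b v) (h : D.Vertical v.1 b.1) : Next (blackOne b) (one v)
  | blackOne_infty (b v) (h : ¬ ∃ u, D.Vertical u b.1) (e : v.1 = b.1) :
      Next (blackOne b) (infty v)
  | blackInfty_infty (b v) (h : ∃ u, D.Vertical u b.1) (e : v.1 = b.1) :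
      Next (blackInfty b) (infty v)
  | base_one (j v) (hj : ∃ x ∈ D.whites, x.2 = j) (h : D.ToBoundary v.1) (hlt : j < v.1.2)
      (hmin : ∀ x ∈ D.whites, j < x.2 → v.1.2 ≤ x.2) : Next (base j) (one v)
  | wrap (j v) (hj : ∃ x ∈ D.whites, x.2 = j) (h : D.ToBoundary v.1)
      (hmax : ∀ x ∈ D.whites, x.2 ≤ j) (hmin : ∀ x ∈ D.whites, v.1.2 ≤ x.2) :
      Next (base j) (one v)

theorem Next.nextArc (hκ : StrictMono κ) {p q : D.Mark} (h : Next p q) :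
    D.NextArc κ (p.toReal κ) (q.toReal κ) := by
  cases h with
  | zero_blackInfty v b hl h =>
    exact ⟨_, isArc_white_zero_one hl, Or.inl (.vertical v b h)⟩
  | zero_base v j hl h e =>
    subst e
    exact ⟨_, isArc_white_zero_one hl, Or.inl (.boundary v h)⟩
  | one_blackZero v b e =>
    exact ⟨_, isArc_white_one_top (e ▸ b.2), Or.inl (.middle v b e)⟩
  | one_blackOne v b hv h =>
    exact ⟨_, isArc_white_one_zero hv ⟨_, h⟩, Or.inl (.horizontal v b h)⟩
  | one_base v j hv hl e =>
    subst e
    refine ⟨_, isArc_white_one_one hv hl, Or.inl (.boundary v ?_)⟩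
    rw [eq_pivot_of_not_mem_boxes v.2 hv]
    exact toBoundary_pivot _
  | infty_blackOne v b hv h =>
    exact ⟨_, isArc_white_top_zero hv ⟨_, h⟩, Or.inl (.horizontal v b h)⟩
  | infty_blackInfty v b hl h =>
    exact ⟨_, isArc_white_top_one h.mem_boxes hl, Or.inl (.vertical v b h)⟩
  | infty_base v j hv hl h e =>
    subst e
    exact ⟨_, isArc_white_top_one hv hl, Or.inl (.boundary v h)⟩
  | blackZero_zero b v h =>
    exact ⟨_, isArc_black_zero_one, Or.inr (.horizontal v b h)⟩
  | blackOne_one b v h =>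
    exact ⟨_, isArc_black_one_top ⟨_, h⟩, Or.inr (.vertical v b h)⟩
  | blackOne_infty b v h e =>
    exact ⟨_, isArc_black_one_zero h, Or.inr (.middle v b e)⟩
  | blackInfty_infty b v h e =>
    exact ⟨_, isArc_black_top_zero h, Or.inr (.middle v b e)⟩
  | base_one j v hj h hlt hmin =>
    obtain ⟨x, hx, rfl⟩ := hj
    exact ⟨_, isArc_base hκ hx h.1 hlt hmin, Or.inr (.boundary v h)⟩
  | wrap j v hj h hmax hmin =>
    obtain ⟨x, hx, rfl⟩ := hj
    exact ⟨_, isArc_base_wrap hκ hx h.1 hmax hmin, Or.inr (.boundary v h)⟩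

/-- Every arc between double points is continued by another one. -/
theorem exists_next (p : D.Mark) (h : D.IsDouble κ (p.toReal κ)) (hκ : Function.Injective κ) :
    ∃ q, Next p q := by
  classical
  cases p with
  | zero v =>
    have hl : D.HasLeft v.1 := by simpa [toReal, isDouble_white] using h
    rcases exists_vertical_or_toBoundary v.2 with ⟨b, hb⟩ | hb
    · exact ⟨_, .zero_blackInfty v ⟨b, hb.2.1⟩ hl hb⟩
    · exact ⟨_, .zero_base v _ hl hb rfl⟩
  | one v =>
    by_cases hv : v.1 ∈ D.boxes
    · exact ⟨_, .one_blackZero v ⟨v.1, hv⟩ rfl⟩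
    by_cases hl : D.HasLeft v.1
    · obtain ⟨b, hb⟩ := hl
      exact ⟨_, .one_blackOne v ⟨b, hb.2.1⟩ hv hb⟩
    · exact ⟨_, .one_base v _ hv hl rfl⟩
  | infty v =>
    have hv : v.1 ∈ D.boxes := by simpa [toReal, isDouble_white] using h
    by_cases hl : D.HasLeft v.1
    · obtain ⟨b, hb⟩ := hl
      exact ⟨_, .infty_blackOne v ⟨b, hb.2.1⟩ hv hb⟩
    rcases exists_vertical_or_toBoundary v.2 with ⟨b, hb⟩ | hb
    · exact ⟨_, .infty_blackInfty v ⟨b, hb.2.1⟩ hl hb⟩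
    · exact ⟨_, .infty_base v _ hv hl hb rfl⟩
  | blackZero b =>
    obtain ⟨v, hv⟩ := exists_horizontal_right b.2
    exact ⟨_, .blackZero_zero b ⟨v, hv.1⟩ hv⟩
  | blackOne b =>
    by_cases hu : ∃ u, D.Vertical u b.1
    · obtain ⟨u, hu⟩ := hu
      exact ⟨_, .blackOne_one b ⟨u, hu.1⟩ hu⟩
    · exact ⟨_, .blackOne_infty b ⟨b.1, mem_whites_of_mem_boxes b.2⟩ hu rfl⟩
  | blackInfty b =>
    have hu : ∃ u, D.Vertical u b.1 := by simpa [toReal, isDouble_black] using h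
    exact ⟨_, .blackInfty_infty b ⟨b.1, mem_whites_of_mem_boxes b.2⟩ hu rfl⟩
  | base j =>
    obtain ⟨x, hx, e⟩ := isDouble_base.1 h
    obtain rfl : j = x.2 := hκ (WithTop.coe_injective e)
    by_cases hlast : ∃ y ∈ D.whites, x.2 < y.2
    · obtain ⟨w, hw, hmin⟩ := (D.whites.filter fun y => x.2 < y.2).exists_min_image Prod.snd
        (by obtain ⟨y, hy, hlt⟩ := hlast; exact ⟨y, by simp [hy, hlt]⟩)
      simp only [Finset.mem_filter] at hw hmin
      obtain ⟨u, hu, e', -⟩ := exists_toBoundary hw.1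
      exact ⟨_, .base_one _ ⟨u, hu.1⟩ ⟨x, hx, rfl⟩ hu (e' ▸ hw.2)
        fun y hy hlt => e' ▸ hmin y ⟨hy, hlt⟩⟩
    · push Not at hlast
      obtain ⟨w, hw, hmin⟩ := D.whites.exists_min_image Prod.snd ⟨x, hx⟩
      obtain ⟨u, hu, e', -⟩ := exists_toBoundary hw
      exact ⟨_, .wrap _ ⟨u, hu.1⟩ ⟨x, hx, rfl⟩ hu hlast fun y hy => e' ▸ hmin y hy⟩

theorem exists_eq_toReal {p : D.RealPoint} (h : D.IsDouble κ p) : ∃ x : D.Mark, p = x.toReal κ := by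
  obtain ⟨q, h | h⟩ := h
  · obtain ⟨x, y, -, e, -⟩ := exists_glue h
    exact ⟨x, e⟩
  · obtain ⟨x, y, -, -, e⟩ := exists_glue h
    exact ⟨y, e⟩

theorem Next.left_unique (hκ : StrictMono κ) {p p' q : D.Mark} (h : Next p q) (h' : Next p' q) :
    p = p' :=
  toReal_injective hκ.injective ((h.nextArc hκ).left_unique hκ.injective (h'.nextArc hκ))

/-- The arc starting at the last marked point of `Γ₀`, which contains `P₀`. -/
def IsLast (D : LeDiagram k n) (p : D.Mark) : Prop :=
  ∃ j, p = base j ∧ ∀ x ∈ D.whites, x.2 ≤ j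

/-! ### The finite ovals -/

/-- The pairs of rows and columns inside the face below the edge from `v` to `b`. -/
def Inner (D : LeDiagram k n) (v b u : Fin k × Fin n) : Prop :=
  v.1 < u.1 ∧ v.2 ≤ u.2 ∧ u.2 < b.2 ∧
    ∀ x ∈ D.boxes, v.1 < x.1 → x.1 < u.1 → u.2 < x.2 → x.2 ≤ b.2 → False

/-- The double points on the oval of the face below the edge from `v` to `b`. -/
def OnFace (D : LeDiagram k n) (v b : Fin k × Fin n) : D.Mark → Prop
  | zero w => w.1 = v
  | one w => w.1 = b ∨ (w.1 ∉ D.boxes ∧ Inner D v b w.1)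
  | infty w => Inner D v b w.1
  | blackZero w => w.1 = b
  | blackOne w => v.1 < w.1.1 ∧ v.2 < w.1.2 ∧ w.1.2 ≤ b.2 ∧
      ∀ x ∈ D.boxes, v.1 < x.1 → x.1 < w.1.1 → w.1.2 ≤ x.2 → x.2 ≤ b.2 → False
  | blackInfty w => Inner D v b w.1
  | base j => v.2 ≤ j ∧ j < b.2 ∧
      ∀ x ∈ D.boxes, v.1 < x.1 → j < x.2 → x.2 ≤ b.2 → j < D.pivot x.1

variable {v b : Fin k × Fin n}

/-- By the Le-rule, no box in the rows between a box and the next one below it sits to the left. -/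
theorem no_box_of_vertical {u w x : Fin k × Fin n} (h : D.Vertical u w) (hx : x ∈ D.boxes)
    (h1 : u.1 < x.1) (h2 : x.1 < w.1) (h3 : u.2 < x.2) : False := by
  have hp : D.pivot x.1 < u.2 := by
    have h4 := pivot_lt_col h.2.1
    rw [h.2.2.1] at h4
    exact (D.pivot.strictMono h2).trans h4
  have h5 := D.le_rule u.1 x.1 u.2 x.2 h1 h3 h.mem_boxes hx hp
  exact (h.2.2.2.2 _ h5 rfl h1).not_gt h2

/-- At a box, the Le-rule would otherwise produce a box below the lowest one; at a pivot vertex,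
pivots increase with the rows. -/
theorem lt_pivot_of_toBoundary {u x : Fin k × Fin n} (h : D.ToBoundary u) (hx : x ∈ D.boxes)
    (h1 : u.1 < x.1) (h3 : u.2 < x.2) : u.2 < D.pivot x.1 := by
  rcases mem_whites.1 h.1 with hu | hu
  · by_contra! hle
    have h5 := D.le_rule u.1 x.1 u.2 x.2 h1 h3 hu hx (lt_of_le_of_ne hle (col_ne_pivot hu _).symm)
    exact h.2 _ h5 rfl h1
  · rw [hu]
    exact D.pivot.strictMono h1

/-- By the Le-rule applied with `b`, such a box would create a box in the row of `v` between `v` and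
`b`. -/
theorem not_mem_boxes_of_between (hvb : D.Horizontal v b) {x : Fin k × Fin n} (hx : x ∈ D.boxes)
    (h1 : x.1 ≤ v.1) (h2 : v.2 < x.2) (h3 : x.2 < b.2) : False := by
  have hr : (v.1, x.2) ∈ D.boxes := by
    rcases h1.lt_or_eq with h1 | h1
    · have hb := hvb.2.1
      have h4 := D.le_rule x.1 v.1 x.2 b.2 h1 h3 hx (by rw [← hvb.2.2.1]; exact hb)
        ((pivot_le_col hvb.1).trans_lt h2)
      exact h4
    · rw [← h1]
      exact hx
  exact (hvb.2.2.2.2 _ hr rfl h2).not_gt h3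

/-- If the horizontal edge from `u` passed beyond the column of `b`, the Le-rule would place a box
of the row of `u` in that column, thus interrupting the edge. -/
theorem Inner.left_le (hvb : D.Horizontal v b) {u w : Fin k × Fin n} (hu : Inner D v b u)
    (huw : D.Horizontal u w) : w.2 ≤ b.2 := by
  by_contra! hlt
  have h1 : (v.1, b.2) ∈ D.boxes := by rw [← hvb.2.2.1]; exact hvb.2.1
  have h2 : (u.1, w.2) ∈ D.boxes := by rw [← huw.2.2.1]; exact huw.2.1
  have h3 := D.le_rule v.1 u.1 b.2 w.2 hu.1 hlt h1 h2 ((pivot_le_col huw.1).trans_lt hu.2.2.1)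
  exact (huw.2.2.2.2 _ h3 rfl hu.2.2.1).not_gt hlt

theorem Inner.onFace_blackOne (hvb : D.Horizontal v b) {u w : Fin k × Fin n} (hu : Inner D v b u)
    (huw : D.Horizontal u w) (hw : w ∈ D.boxes) : OnFace D v b (blackOne ⟨w, hw⟩) := by
  refine ⟨huw.2.2.1 ▸ hu.1, hu.2.1.trans_lt huw.2.2.2.1, hu.left_le hvb huw,
    fun x hx h1 h2 h3 h4 => hu.2.2.2 x hx h1 ?_ (huw.2.2.2.1.trans_le h3) h4⟩
  exact h2.trans_eq huw.2.2.1

/-- A box violating the claim is excluded above `u` because `u` is inner, in the row of `u` because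
`u` has no left edge, and below `u` by the Le-rule. -/
theorem Inner.inner_of_vertical {u w : Fin k × Fin n} (hu : Inner D v b u)
    (hl : ¬ D.HasLeft u) (huw : D.Vertical u w) : Inner D v b w := by
  refine ⟨hu.1.trans huw.2.2.2.1, huw.2.2.1 ▸ hu.2.1, huw.2.2.1 ▸ hu.2.2.1,
    fun x hx h1 h2 h3 h4 => ?_⟩
  rw [huw.2.2.1] at h3
  rcases lt_trichotomy x.1 u.1 with h | h | h
  · exact hu.2.2.2 x hx h1 h h3 h4
  · obtain ⟨c, hc, -⟩ := exists_horizontal huw.1 hx h h3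
    exact hl ⟨c, hc⟩
  · exact no_box_of_vertical huw hx h h2 h3

theorem Inner.onFace_base {u : Fin k × Fin n} (hu : Inner D v b u)
    (hl : ¬ D.HasLeft u) (hb : D.ToBoundary u) : OnFace D v b (base u.2) := by
  refine ⟨hu.2.1, hu.2.2.1, fun x hx h1 h3 h4 => ?_⟩
  rcases lt_trichotomy x.1 u.1 with h | h | h
  · exact (hu.2.2.2 x hx h1 h h3 h4).elim
  · obtain ⟨c, hc, -⟩ := exists_horizontal hb.1 hx h h3
    exact (hl ⟨c, hc⟩).elim
  · exact lt_pivot_of_toBoundary hb hx h h3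

theorem OnFace.not_isLast (hvb : D.Horizontal v b) {p : D.Mark} (hp : OnFace D v b p) :
    ¬ IsLast D p := by
  rintro ⟨j, rfl, h⟩
  exact (h b (mem_whites_of_mem_boxes hvb.2.1)).not_gt hp.2.1

/-- The description of the face is closed under the successor relation. As it admits only one mark
of `zero` type, namely that of `v`, each finite oval has a single horizontal edge as its upper side.
-/
theorem OnFace.next (hvb : D.Horizontal v b) {p q : D.Mark} (h : Next p q)
    (hp : OnFace D v b p) : OnFace D v b q := by
  cases h with
  | zero_blackInfty u w hl h =>
    obtain rfl : u.1 = v := hp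
    refine ⟨h.2.2.2.1, h.2.2.1.ge, h.2.2.1 ▸ hvb.2.2.2.1, fun x hx h1 h2 h3 _ => ?_⟩
    exact no_box_of_vertical h hx h1 h2 (h.2.2.1 ▸ h3)
  | zero_base u j hl h e =>
    obtain rfl : u.1 = v := hp
    subst e
    exact ⟨le_rfl, hvb.2.2.2.1, fun x hx h1 h2 _ => lt_pivot_of_toBoundary h hx h1 h2⟩
  | one_blackZero u w e =>
    rcases hp with hp | hp
    · exact e.symm.trans hp
    · exact absurd (e ▸ w.2) hp.1
  | one_blackOne u w hu h =>
    rcases hp with hp | hp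
    · exact absurd (hp ▸ hvb.2.1) hu
    · exact hp.2.onFace_blackOne hvb h w.2
  | one_base u j hu hl e =>
    rcases hp with hp | hp
    · exact absurd (hp ▸ hvb.2.1) hu
    · subst e
      refine hp.2.onFace_base hl ?_
      rw [eq_pivot_of_not_mem_boxes u.2 hu]
      exact toBoundary_pivot _
  | infty_blackOne u w hu h =>
    exact Inner.onFace_blackOne hvb hp h w.2
  | infty_blackInfty u w hl h => exact Inner.inner_of_vertical hp hl h
  | infty_base u j hu hl h e =>
    subst e
    exact Inner.onFace_base hp hl h
  | blackZero_zero w u h =>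
    obtain rfl : w.1 = b := hp
    exact h.left_unique hvb
  | blackOne_one w u h =>
    obtain ⟨h1, h2, h3, h4⟩ := hp
    rcases h3.lt_or_eq with h3 | h3
    -- Strictly between the columns of `v` and `b`, a box above `w` would lie either no lower than
    -- `v`, against the Le-rule, or between `v` and `w`, against the face condition. In the column
    -- of `b` it must be `b` itself.
    · exfalso
      rw [h.2.2.1] at h2 h3
      rcases le_or_gt u.1.1 v.1 with hu | hu
      · exact not_mem_boxes_of_between hvb h.mem_boxes hu h2 h3
      · exact h4 u.1 h.mem_boxes hu h.2.2.2.1 h.2.2.1.le h3.le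
    · have hrow : v.1 ≤ u.1.1 := by
        by_contra! hlt
        have := h.2.2.2.2 b hvb.2.1 (h3.symm.trans h.2.2.1) (by rw [hvb.2.2.1]; exact hlt)
        rw [hvb.2.2.1] at this
        exact this.not_gt h1
      have hrow' : ¬ v.1 < u.1.1 := fun hlt =>
        h4 u.1 h.mem_boxes hlt h.2.2.2.1 h.2.2.1.le (h.2.2.1.symm.trans h3).le
      refine Or.inl (Prod.ext ?_ (h.2.2.1.symm.trans h3))
      rw [hvb.2.2.1]
      exact le_antisymm (not_lt.1 hrow') hrow
  | blackOne_infty w u h e =>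
    obtain ⟨h1, h2, h3, h4⟩ := hp
    have hne : w.1.2 ≠ b.2 := fun e' => by
      obtain ⟨c, hc, -⟩ := exists_vertical_above w.2 hvb.2.1 e'.symm (by rw [hvb.2.2.1]; exact h1)
      exact h ⟨c, hc⟩
    change Inner D v b u.1
    rw [e]
    exact ⟨h1, h2.le, lt_of_le_of_ne h3 hne, fun x hx h5 h6 h7 => h4 x hx h5 h6 h7.le⟩
  | blackInfty_infty w u h e =>
    change Inner D v b u.1
    rw [e]
    exact hp
  | base_one j u hj h hlt hmin =>
    obtain ⟨h1, h2, h3⟩ := hp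
    have hle : u.1.2 ≤ b.2 := hmin b (mem_whites_of_mem_boxes hvb.2.1) h2
    -- The walk along `Γ₀` reaches the next occupied column. If it is a box column, its lowest
    -- vertex must be `b`; otherwise the pivot vertex of the column is inside the face.
    by_cases hu : u.1 ∈ D.boxes
    · left
      have hnot : ¬ v.1 < u.1.1 := fun hlt' => by
        have h4 := h3 u.1 hu hlt' hlt hle
        exact (hmin _ (pivot_mem_whites u.1.1) h4).not_gt (pivot_lt_col hu)
      have hcol : u.1.2 = b.2 := by
        by_contra hne
        exact not_mem_boxes_of_between hvb hu (not_lt.1 hnot) (h1.trans_lt hlt)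
          (lt_of_le_of_ne hle hne)
      refine Prod.ext (le_antisymm (by rw [hvb.2.2.1]; exact not_lt.1 hnot) ?_) hcol
      exact not_lt.1 (h.2 b hvb.2.1 hcol.symm)
    · right
      have hpiv := (mem_whites.1 u.2).resolve_left hu
      refine ⟨hu, ?_, (h1.trans_lt hlt).le, lt_of_le_of_ne hle ?_, fun x hx h4 h5 h6 h7 => ?_⟩
      · refine D.pivot.strictMono.lt_iff_lt.1 ?_
        rw [← hpiv]
        exact ((pivot_le_col hvb.1).trans h1).trans_lt hlt
      · rw [hpiv]
        exact (col_ne_pivot hvb.2.1 _).symm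
      · have h8 := h3 x hx h4 (hlt.trans h6) h7
        refine (hmin _ (pivot_mem_whites x.1) h8).not_gt ?_
        rw [hpiv]
        exact D.pivot.strictMono h5
  | wrap j u hj h hmax hmin =>
    exact absurd hp.2.1 (not_lt.2 (hmax b (mem_whites_of_mem_boxes hvb.2.1)))

/-! ### The infinite oval -/

/-- A function that increases along the ovals, except at the marked points of `zero` type and at
`P₀`. -/
def height : D.Mark → Fin n ×ₗ ℕ
  | zero v => toLex (v.1.2, 0)
  | one v => toLex (v.1.2, if v.1 ∈ D.boxes then 2 * k + 1 else 0)
  | infty v => toLex (v.1.2, 2 * v.1.1 + 1)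
  | blackZero b => toLex (b.1.2, 2 * k + 2)
  | blackOne b => toLex (b.1.2, 2 * b.1.1)
  | blackInfty b => toLex (b.1.2, 2 * b.1.1)
  | base j => toLex (j, 2 * k)

/-- Leftward steps raise the column. In a box column the second component orders the marks as they
are met: down through the boxes, to `Γ₀`, up along a vertical edge to its upper white vertex and on
to the black one; in a pivot column the vertex comes before `Γ₀`. -/
theorem Next.height_lt {p q : D.Mark} (h : Next p q) (hp : ∀ v, p ≠ zero v) (hq : ∀ v, q ≠ zero v)
    (hlast : ¬ IsLast D p) : p.height < q.height := by
  cases h with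
  | zero_blackInfty u w hl h => exact absurd rfl (hp u)
  | zero_base u j hl h e => exact absurd rfl (hp u)
  | one_blackZero u w e =>
    simp [height, Prod.Lex.toLex_lt_toLex, e]
  | one_blackOne u w hu h =>
    exact Prod.Lex.toLex_lt_toLex.2 (Or.inl h.2.2.2.1)
  | one_base u j hu hl e =>
    have := u.1.1.pos
    exact Prod.Lex.toLex_lt_toLex.2 (Or.inr ⟨e, by simp [hu]; omega⟩)
  | infty_blackOne u w hu h => exact Prod.Lex.toLex_lt_toLex.2 (Or.inl h.2.2.2.1)
  | infty_blackInfty u w hl h =>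
    have : (u.1.1 : ℕ) < w.1.1 := h.2.2.2.1
    exact Prod.Lex.toLex_lt_toLex.2 (Or.inr ⟨h.2.2.1.symm, by dsimp only; omega⟩)
  | infty_base u j hu hl h e =>
    exact Prod.Lex.toLex_lt_toLex.2 (Or.inr ⟨e, by have := u.1.1.isLt; dsimp only; omega⟩)
  | blackZero_zero w u h => exact absurd rfl (hq u)
  | blackOne_one w u h =>
    refine Prod.Lex.toLex_lt_toLex.2 (Or.inr ⟨h.2.2.1, ?_⟩)
    have := w.1.1.isLt
    dsimp only
    rw [if_pos h.mem_boxes]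
    omega
  | blackOne_infty w u h e =>
    exact Prod.Lex.toLex_lt_toLex.2 (Or.inr ⟨by rw [e], by dsimp only; rw [e]; omega⟩)
  | blackInfty_infty w u h e =>
    exact Prod.Lex.toLex_lt_toLex.2 (Or.inr ⟨by rw [e], by dsimp only; rw [e]; omega⟩)
  | base_one j u hj h hlt hmin => exact Prod.Lex.toLex_lt_toLex.2 (Or.inl hlt)
  | wrap j u hj h hmax hmin => exact absurd ⟨j, rfl, hmax⟩ hlast

end Mark
end LeDiagram
end KPSoliton

/-! ### Cycles of double points and the parity potential. -/

namespace KPSoliton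
namespace LeDiagram

variable {k n : ℕ} {D : LeDiagram k n} {κ : Fin n → ℝ}

theorem NextArc.isDouble_iff {p q : D.RealPoint} (h : Relation.EqvGen (D.NextArc κ) p q) :
    D.IsDouble κ p ↔ D.IsDouble κ q := by
  induction h with
  | rel p q h =>
    obtain ⟨b, hb, h⟩ := h
    exact ⟨fun _ => ⟨_, h.symm⟩, fun _ => hb.1⟩
  | refl => rfl
  | symm _ _ _ ih => exact ih.symm
  | trans _ _ _ _ _ ih ih' => exact ih.trans ih'

/-- An interior point of an arc is not a double point and lies on no other arc, so membership in an
oval is decided by the start of its arc. -/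
theorem mem_ovalThrough {p : D.RealPoint} {c : D.Component} {a b y : WithTop ℝ}
    (h : D.IsArc κ c a b) (hy : y ∈ openArc a b) :
    RealPoint.toPoint (D := D) (c, y) ∈ D.ovalThrough κ p ↔
      Relation.EqvGen (D.NextArc κ) p (c, a) := by
  refine ⟨?_, fun h' => ⟨_, h', b, h, y, Or.inl hy, rfl⟩⟩
  rintro ⟨⟨c', a'⟩, hq, b', hb', y', hy', e⟩
  obtain ⟨rfl, rfl⟩ := Prod.mk.inj (RealPoint.toPoint_injective e)
  rcases hy' with hy' | rfl | rfl
  · rwa [h.eq_of_mem hb' hy hy']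
  · exact absurd hb'.1 (h.2.2 _ hy)
  · exact absurd hb'.2.1 (h.2.2 _ hy)

namespace Mark

theorem Next.isDouble (hκ : StrictMono κ) {p q : D.Mark} (h : Next p q) :
    D.IsDouble κ (q.toReal κ) := by
  obtain ⟨b, -, h⟩ := h.nextArc hκ
  exact ⟨_, h.symm⟩

/-- The successor is injective on a finite set that it preserves, hence a permutation of it. -/
theorem exists_equiv (hκ : StrictMono κ) {C : Set D.Mark} (hC : ∀ p ∈ C, ∃ q ∈ C, Next p q) :
    ∃ e : C ≃ C, ∀ p : C, Next p.1 (e p).1 := by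
  choose f hf hn using hC
  have hinj : Function.Injective fun p : C => (⟨f p.1 p.2, hf p.1 p.2⟩ : C) := fun p q h => by
    have h1 := hn p.1 p.2
    have h2 := hn q.1 q.2
    rw [← show f p.1 p.2 = f q.1 q.2 from congrArg Subtype.val h] at h2
    exact Subtype.ext (h1.left_unique hκ h2)
  exact ⟨Equiv.ofBijective _ ⟨hinj, Finite.injective_iff_surjective.1 hinj⟩, fun p => hn p.1 p.2⟩

/-- Since the successor permutes `C`, the set is also closed under predecessors, hence under the
equivalence relation that defines ovals. -/
theorem mem_of_eqvGen (hκ : StrictMono κ) {C : Set D.Mark} (hC : ∀ p ∈ C, ∃ q ∈ C, Next p q)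
    {p q : D.Mark} (hp : p ∈ C)
    (h : Relation.EqvGen (D.NextArc κ) (p.toReal κ) (q.toReal κ)) : q ∈ C := by
  obtain ⟨e, he⟩ := exists_equiv hκ hC
  have key : ∀ x y, Relation.EqvGen (D.NextArc κ) x y →
      ((∃ q ∈ C, x = q.toReal κ) ↔ ∃ q ∈ C, y = q.toReal κ) := by
    intro x y hxy
    induction hxy with
    | rel x y h =>
      constructor
      · rintro ⟨q, hq, rfl⟩
        exact ⟨_, (e ⟨q, hq⟩).2, h.right_unique hκ.injective ((he ⟨q, hq⟩).nextArc hκ)⟩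
      · rintro ⟨q, hq, rfl⟩
        refine ⟨_, (e.symm ⟨q, hq⟩).2, h.left_unique hκ.injective (Next.nextArc hκ ?_)⟩
        have := he (e.symm ⟨q, hq⟩)
        rwa [e.apply_symm_apply] at this
    | refl => rfl
    | symm _ _ _ ih => exact ih.symm
    | trans _ _ _ _ _ ih ih' => exact ih.trans ih'
  obtain ⟨q', hq', e'⟩ := (key _ _ h).1 ⟨p, hp, rfl⟩
  rwa [toReal_injective hκ.injective e']

/-- The marked points on the oval through `p`. -/
def orbit (κ : Fin n → ℝ) (p : D.RealPoint) : Set D.Mark :=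
  {q | Relation.EqvGen (D.NextArc κ) p (q.toReal κ)}

noncomputable instance (p : D.RealPoint) : Fintype (orbit κ p) := Fintype.ofFinite _

variable {p : D.RealPoint}

theorem isDouble_of_mem_orbit (hp : D.IsDouble κ p) {q : D.Mark} (hq : q ∈ orbit κ p) :
    D.IsDouble κ (q.toReal κ) :=
  (NextArc.isDouble_iff hq).1 hp

theorem exists_next_mem_orbit (hκ : StrictMono κ) (hp : D.IsDouble κ p) {q : D.Mark}
    (hq : q ∈ orbit κ p) : ∃ q' ∈ orbit κ p, Next q q' := by
  obtain ⟨q', h⟩ := exists_next q (isDouble_of_mem_orbit hp hq) hκ.injective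
  exact ⟨q', Relation.EqvGen.trans _ _ _ hq (.rel _ _ (h.nextArc hκ)), h⟩

theorem onFace_of_mem_orbit (hκ : StrictMono κ) {v : {v // v ∈ D.whites}} {b : Fin k × Fin n}
    (hvb : D.Horizontal v.1 b) (hv : zero v ∈ orbit κ p) {q : D.Mark} (hq : q ∈ orbit κ p) :
    OnFace D v.1 b q := by
  let C : Set D.Mark := {q | OnFace D v.1 b q ∧ D.IsDouble κ (q.toReal κ)}
  have hC : ∀ q ∈ C, ∃ q' ∈ C, Next q q' := fun q hq => by
    obtain ⟨q', h⟩ := exists_next q hq.2 hκ.injective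
    exact ⟨q', ⟨hq.1.next hvb h, h.isDouble hκ⟩, h⟩
  have hvC : zero v ∈ C := ⟨rfl, isDouble_white.2 (Or.inl ⟨rfl, b, hvb⟩)⟩
  exact (mem_of_eqvGen hκ hC hvC (.trans _ _ _ (.symm _ _ hv) hq)).1

theorem hasLeft_of_mem_orbit (hp : D.IsDouble κ p) {v : {v // v ∈ D.whites}}
    (hv : zero v ∈ orbit κ p) : D.HasLeft v.1 := by
  have h := isDouble_of_mem_orbit hp hv
  simpa [toReal, isDouble_white] using h

/-- Otherwise the successor of a mark of maximal height on the oval would be higher still. -/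
theorem exists_zero_or_isLast (hκ : StrictMono κ) (hp : D.IsDouble κ p) :
    (∃ v, zero v ∈ orbit κ p) ∨ ∃ q ∈ orbit κ p, IsLast D q := by
  by_contra! hcon
  obtain ⟨x, rfl⟩ := exists_eq_toReal hp
  obtain ⟨q, hq, hmax⟩ := (orbit κ (x.toReal κ)).toFinite.exists_maximalFor height _
    ⟨x, Relation.EqvGen.refl _⟩
  obtain ⟨q', hq', h⟩ := exists_next_mem_orbit hκ hp hq
  have hlt := h.height_lt (fun v e => hcon.1 v (e ▸ hq)) (fun v e => hcon.1 v (e ▸ hq'))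
    (hcon.2 q hq)
  exact (hmax hq' hlt.le).not_gt hlt

theorem isLast_unique (hκ : Function.Injective κ) {q q' : D.Mark} (h : IsLast D q)
    (h' : IsLast D q') (hd : D.IsDouble κ (q.toReal κ)) (hd' : D.IsDouble κ (q'.toReal κ)) :
    q = q' := by
  obtain ⟨j, rfl, hj⟩ := h
  obtain ⟨j', rfl, hj'⟩ := h'
  obtain ⟨x, hx, e⟩ := isDouble_base.1 hd
  obtain ⟨x', hx', e'⟩ := isDouble_base.1 hd'
  obtain rfl : j = x.2 := hκ (WithTop.coe_injective e)
  obtain rfl : j' = x'.2 := hκ (WithTop.coe_injective e')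
  rw [le_antisymm (hj' x hx) (hj x' hx')]

theorem P0_mem_iff (hκ : StrictMono κ) (hk : 0 < k) (hp : D.IsDouble κ p) :
    D.P0 ∈ D.ovalThrough κ p ↔ ∃ q ∈ orbit κ p, IsLast D q := by
  obtain ⟨w, hw, hmax⟩ := D.whites.exists_max_image Prod.snd ⟨_, pivot_mem_whites ⟨0, hk⟩⟩
  obtain ⟨u, hu, hmin⟩ := D.whites.exists_min_image Prod.snd ⟨_, pivot_mem_whites ⟨0, hk⟩⟩
  have harc := isArc_base_wrap hκ hw hu hmax hmin
  have hlast : IsLast D (base w.2) := ⟨w.2, rfl, hmax⟩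
  have hmem : D.P0 ∈ D.ovalThrough κ p ↔ base w.2 ∈ orbit κ p := by
    refine mem_ovalThrough (y := ⊤) harc (mem_openArc.2 (Or.inr ⟨?_, Or.inl (WithTop.coe_lt_top _)⟩))
    rw [WithTop.coe_lt_coe, hκ.lt_iff_lt]
    exact (hmin w hw).not_gt
  rw [hmem]
  refine ⟨fun h => ⟨_, h, hlast⟩, ?_⟩
  rintro ⟨q, hq, hql⟩
  rwa [isLast_unique hκ.injective hlast hql harc.1 (isDouble_of_mem_orbit hp hq)]

/-! ### Parity -/

variable {γ : Fin k × Fin n → ℝ}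

/-- The number of pivots to the right of the column `j`. -/
def pivotsBefore (D : LeDiagram k n) (j : Fin n) : ℕ :=
  (Finset.univ.filter fun s => D.pivot s < j).card

/-- The number of pivots not to the left of the column `j`. -/
def pivotsUpTo (D : LeDiagram k n) (j : Fin n) : ℕ :=
  (Finset.univ.filter fun s => D.pivot s ≤ j).card

theorem pivotsUpTo_of_ne {j : Fin n} (h : ∀ r, j ≠ D.pivot r) :
    pivotsUpTo D j = pivotsBefore D j := by
  rw [pivotsUpTo, pivotsBefore]
  congr 1
  ext s
  simp only [Finset.mem_filter, Finset.mem_univ, true_and]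
  exact ⟨fun h' => lt_of_le_of_ne h' (h s).symm, le_of_lt⟩

theorem pivotsUpTo_pivot (r : Fin k) :
    pivotsUpTo D (D.pivot r) = pivotsBefore D (D.pivot r) + 1 := by
  rw [pivotsUpTo, pivotsBefore, ← Finset.card_insert_of_notMem (a := r) (by simp)]
  congr 1
  ext s
  simp [le_iff_lt_or_eq, or_comm]

theorem pivotsBefore_eq_add {i j : Fin n} (h : i < j) :
    pivotsBefore D j = pivotsUpTo D i + D.pivotsBetween i j := by
  rw [pivotsBefore, pivotsUpTo, pivotsBetween, ← Finset.card_union_of_disjoint]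
  · congr 1
    ext s
    simp only [Finset.mem_filter, Finset.mem_univ, true_and, Finset.mem_union]
    constructor
    · intro h1
      rcases le_or_gt (D.pivot s) i with h2 | h2
      · exact Or.inl h2
      · exact Or.inr ⟨h2, h1⟩
    · rintro (h1 | h1)
      · exact h1.trans_lt h
      · exact h1.2
  · rw [Finset.disjoint_filter]
    exact fun s _ h1 h2 => h2.1.not_ge h1

/-- `0` or `1` according to whether the divisor point lies in `(0, 1)` or not. -/
noncomputable def signBit (γ : Fin k × Fin n → ℝ) (v : Fin k × Fin n) : ZMod 2 :=
  if 0 < γ v then 0 else 1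

end Mark

/-- The sign of the divisor coordinate records the parity of the pivots under the horizontal edge,
which is the change of the potential across this edge. -/
theorem IsVacuumNetwork.pivotsBefore_eq {a : Fin k × Fin n → Fin n → ℝ}
    {γ : Fin k × Fin n → ℝ} (h : D.IsVacuumNetwork a γ) {v b : Fin k × Fin n}
    (hvb : D.Horizontal v b) :
    (Mark.pivotsBefore D b.2 : ZMod 2) = Mark.pivotsUpTo D v.2 + Mark.signBit γ v := by
  rw [Mark.pivotsBefore_eq_add hvb.2.2.2.1, Nat.cast_add, Mark.signBit]
  congr 1
  rcases Nat.even_or_odd (D.pivotsBetween v.2 b.2) with he | ho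
  · rw [if_pos (h.gamma_pos v b hvb he).1, ZMod.natCast_eq_zero_iff_even.2 he]
  · rw [if_neg (h.gamma_neg v b hvb ho).le.not_gt, ZMod.natCast_eq_one_iff_odd.2 ho]

namespace Mark

variable {γ : Fin k × Fin n → ℝ}

open Classical in
/-- The start of the arc that contains the divisor point on the component of `v`. -/
noncomputable def start (γ : Fin k × Fin n → ℝ) (v : {v // v ∈ D.whites}) : D.Mark :=
  if 0 < γ v.1 then zero v else if v.1 ∈ D.boxes then infty v else one v

open Classical in
/-- The number of divisor and Darboux points on the arc starting at a marked point, modulo `2`. -/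
noncomputable def weight (γ : Fin k × Fin n → ℝ) : D.Mark → ZMod 2
  | zero v => if D.HasLeft v.1 then 1 + signBit γ v.1 else 0
  | one v => if v.1 ∈ D.boxes then 0 else 1 + if D.HasLeft v.1 then signBit γ v.1 else 0
  | infty v => if v.1 ∈ D.boxes ∧ D.HasLeft v.1 then signBit γ v.1 else 0
  | _ => 0

/-- The number of pivots to the right of the face, modulo `2`, near a marked point. -/
noncomputable def level (γ : Fin k × Fin n → ℝ) : D.Mark → ZMod 2
  | zero v => pivotsUpTo D v.1.2 + signBit γ v.1
  | one v => pivotsBefore D v.1.2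
  | infty v => pivotsBefore D v.1.2
  | blackZero b => pivotsBefore D b.1.2
  | blackOne b => pivotsBefore D b.1.2
  | blackInfty b => pivotsBefore D b.1.2
  | base j => pivotsUpTo D j

open Classical in
-- The weight is the increment of the potential `level` along the oval, apart from two corrections:
-- one unit at each mark of `zero` type, and `k` at P₀, where the number of pivots to the right
-- drops from `k` to 0.
theorem Next.weight_eq {a : Fin k × Fin n → Fin n → ℝ} (hγ : D.IsVacuumNetwork a γ)
    {p q : D.Mark} (h : Next p q) : weight γ p = level γ q - level γ p +
      (if ∃ v, p = zero v then 1 else 0) + if IsLast D p then (k : ZMod 2) else 0 := by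
  have hlast : ∀ p : D.Mark, (∀ j, p ≠ base j) → ¬ IsLast D p := by
    rintro p hp ⟨j, rfl, -⟩
    exact hp j rfl
  have htwo : ∀ x : ZMod 2, x + x = 0 := CharTwo.add_self_eq_zero
  have hbox : ∀ b ∈ D.boxes, pivotsUpTo D b.2 = pivotsBefore D b.2 := fun b hb =>
    pivotsUpTo_of_ne (col_ne_pivot hb)
  have hpiv : ∀ v ∈ D.whites, v ∉ D.boxes → pivotsUpTo D v.2 = pivotsBefore D v.2 + 1 :=
    fun v hv hv' => by
      rw [(mem_whites.1 hv).resolve_left hv']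
      exact pivotsUpTo_pivot _
  cases h with
  | zero_blackInfty u w hl h =>
    rw [if_neg (hlast _ (by simp))]
    simp only [weight, level, hl, if_true, zero.injEq, exists_eq', h.2.2.1, hbox _ h.mem_boxes]
    linear_combination htwo (signBit γ u.1)
  | zero_base u j hl h e =>
    subst e
    rw [if_neg (hlast _ (by simp))]
    simp only [weight, level, hl, if_true, zero.injEq, exists_eq']
    linear_combination htwo (signBit γ u.1)
  | one_blackZero u w e =>
    rw [if_neg (hlast _ (by simp))]
    simp [weight, level, e]
  | one_blackOne u w hu h =>
    rw [if_neg (hlast _ (by simp))]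
    have hl : D.HasLeft u.1 := ⟨_, h⟩
    have h1 := hγ.pivotsBefore_eq h
    rw [hpiv _ u.2 hu] at h1
    simp [weight, level, hl, hu, h1]
    ring
  | one_base u j hu hl e =>
    subst e
    rw [if_neg (hlast _ (by simp))]
    simp [weight, level, hl, hu, hpiv _ u.2 hu]
  | infty_blackOne u w hu h =>
    rw [if_neg (hlast _ (by simp))]
    have hl : D.HasLeft u.1 := ⟨_, h⟩
    have h1 := hγ.pivotsBefore_eq h
    rw [hbox _ hu] at h1
    simp [weight, level, hl, hu, h1]
  | infty_blackInfty u w hl h =>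
    rw [if_neg (hlast _ (by simp))]
    simp [weight, level, hl, h.2.2.1]
  | infty_base u j hu hl h e =>
    subst e
    rw [if_neg (hlast _ (by simp))]
    simp [weight, level, hl, hbox _ hu]
  | blackZero_zero w u h =>
    rw [if_neg (hlast _ (by simp))]
    simp [weight, level, hγ.pivotsBefore_eq h]
  | blackOne_one w u h =>
    rw [if_neg (hlast _ (by simp))]
    simp [weight, level, h.2.2.1]
  | blackOne_infty w u h e =>
    rw [if_neg (hlast _ (by simp))]
    simp [weight, level, e]
  | blackInfty_infty w u h e =>
    rw [if_neg (hlast _ (by simp))]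
    simp [weight, level, e]
  | base_one j u hj h hlt hmin =>
    have hnot : ¬ IsLast D (base j) := by
      rintro ⟨j', e, h'⟩
      rw [base.injEq] at e
      subst e
      exact (h' _ u.2).not_gt hlt
    rw [if_neg hnot]
    have h1 : D.pivotsBetween j u.1.2 = 0 := by
      rw [pivotsBetween, Finset.card_eq_zero, Finset.filter_eq_empty_iff]
      exact fun s _ h => (hmin _ (pivot_mem_whites s) h.1).not_gt h.2
    simp [weight, level, pivotsBefore_eq_add hlt, h1]
  | wrap j u hj h hmax hmin =>
    have hlast' : IsLast D (base j) := ⟨j, rfl, hmax⟩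
    rw [if_pos hlast']
    have h1 : pivotsBefore D u.1.2 = 0 := by
      rw [pivotsBefore, Finset.card_eq_zero, Finset.filter_eq_empty_iff]
      exact fun s _ => (hmin _ (pivot_mem_whites s)).not_gt
    have h2 : pivotsUpTo D j = k := by
      rw [pivotsUpTo, Finset.filter_true_of_mem fun s _ => hmax _ (pivot_mem_whites s)]
      simp
    simp [weight, level, h1, h2, htwo]

theorem card_filter_eq_and {α : Type*} [Fintype α] (x : α) (P : Prop) [DecidablePred fun y => y = x ∧ P]
    [Decidable P] : (Finset.univ.filter fun y => y = x ∧ P).card = if P then 1 else 0 := by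
  classical
  by_cases hP : P
  · simp only [hP, and_true, if_true]
    exact Finset.card_eq_one.2 ⟨x, by ext; simp⟩
  · simp [hP]

theorem start_eq_zero {v w : {v // v ∈ D.whites}} : start γ v = zero w ↔ v = w ∧ 0 < γ w.1 := by
  rw [start]
  split_ifs with h1 h2
  · rw [zero.injEq]
    exact ⟨fun e => ⟨e, e ▸ h1⟩, And.left⟩
  · simp only [false_iff]
    rintro ⟨rfl, h⟩
    exact h1 h
  · simp only [false_iff]
    rintro ⟨rfl, h⟩
    exact h1 h

theorem start_eq_infty {v w : {v // v ∈ D.whites}} :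
    start γ v = infty w ↔ v = w ∧ ¬ 0 < γ w.1 ∧ w.1 ∈ D.boxes := by
  rw [start]
  split_ifs with h1 h2
  · simp only [false_iff]
    rintro ⟨rfl, h, -⟩
    exact h h1
  · rw [infty.injEq]
    exact ⟨fun e => ⟨e, e ▸ h1, e ▸ h2⟩, And.left⟩
  · simp only [false_iff]
    rintro ⟨rfl, -, h⟩
    exact h2 h

theorem start_eq_one {v w : {v // v ∈ D.whites}} :
    start γ v = one w ↔ v = w ∧ ¬ 0 < γ w.1 ∧ w.1 ∉ D.boxes := by
  rw [start]
  split_ifs with h1 h2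
  · simp only [false_iff]
    rintro ⟨rfl, h, -⟩
    exact h h1
  · simp only [false_iff]
    rintro ⟨rfl, -, h⟩
    exact h h2
  · rw [one.injEq]
    exact ⟨fun e => ⟨e, e ▸ h1, e ▸ h2⟩, And.left⟩

open Classical in
theorem weight_eq_card (p : D.Mark) : weight γ p =
    ((Finset.univ.filter fun v : {v // v ∈ D.whites} => D.HasLeft v.1 ∧ start γ v = p).card +
      (Finset.univ.filter fun r : Fin k => one (D.source r) = p).card : ℕ) := by
  have hsrc : ∀ w : {v // v ∈ D.whites},
      (Finset.univ.filter fun r : Fin k => one (D.source r) = one w).card =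
        if w.1 ∈ D.boxes then 0 else 1 := fun w => by
    have h1 : ∀ r : Fin k, one (D.source r) = one w ↔ r = w.1.1 ∧ ¬ w.1 ∈ D.boxes := fun r => by
      rw [one.injEq]
      constructor
      · rintro rfl
        exact ⟨rfl, fun h => col_ne_pivot h r rfl⟩
      · rintro ⟨rfl, h⟩
        exact Subtype.ext (eq_pivot_of_not_mem_boxes w.2 h).symm
    simp_rw [h1, card_filter_eq_and, ite_not]
  have hst : ∀ (p : D.Mark) (w : {v // v ∈ D.whites}) (Q : Prop),
      (∀ v, start γ v = p ↔ v = w ∧ Q) →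
      (Finset.univ.filter fun v : {v // v ∈ D.whites} => D.HasLeft v.1 ∧ start γ v = p).card =
        if D.HasLeft w.1 ∧ Q then 1 else 0 := fun p w Q h => by
    rw [← card_filter_eq_and w]
    congr 1
    ext v
    simp only [Finset.mem_filter, Finset.mem_univ, true_and, h v]
    constructor
    · rintro ⟨h1, rfl, h2⟩
      exact ⟨rfl, h1, h2⟩
    · rintro ⟨rfl, h1, h2⟩
      exact ⟨h1, rfl, h2⟩
  have hne : ∀ p : D.Mark, (∀ v, p ≠ zero v ∧ p ≠ one v ∧ p ≠ infty v) →
      (Finset.univ.filter fun v : {v // v ∈ D.whites} => D.HasLeft v.1 ∧ start γ v = p).card = 0 ∧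
      (Finset.univ.filter fun r : Fin k => one (D.source r) = p).card = 0 := fun p hp => by
    constructor
    · rw [Finset.card_eq_zero, Finset.filter_eq_empty_iff]
      rintro v - ⟨-, e⟩
      rw [start] at e
      split_ifs at e
      · exact (hp v).1 e.symm
      · exact (hp v).2.2 e.symm
      · exact (hp v).2.1 e.symm
    · rw [Finset.card_eq_zero, Finset.filter_eq_empty_iff]
      exact fun r _ e => (hp _).2.1 e.symm
  cases p with
  | zero w =>
    rw [hst _ w _ fun v => start_eq_zero, weight, signBit]
    by_cases h1 : D.HasLeft w.1 <;> by_cases h2 : 0 < γ w.1 <;> simp [h1, h2, CharTwo.add_self_eq_zero]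
  | one w =>
    rw [hst _ w _ fun v => start_eq_one, hsrc, weight, signBit]
    by_cases h1 : D.HasLeft w.1 <;> by_cases h2 : 0 < γ w.1 <;> by_cases h3 : w.1 ∈ D.boxes <;>
      simp [h1, h2, h3, one_add_one_eq_two]
  | infty w =>
    rw [hst _ w _ fun v => start_eq_infty, weight, signBit]
    by_cases h1 : D.HasLeft w.1 <;> by_cases h2 : 0 < γ w.1 <;> by_cases h3 : w.1 ∈ D.boxes <;>
      simp [h1, h2, h3]
  | blackZero w => rw [(hne _ (by simp)).1, (hne _ (by simp)).2]; simp [weight]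
  | blackOne w => rw [(hne _ (by simp)).1, (hne _ (by simp)).2]; simp [weight]
  | blackInfty w => rw [(hne _ (by simp)).1, (hne _ (by simp)).2]; simp [weight]
  | base w => rw [(hne _ (by simp)).1, (hne _ (by simp)).2]; simp [weight]

end Mark

end LeDiagram
end KPSoliton

/-! ### Parity of the divisor and Darboux points on each oval. -/

namespace KPSoliton
namespace LeDiagram

variable {k n : ℕ} {D : LeDiagram k n} {κ : Fin n → ℝ} {γ : Fin k × Fin n → ℝ}
  {a : Fin k × Fin n → Fin n → ℝ}

namespace Mark

variable {p : D.RealPoint}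

/-- On a source component ∞ is not a double point, so the Darboux point is interior to the arc that
starts at 1. -/
theorem darboux_mem_iff (r : Fin k) :
    D.darboux r ∈ D.ovalThrough κ p ↔ one (D.source r) ∈ orbit κ p := by
  have hr : (D.source r).1 ∉ D.boxes := fun h => col_ne_pivot h r rfl
  have h0 : D.darboux r = RealPoint.toPoint (D := D) (.white (D.source r), ⊤) := rfl
  rw [h0]
  by_cases hl : D.HasLeft (D.source r).1
  · refine mem_ovalThrough (isArc_white_one_zero hr hl) (mem_openArc.2 (Or.inr ⟨?_, Or.inl ?_⟩))
    · rw [WithTop.coe_lt_coe]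
      norm_num
    · exact WithTop.coe_lt_top _
  · exact mem_ovalThrough (isArc_white_one_one hr hl)
      (mem_openArc.2 (Or.inr ⟨lt_irrefl _, Or.inl (WithTop.coe_lt_top _)⟩))

end Mark

/-- The coordinate is less than 1 and nonzero, hence lies in `(0, 1)` or is negative; in the second
case the arc starts at ∞ or, if ∞ is not a double point, at 1. -/
theorem IsVacuumNetwork.exists_isArc_start (h : D.IsVacuumNetwork a γ) {v : {v // v ∈ D.whites}}
    (hv : D.HasLeft v.1) : ∃ x b, (Mark.start γ v).toReal κ = (.white v, x) ∧
      D.IsArc κ (.white v) x b ∧ ((γ v.1 : ℝ) : WithTop ℝ) ∈ openArc x b := by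
  have h1 := h.gamma_lt_one hv
  have h0 := h.gamma_ne_zero hv
  rw [Mark.start]
  split_ifs with hpos hbox
  · refine ⟨_, _, rfl, isArc_white_zero_one hv, mem_openArc.2 (Or.inl ?_)⟩
    simp only [WithTop.coe_lt_coe]
    exact ⟨one_pos, hpos, h1⟩
  · refine ⟨_, _, rfl, isArc_white_top_zero hbox hv, mem_openArc.2 (Or.inr ⟨not_top_lt, Or.inr ?_⟩)⟩
    exact WithTop.coe_lt_coe.2 (lt_of_le_of_ne (not_lt.1 hpos) h0)
  · refine ⟨_, _, rfl, isArc_white_one_zero hbox hv, mem_openArc.2 (Or.inr ⟨?_, Or.inr ?_⟩)⟩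
    · rw [WithTop.coe_lt_coe]
      norm_num
    · exact WithTop.coe_lt_coe.2 (lt_of_le_of_ne (not_lt.1 hpos) h0)

theorem IsVacuumNetwork.whitePoint_mem_iff (h : D.IsVacuumNetwork a γ) {p : D.RealPoint}
    {v : {v // v ∈ D.whites}} (hv : D.HasLeft v.1) :
    D.whitePoint γ v ∈ D.ovalThrough κ p ↔ Mark.start γ v ∈ Mark.orbit κ p := by
  obtain ⟨x, b, e, harc, hmem⟩ := h.exists_isArc_start (κ := κ) hv
  rw [Mark.orbit, Set.mem_ofPred_eq, e]
  exact mem_ovalThrough harc hmem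

open Classical in
theorem IsVacuumNetwork.degreeOn_add_darbouxCount (h : D.IsVacuumNetwork a γ) (p : D.RealPoint) :
    ((degreeOn (D.divisor γ) (D.ovalThrough κ p) + D.darbouxCount (D.ovalThrough κ p) : ℕ) :
      ZMod 2) = ∑ q : Mark.orbit κ p, Mark.weight γ q.1 := by
  have hfin : Fintype D.Mark := Fintype.ofFinite _
  let O : Finset D.Mark := Finset.univ.filter (· ∈ Mark.orbit κ p)
  have hO : ∀ q, q ∈ O ↔ q ∈ Mark.orbit κ p := fun q => by simp [O]
  have h1 : degreeOn (D.divisor γ) (D.ovalThrough κ p) = ∑ q ∈ O,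
      (Finset.univ.filter fun v : {v // v ∈ D.whites} => D.HasLeft v.1 ∧ Mark.start γ v = q).card := by
    rw [degreeOn_divisor, Finset.card_eq_sum_card_fiberwise (f := Mark.start γ) (t := O)]
    · refine Finset.sum_congr rfl fun q hq => congrArg _ ?_
      ext v
      simp only [Finset.mem_filter, Finset.mem_univ, true_and]
      constructor
      · rintro ⟨⟨h1, -⟩, h2⟩
        exact ⟨h1, h2⟩
      · rintro ⟨h1, rfl⟩
        exact ⟨⟨h1, (h.whitePoint_mem_iff h1).2 ((hO _).1 hq)⟩, rfl⟩
    · intro v hv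
      simp only [Finset.coe_filter, Finset.mem_univ, true_and, Set.mem_ofPred_eq] at hv
      exact (hO _).2 ((h.whitePoint_mem_iff hv.1).1 hv.2)
  have h2 : D.darbouxCount (D.ovalThrough κ p) = ∑ q ∈ O,
      (Finset.univ.filter fun r : Fin k => Mark.one (D.source r) = q).card := by
    rw [darbouxCount, Set.ncard_eq_toFinset_card', Finset.card_eq_sum_card_fiberwise
      (f := fun r => Mark.one (D.source r)) (t := O)]
    · refine Finset.sum_congr rfl fun q hq => congrArg _ ?_
      ext r
      simp only [Finset.mem_filter, Set.mem_toFinset, Set.mem_ofPred_eq, Finset.mem_univ, true_and]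
      refine ⟨And.right, ?_⟩
      rintro rfl
      exact ⟨(Mark.darboux_mem_iff r).2 ((hO _).1 hq), rfl⟩
    · intro r hr
      simp only [Set.coe_toFinset, Set.mem_ofPred_eq] at hr
      exact (hO _).2 ((Mark.darboux_mem_iff r).1 hr)
  rw [h1, h2, ← Finset.sum_add_distrib, Nat.cast_sum, ← Finset.sum_subtype O hO]
  exact Finset.sum_congr rfl fun q _ => (Mark.weight_eq_card q).symm

open Classical in
-- The potential differences telescope, because the successor permutes the marks of the oval.
theorem IsVacuumNetwork.sum_weight (h : D.IsVacuumNetwork a γ) (hκ : StrictMono κ)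
    {p : D.RealPoint} (hp : D.IsDouble κ p) : ∑ q : Mark.orbit κ p, Mark.weight γ q.1 =
      (∑ q : Mark.orbit κ p, if ∃ v, q.1 = Mark.zero v then (1 : ZMod 2) else 0) +
        ∑ q : Mark.orbit κ p, if Mark.IsLast D q.1 then (k : ZMod 2) else 0 := by
  obtain ⟨e, he⟩ := Mark.exists_equiv hκ (C := Mark.orbit κ p)
    fun q hq => Mark.exists_next_mem_orbit hκ hp hq
  have h1 : ∑ q : Mark.orbit κ p, Mark.level γ (e q).1 = ∑ q : Mark.orbit κ p, Mark.level γ q.1 :=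
    Equiv.sum_comp e fun q : Mark.orbit κ p => Mark.level γ q.1
  rw [Finset.sum_congr rfl fun q _ => Mark.Next.weight_eq h (he q), Finset.sum_add_distrib,
    Finset.sum_add_distrib, Finset.sum_sub_distrib, h1, sub_self, zero_add]

theorem IsVacuumNetwork.isRealRegularDivisor (h : D.IsVacuumNetwork a γ) (hκ : StrictMono κ)
    (hk : 0 < k) : D.IsRealRegularDivisor κ (D.divisor γ) where
  degree_eq := by
    classical
    rw [degreeOn_divisor, ← card_hasLeft]
    simp only [Set.mem_univ, and_true]
  off_base x hx := h.not_onBase (Finsupp.mem_support_iff.1 hx)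
  on_ovals x hx := by
    obtain ⟨v, hv, rfl⟩ := divisor_ne_zero (Finsupp.mem_support_iff.1 hx)
    obtain ⟨y, b, e, harc, -⟩ := h.exists_isArc_start (κ := κ) hv
    refine ⟨_, ⟨(Mark.start γ v).toReal κ, e ▸ harc.1, rfl⟩, ?_⟩
    exact (h.whitePoint_mem_iff hv).2 (Relation.EqvGen.refl _)
  one_point v hv := by
    classical
    rw [degreeOn_divisor, Finset.card_eq_one]
    refine ⟨v, ?_⟩
    ext w
    simp only [Finset.mem_filter, Finset.mem_univ, true_and, Finset.mem_singleton,
      Set.mem_ofPred_eq, whitePoint, Component.white.injEq]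
    exact ⟨And.right, fun e => ⟨e ▸ hv, e⟩⟩
  finite_oval := by
    classical
    rintro S ⟨p, hp, rfl⟩ hP
    rw [Mark.P0_mem_iff hκ hk hp] at hP
    push Not at hP
    rw [← ZMod.natCast_eq_one_iff_odd, h.degreeOn_add_darbouxCount, h.sum_weight hκ hp]
    -- An oval without P₀ has a mark of `zero` type, and by the face description only one, so the
    -- total is 1.
    obtain ⟨v, hv⟩ := (Mark.exists_zero_or_isLast hκ hp).resolve_right (by simpa using hP)
    obtain ⟨b, hb⟩ := Mark.hasLeft_of_mem_orbit hp hv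
    rw [Fintype.sum_eq_single (⟨Mark.zero v, hv⟩ : Mark.orbit κ p), if_pos ⟨v, rfl⟩,
      Finset.sum_eq_zero fun q _ => if_neg (hP q.1 q.2), add_zero]
    rintro ⟨q, hq⟩ hne
    refine if_neg ?_
    rintro ⟨w, e⟩
    obtain rfl : q = Mark.zero w := e
    have h1 : w.1 = v.1 := Mark.onFace_of_mem_orbit hκ hb hv hq
    exact hne (by rw [Subtype.mk.injEq, Subtype.ext h1])
  infinite_oval := by
    classical
    rintro S ⟨p, hp, rfl⟩ hP
    -- A mark of `zero` type would confine the oval to a face away from P₀. So the total is the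
    -- single contribution `k`, which cancels against the added `k`.
    obtain ⟨q, hq, hql⟩ := (Mark.P0_mem_iff hκ hk hp).1 hP
    rw [← ZMod.natCast_eq_zero_iff_even, Nat.cast_add, h.degreeOn_add_darbouxCount,
      h.sum_weight hκ hp, Finset.sum_eq_zero, Fintype.sum_eq_single (⟨q, hq⟩ : Mark.orbit κ p),
      if_pos hql, zero_add, CharTwo.add_self_eq_zero]
    · rintro ⟨q', hq'⟩ hne
      refine if_neg fun hql' => hne ?_
      rw [Subtype.mk.injEq]
      exact Mark.isLast_unique hκ.injective hql' hql (Mark.isDouble_of_mem_orbit hp hq')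
        (Mark.isDouble_of_mem_orbit hp hq)
    · rintro ⟨q', hq'⟩ -
      refine if_neg ?_
      rintro ⟨w, e⟩
      obtain rfl : q' = Mark.zero w := e
      obtain ⟨b, hb⟩ := Mark.hasLeft_of_mem_orbit hp hq'
      exact (Mark.onFace_of_mem_orbit hκ hb hq' hq).not_isLast hb hql

end LeDiagram
end KPSoliton

/-! ### The main theorem. -/

open KPSoliton
theorem theorem3p1 {k n : ℕ} (hk : 0 < k) (hkn : k < n) (κ : Fin n → ℝ) (hκ : StrictMono κ)
    (A R : Matrix (Fin k) (Fin n) ℝ) (hA : IsTNN A) (hR : IsRREF R) (hAR : SamePoint A R) :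
    (∃ D : LeDiagram k n, D.Represents R) ∧
    ∀ D : LeDiagram k n, D.Represents R →
      ∃ t₀ : RealTimes, (∀ r, generator κ R r t₀.toComplex ≠ 0) ∧
        ∃ (δ : D.Point →₀ ℕ) (φ : D.Point → Times → OnePoint ℂ),
          D.IsRealRegularDivisor κ δ ∧
          D.IsVacuumWaveFunction κ t₀ δ φ ∧
          D.HasDarbouxValues κ R t₀ φ ∧
          (∀ x, δ x ≠ 0 → ∃ t : RealTimes, φ x t.toComplex = OnePoint.infty) ∧
          (∀ ψ : D.Point → Times → OnePoint ℂ, D.IsVacuumWaveFunction κ t₀ δ ψ →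
            D.HasDarbouxValues κ R t₀ ψ → ∀ x, x ≠ D.P0 → ψ x = φ x) ∧
          (∀ (δ' : D.Point →₀ ℕ) (ψ : D.Point → Times → OnePoint ℂ),
            D.IsRealRegularDivisor κ δ' → D.IsVacuumWaveFunction κ t₀ δ' ψ →
            D.HasDarbouxValues κ R t₀ ψ → δ' = δ) := by
  refine ⟨LeDiagram.exists_represents hA hR hAR, fun D hD => ?_⟩
  obtain ⟨t₀, ht₀, a, γ, h, hgen⟩ := LeDiagram.exists_isVacuumNetwork hD hκ
  have hdiv := h.isRealRegularDivisor hκ hk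
  refine ⟨t₀, ht₀, D.divisor γ, D.wave κ t₀ a γ, hdiv, h.isVacuumWaveFunction, fun r t => ?_,
    fun x hx => h.exists_wave_eq_infty hκ.injective hx, fun ψ hψ hdar => ?_,
    fun δ' ψ hδ' hψ hdar => ?_⟩
  · rw [hgen]
    exact LeDiagram.wave_white_infty _ _
  · exact (h.unique hκ.injective hdiv hψ fun r t => (hdar r t).trans (by rw [hgen]; rfl)).2
  · exact (h.unique hκ.injective hδ' hψ fun r t => (hdar r t).trans (by rw [hgen]; rfl)).1
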